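/- For words $w,w'$ in the letters $X,X^*$ (the empty word included) let $K_{w,w'}$ be the set of oriented Kauffman diagrams of type $(w,w')$: isotopy classes of systems of disjoint oriented planar strings without closed loops in a rectangle, joining in pairs the upper boundary points, labelled by $w$, and the lower ones, labelled by $w'$, such that strings start at the upper points labelled $X$ and the lower points labelled $X^*$ and end at the other boundary points. For $d\in\mathbb C$ let $\mathcal O_d$ be the strict $\mathbb C$-linear tensor category whose objects are these words, with $\operatorname{Hom}(w,w')=\mathbb C[K_{w,w'}]$ the free vector space, composition the bilinear extension of vertical concatenation with every closed loop (of either orientation) replaced by the factor $d$, and tensor product given by joining words and by horizontal juxtaposition of diagrams. A compatible $*$-structure on a $\mathbb C$-linear tensor category is a family of antilinear maps $*:\operatorname{Hom}(V,W)\to\operatorname{Hom}(W,V)$ with $f^{**}=f$, $(gf)^*=f^*g^*$, $(f\otimes g)^*=f^*\otimes g^*$, for which the associativity and unit constraints are unitary. It is a compatible C*-structure if the spaces of morphisms carry complete norms with $\|gf\|\le\|g\|\,\|f\|$ and $\|f^*f\|=\|f\|^2$, and if every $f^*f$ with $f\in\operatorname{Hom}(V,W)$ is of the form $g^*g$ with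 $g\in\operatorname{End}(V)$. Theorem. Let $d\in\mathbb C$. The tensor category $\mathcal O_d$ admits a compatible C*-structure if and only if $d$ is a nonzero real number with $d^2\ge 4$. If this is the case, then the C*-structure is unique up to monoidal equivalence: for any two compatible C*-structures $*$ and $\star$ on $\mathcal O_d$ there is a linear monoidal self-equivalence $F$ of $\mathcal O_d$, with structure isomorphisms unitary for $\star$, such that $F(f^*)=F(f)^\star$ for all morphisms $f$. Moreover it is given by the following formula: there is a compatible C*-structure on $\mathcal O_d$ with $$D^*=\left(\frac{d}{|d|}\right)^{\sharp(D)}D'$$ for every diagram $D\in K_{w,w'}$, where $D'\in K_{w',w}$ is the reflection of $D$ in a horizontal line with all orientations reversed, and $\sharp(D)$ is the number of strings of $D$ joining two upper points minus the number of strings joining two lower points. -/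

import Mathlib

namespace KauffmanDiagrams

/-- The letters `X` and `X^*`. -/
inductive Letter
  | X
  | Xstar

/-- Words in the letters `X` and `X^*`; the empty word is included. -/
abbrev Word := List Letter

/-- `+1` for `X` (a string starts at an upper point labelled `X`), `-1` for `X^*` (it ends there). -/
def Letter.sign : Letter → ℤ
  | X => 1
  | Xstar => -1

/-- Boundary points of a rectangle: the upper ones (`Sum.inl`, source word `w`) and the lower ones
(`Sum.inr`, target word `w'`), both counted from left to right. -/
abbrev Pt (w w' : Word) := Fin w.length ⊕ Fin w'.length

/-- `+1` at the points where a string starts, `-1` at the points where it ends. -/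
def charge {w w' : Word} : Pt w w' → ℤ
  | .inl i => (w.get i).sign
  | .inr j => -(w'.get j).sign

/-- The position of a boundary point when going around the rectangle clockwise from the upper left
corner: upper points from left to right, then lower points from right to left. -/
def pos {w w' : Word} : Pt w w' → ℕ
  | .inl i => i
  | .inr j => w.length + j.rev

/-- Oriented Kauffman diagrams of type `(w, w')`. The isotopy class of a system of disjoint planar
strings is recorded by saying which boundary points are joined by a string, no two strings crossing;
each string runs from a starting point to an ending point (in particular its two ends are
different). -/
@[ext]
structure Diagram (w w' : Word) where
  partner : Pt w w' → Pt w w'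
  partner_partner : ∀ p, partner (partner p) = p
  oriented : ∀ p, charge (partner p) = -charge p
  planar : ∀ p q, ¬(pos p < pos q ∧ pos q < pos (partner p) ∧ pos (partner p) < pos (partner q))

lemma charge_ne_zero {w w' : Word} (p : Pt w w') : charge p ≠ 0 := by
  have h : ∀ a : Letter, a.sign ≠ 0 := by intro a; cases a <;> simp [Letter.sign]
  cases p <;> simp [charge, h]

lemma Diagram.partner_ne {w w' : Word} (D : Diagram w w') (p : Pt w w') : D.partner p ≠ p := by
  intro h
  have h1 := D.oriented p
  rw [h] at h1
  exact charge_ne_zero p (by omega)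

lemma pos_injective {w w' : Word} : Function.Injective (pos : Pt w w' → ℕ) := by
  rintro (i | i) (j | j) h <;> simp only [pos, Fin.val_rev] at h
  · exact congrArg _ (Fin.ext h)
  · omega
  · omega
  · exact congrArg _ (Fin.ext (by omega))

/-! ### Pairs of involutions -/

/-- The equivalence relation generated by `x ∼ s x` and `x ∼ t x`. -/
def glueSetoid {V : Type} (s t : V → V) : Setoid V :=
  Relation.EqvGen.setoid fun x y => s x = y ∨ t x = y

lemma glue_s {V : Type} (s t : V → V) (x : V) : glueSetoid s t x (s x) :=
  Relation.EqvGen.rel _ _ (Or.inl rfl)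

lemma glue_t {V : Type} (s t : V → V) (x : V) : glueSetoid s t x (t x) :=
  Relation.EqvGen.rel _ _ (Or.inr rfl)

lemma glue_comm {V : Type} (s t : V → V) : glueSetoid s t = glueSetoid t s := by
  unfold glueSetoid
  congr 1
  funext x y
  exact propext or_comm

lemma glue_const {V β : Type} {s t : V → V} {f : V → β} (hs : ∀ x, f (s x) = f x)
    (ht : ∀ x, f (t x) = f x) {x y : V} (h : glueSetoid s t x y) : f x = f y := by
  change Relation.EqvGen _ x y at h
  induction h with
  | rel x y h => rcases h with h | h <;> subst h <;> simp [hs, ht]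
  | refl x => rfl
  | symm x y _ ih => exact ih.symm
  | trans x y z _ _ ih1 ih2 => exact ih1.trans ih2

lemma glue_partner_aux {V : Type} [Finite V] {s t : V → V} (hs : ∀ x, s (s x) = x)
    (ht : ∀ x, t (t x) = x) (hst : ∀ x, s x = x → t x ≠ x) (x : V) (hx : t x = x) :
    ∃! y, y ≠ x ∧ (s y = y ∨ t y = y) ∧ glueSetoid s t x y := by
  classical
  let S : Equiv.Perm V := Function.Involutive.toPerm s hs
  let T : Equiv.Perm V := Function.Involutive.toPerm t ht
  have hS : S * S = 1 := by ext z; exact hs z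
  have hT : T * T = 1 := by ext z; exact ht z
  have hTinv : T⁻¹ = T := inv_eq_of_mul_eq_one_left hT
  have hSinv : S⁻¹ = S := inv_eq_of_mul_eq_one_left hS
  let π : Equiv.Perm V := T * S
  have hTx : T • x = x := hx
  have hconj : ∀ n : ℤ, T * π ^ n = π ^ (-n) * T := by
    intro n
    have h1 : T * π * T⁻¹ = π⁻¹ := by
      simp only [π, mul_inv_rev, hTinv, hSinv]
      rw [mul_assoc, mul_assoc, ← mul_assoc T T, hT, one_mul]
    have h2 : T * π ^ n * T⁻¹ = π ^ (-n) := by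
      rw [← conj_zpow, h1, inv_zpow']
    rw [← h2]; simp
  have hTn : ∀ n : ℤ, T • (π ^ n • x) = π ^ (-n) • x := by
    intro n
    rw [← mul_smul, hconj, mul_smul, hTx]
  have hSn : ∀ n : ℤ, S • (π ^ n • x) = π ^ (-n - 1) • x := by
    intro n
    have h1 : S = T * π := by simp only [π]; rw [← mul_assoc, hT, one_mul]
    have h2 : π * π ^ n = π ^ (n + 1) := by rw [add_comm, zpow_add, zpow_one]
    calc S • (π ^ n • x) = T • (π ^ (n + 1) • x) := by
          rw [← h2, h1]; simp only [mul_smul]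
      _ = π ^ (-n - 1) • x := by rw [hTn]; congr 2; ring
  have hper : ∀ n : ℤ, π ^ n • x = x ↔ ((Function.minimalPeriod (π • ·) x : ℕ) : ℤ) ∣ n :=
    fun n => MulAction.zpow_smul_eq_iff_minimalPeriod_dvd
  set L : ℕ := Function.minimalPeriod (π • ·) x with hL
  have hLpos : 0 < L := by
    have : Finite (MulAction.orbit (Subgroup.zpowers π) x) := Subtype.finite
    exact Nat.pos_of_ne_zero (NeZero.ne _)
  have heq : ∀ m n : ℤ, π ^ m • x = π ^ n • x ↔ (L : ℤ) ∣ m - n := by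
    intro m n
    rw [← hper, sub_eq_add_neg, add_comm, zpow_add, mul_smul, zpow_neg, inv_smul_eq_iff]
  have horb : ∀ y, glueSetoid s t x y ↔ ∃ n : ℤ, y = π ^ n • x := by
    intro y
    constructor
    · intro h
      have key : (∃ n : ℤ, x = π ^ n • x) = (∃ n : ℤ, y = π ^ n • x) := by
        refine glue_const (f := fun y => ∃ n : ℤ, y = π ^ n • x) ?_ ?_ h
        · have h1 : ∀ z, (∃ n : ℤ, z = π ^ n • x) → ∃ n : ℤ, s z = π ^ n • x := by
            rintro z ⟨n, rfl⟩
            exact ⟨_, hSn n⟩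
          intro z
          refine propext ⟨fun h2 => ?_, h1 z⟩
          simpa [hs] using h1 _ h2
        · have h1 : ∀ z, (∃ n : ℤ, z = π ^ n • x) → ∃ n : ℤ, t z = π ^ n • x := by
            rintro z ⟨n, rfl⟩
            exact ⟨_, hTn n⟩
          intro z
          refine propext ⟨fun h2 => ?_, h1 z⟩
          simpa [ht] using h1 _ h2
      rw [← key]
      exact ⟨0, by simp⟩
    · have hπ : ∀ z, glueSetoid s t z (π z) := fun z =>
        (glueSetoid s t).trans (glue_s s t z) (glue_t s t (s z))
      have hnat : ∀ n : ℕ, glueSetoid s t x (π ^ n • x) := by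
        intro n
        induction n with
        | zero => simp
        | succ n ih =>
          rw [pow_succ', mul_smul]
          exact (glueSetoid s t).trans ih (hπ _)
      rintro ⟨n, rfl⟩
      have h1 : (0 : ℤ) ≤ n % L := Int.emod_nonneg _ (by omega)
      obtain ⟨k, hk⟩ := Int.eq_ofNat_of_zero_le h1
      have h2 : π ^ n • x = π ^ k • x := by
        rw [← zpow_natCast, heq, ← hk]
        exact Int.dvd_self_sub_emod
      rw [h2]
      exact hnat k
  have hTfix : ∀ n : ℤ, t (π ^ n • x) = π ^ n • x ↔ (L : ℤ) ∣ 2 * n := by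
    intro n
    change T • (π ^ n • x) = π ^ n • x ↔ _
    rw [hTn, heq, ← dvd_neg]
    ring_nf
  have hSfix : ∀ n : ℤ, s (π ^ n • x) = π ^ n • x ↔ (L : ℤ) ∣ 2 * n + 1 := by
    intro n
    change S • (π ^ n • x) = π ^ n • x ↔ _
    rw [hSn, heq, ← dvd_neg]
    ring_nf
  refine ⟨π ^ ((L / 2 : ℕ) : ℤ) • x, ⟨?_, ?_, ?_⟩, ?_⟩
  · rw [Ne, hper]
    intro h
    have h1 : L ∣ L / 2 := by exact_mod_cast h
    have h2 : L / 2 = 0 := Nat.eq_zero_of_dvd_of_lt h1 (by omega)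
    have h3 : L = 1 := by omega
    have h4 : s x = x := by
      have := hSfix 0
      rw [h3] at this
      simpa using this
    exact hst x h4 hx
  · rw [hTfix, hSfix]
    rcases Nat.even_or_odd' L with ⟨c, hc | hc⟩
    · right
      exact ⟨1, by omega⟩
    · left
      exact ⟨1, by omega⟩
  · exact (horb _).2 ⟨_, rfl⟩
  · rintro y ⟨hyx, hfix, hrel⟩
    obtain ⟨n, rfl⟩ := (horb y).1 hrel
    rw [heq]
    rw [Ne, hper] at hyx
    rw [hTfix, hSfix] at hfix
    have hLL : L % 2 = 0 ∧ ((L / 2 : ℕ) : ℤ) * 2 = L ∨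
        L % 2 = 1 ∧ ((L / 2 : ℕ) : ℤ) * 2 + 1 = L := by omega
    rcases hfix with ⟨a, ha⟩ | ⟨a, ha⟩
    · rcases Int.even_or_odd' a with ⟨b, hb | hb⟩
      · exfalso
        have : 2 * n + 1 = 2 * (L * b) := by rw [ha, hb]; ring
        omega
      · have ha' : 2 * n + 1 = 2 * (L * b) + L := by rw [ha, hb]; ring
        rcases hLL with ⟨h1, h2⟩ | ⟨h1, h2⟩
        · exfalso; omega
        · exact ⟨b, by omega⟩
    · rcases Int.even_or_odd' a with ⟨b, hb | hb⟩
      · have : 2 * n = 2 * (L * b) := by rw [ha, hb]; ring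
        exact absurd ⟨b, by omega⟩ hyx
      · have ha' : 2 * n = 2 * (L * b) + L := by rw [ha, hb]; ring
        rcases hLL with ⟨h1, h2⟩ | ⟨h1, h2⟩
        · exact ⟨b, by omega⟩
        · exfalso; omega

lemma glue_partner {V : Type} [Finite V] {s t : V → V} (hs : ∀ x, s (s x) = x)
    (ht : ∀ x, t (t x) = x) (hst : ∀ x, s x = x → t x ≠ x) (x : V) (hx : s x = x ∨ t x = x) :
    ∃! y, y ≠ x ∧ (s y = y ∨ t y = y) ∧ glueSetoid s t x y := by
  rcases hx with hx | hx
  · have h := glue_partner_aux ht hs (fun z h1 h2 => hst z h2 h1) x hx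
    rw [glue_comm t s] at h
    simpa only [or_comm] using h
  · exact glue_partner_aux hs ht hst x hx

/-! ### Concatenation of diagrams -/

section Concatenation

variable {w w' w'' : Word}

/-- The points of a rectangle placed on top of another one: upper points, then the middle points and
the lower points. -/
abbrev GluePt (w w' w'' : Word) := Fin w.length ⊕ Pt w' w''

/-- The points of the upper rectangle. -/
def upperPt : Pt w w' → GluePt w w' w'' := Sum.map id Sum.inl

/-- The points on the boundary of the big rectangle. -/
def outerPt : Pt w w'' → GluePt w w' w'' := Sum.map id Sum.inr

/-- Moving along the strings of the upper diagram. -/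
def Diagram.moveUpper (D : Diagram w w') : GluePt w w' w'' → GluePt w w' w''
  | .inl i => upperPt (D.partner (.inl i))
  | .inr (.inl j) => upperPt (D.partner (.inr j))
  | .inr (.inr k) => .inr (.inr k)

/-- Moving along the strings of the lower diagram. -/
def Diagram.moveLower (E : Diagram w' w'') : GluePt w w' w'' → GluePt w w' w''
  | .inl i => .inl i
  | .inr p => .inr (E.partner p)

/-- Two points are equivalent if they lie on the same string (or loop) of the concatenation. -/
def Diagram.strings (D : Diagram w w') (E : Diagram w' w'') : Setoid (GluePt w w' w'') :=
  glueSetoid D.moveUpper E.moveLower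

lemma Diagram.moveUpper_upperPt (D : Diagram w w') (p : Pt w w') :
    D.moveUpper (upperPt p : GluePt w w' w'') = upperPt (D.partner p) := by
  cases p <;> rfl

lemma Diagram.moveUpper_moveUpper (D : Diagram w w') (x : GluePt w w' w'') :
    D.moveUpper (D.moveUpper x) = x := by
  rcases x with i | j | k
  · exact (D.moveUpper_upperPt _).trans (by rw [D.partner_partner]; rfl)
  · exact (D.moveUpper_upperPt _).trans (by rw [D.partner_partner]; rfl)
  · rfl

lemma Diagram.moveLower_moveLower (E : Diagram w' w'') (x : GluePt w w' w'') :
    E.moveLower (E.moveLower x) = x := by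
  rcases x with i | p
  · rfl
  · exact congrArg Sum.inr (E.partner_partner p)

lemma upperPt_injective : Function.Injective (upperPt : Pt w w' → GluePt w w' w'') :=
  Function.injective_id.sumMap Sum.inl_injective

lemma outerPt_injective : Function.Injective (outerPt : Pt w w'' → GluePt w w' w'') :=
  Function.injective_id.sumMap Sum.inr_injective

lemma Diagram.moveUpper_eq_self (D : Diagram w w') (x : GluePt w w' w'') :
    D.moveUpper x = x ↔ ∃ k, x = .inr (.inr k) := by
  rcases x with i | j | k
  · refine ⟨fun h => ?_, fun ⟨k, h⟩ => by simp at h⟩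
    exact absurd (upperPt_injective (w'' := w'') (a₂ := .inl i) h) (D.partner_ne _)
  · refine ⟨fun h => ?_, fun ⟨k, h⟩ => by simp at h⟩
    exact absurd (upperPt_injective (w'' := w'') (a₂ := .inr j) h) (D.partner_ne _)
  · exact ⟨fun _ => ⟨k, rfl⟩, fun _ => rfl⟩

lemma Diagram.moveLower_eq_self (E : Diagram w' w'') (x : GluePt w w' w'') :
    E.moveLower x = x ↔ ∃ i, x = .inl i := by
  rcases x with i | p
  · exact ⟨fun _ => ⟨i, rfl⟩, fun _ => rfl⟩
  · refine ⟨fun h => ?_, fun ⟨k, h⟩ => by simp at h⟩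
    exact absurd (Sum.inr_injective h) (E.partner_ne _)

lemma fixed_iff_outer (D : Diagram w w') (E : Diagram w' w'') (x : GluePt w w' w'') :
    (D.moveUpper x = x ∨ E.moveLower x = x) ↔ ∃ q, outerPt q = x := by
  rw [D.moveUpper_eq_self, E.moveLower_eq_self]
  constructor
  · rintro (⟨k, rfl⟩ | ⟨i, rfl⟩)
    · exact ⟨.inr k, rfl⟩
    · exact ⟨.inl i, rfl⟩
  · rintro ⟨i | k, rfl⟩
    · exact Or.inr ⟨i, rfl⟩
    · exact Or.inl ⟨k, rfl⟩

/-- A string of the concatenation that starts on the boundary has exactly one other end there. -/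
lemma Diagram.existsUnique_partner (D : Diagram w w') (E : Diagram w' w'') (p : Pt w w'') :
    ∃! q, q ≠ p ∧ D.strings E (outerPt p) (outerPt q) := by
  obtain ⟨y, ⟨h1, h2, h3⟩, h4⟩ := glue_partner D.moveUpper_moveUpper E.moveLower_moveLower
    (fun x h => by
      rw [D.moveUpper_eq_self] at h
      obtain ⟨k, rfl⟩ := h
      rw [Ne, E.moveLower_eq_self]
      simp) (outerPt p) ((fixed_iff_outer D E _).2 ⟨p, rfl⟩)
  obtain ⟨q, rfl⟩ := (fixed_iff_outer D E _).1 h2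
  refine ⟨q, ⟨fun h => h1 (h ▸ rfl), h3⟩, fun q' ⟨h5, h6⟩ => ?_⟩
  exact outerPt_injective (h4 _ ⟨fun h => h5 (outerPt_injective h),
    (fixed_iff_outer D E _).2 ⟨q', rfl⟩, h6⟩)

/-- The other end of the string of the concatenation that starts at `p`. -/
noncomputable def Diagram.compPartner (D : Diagram w w') (E : Diagram w' w'') (p : Pt w w'') :
    Pt w w'' :=
  (D.existsUnique_partner E p).choose

lemma Diagram.compPartner_ne (D : Diagram w w') (E : Diagram w' w'') (p : Pt w w'') :
    D.compPartner E p ≠ p :=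
  (D.existsUnique_partner E p).choose_spec.1.1

lemma Diagram.compPartner_rel (D : Diagram w w') (E : Diagram w' w'') (p : Pt w w'') :
    D.strings E (outerPt p) (outerPt (D.compPartner E p)) :=
  (D.existsUnique_partner E p).choose_spec.1.2

lemma Diagram.strings_outerPt (D : Diagram w w') (E : Diagram w' w'') (p q : Pt w w'') :
    D.strings E (outerPt p) (outerPt q) ↔ q = p ∨ q = D.compPartner E p := by
  constructor
  · intro h
    by_cases hq : q = p
    · exact Or.inl hq
    · exact Or.inr ((D.existsUnique_partner E p).choose_spec.2 q ⟨hq, h⟩)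
  · rintro (rfl | rfl)
    · exact (D.strings E).refl _
    · exact D.compPartner_rel E p

lemma Diagram.compPartner_compPartner (D : Diagram w w') (E : Diagram w' w'') (p : Pt w w'') :
    D.compPartner E (D.compPartner E p) = p := by
  have h : D.strings E (outerPt (D.compPartner E p)) (outerPt p) :=
    (D.strings E).symm (D.compPartner_rel E p)
  rw [D.strings_outerPt] at h
  rcases h with h | h
  · exact absurd h.symm (D.compPartner_ne E p)
  · exact h.symm

lemma Diagram.strings_upper (D : Diagram w w') (E : Diagram w' w'') (x : GluePt w w' w'')
    (p : Pt w w') : D.strings E x (upperPt (D.partner p)) ↔ D.strings E x (upperPt p) := by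
  have h : D.strings E (upperPt p) (upperPt (D.partner p)) := by
    rw [← D.moveUpper_upperPt]; exact glue_s _ _ _
  exact ⟨fun h' => (D.strings E).trans h' ((D.strings E).symm h),
    fun h' => (D.strings E).trans h' h⟩

lemma Diagram.strings_lower (D : Diagram w w') (E : Diagram w' w'') (x : GluePt w w' w'')
    (p : Pt w' w'') : D.strings E x (.inr (E.partner p)) ↔ D.strings E x (.inr p) := by
  have h : D.strings E (.inr p) (.inr (E.partner p)) := glue_t _ _ _
  exact ⟨fun h' => (D.strings E).trans h' ((D.strings E).symm h),
    fun h' => (D.strings E).trans h' h⟩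

lemma Diagram.sum_charge (D : Diagram w w') (P : Pt w w' → Prop) [DecidablePred P]
    (hP : ∀ p, P (D.partner p) ↔ P p) : ∑ p, (if P p then charge p else 0) = 0 := by
  refine Finset.sum_involution (fun p _ => D.partner p) ?_ ?_ ?_ ?_
  · intro p _
    simp only [hP, D.oriented]
    split_ifs <;> simp
  · intro p _ _
    exact D.partner_ne p
  · intro p _
    exact Finset.mem_univ _
  · intro p _
    exact D.partner_partner p

lemma Diagram.sum_parity (D : Diagram w w') (P : Pt w w' → Prop) [DecidablePred P]
    (hP : ∀ p, P (D.partner p) ↔ P p) : ∑ p, (if P p then (1 : ZMod 2) else 0) = 0 := by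
  refine Finset.sum_involution (fun p _ => D.partner p) ?_ ?_ ?_ ?_
  · intro p _
    simp only [hP]
    split_ifs <;> decide
  · intro p _ _
    exact D.partner_ne p
  · intro p _
    exact Finset.mem_univ _
  · intro p _
    exact D.partner_partner p

lemma Diagram.sum_cross (D : Diagram w w') (P Q : Pt w w' → Prop) [DecidablePred P]
    [DecidablePred Q] (hP : ∀ p, P (D.partner p) ↔ P p) (hQ : ∀ p, Q (D.partner p) ↔ Q p)
    (hPQ : ∀ p, P p → ¬Q p) :
    ∑ p, ∑ q, (if P p ∧ Q q ∧ pos q < pos p then (1 : ZMod 2) else 0) = 0 := by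
  have inner : ∀ p, P p → ∑ q, ((if Q q ∧ pos q < pos p then (1 : ZMod 2) else 0) +
      (if Q q ∧ pos q < pos (D.partner p) then (1 : ZMod 2) else 0)) = 0 := by
    intro p hp
    refine Finset.sum_involution (fun q _ => D.partner q) ?_ ?_ ?_ ?_
    · intro q _
      simp only [hQ]
      by_cases hq : Q q
      · have hne1 : pos q ≠ pos p := fun h => hPQ p hp (pos_injective h ▸ hq)
        have hne2 : pos q ≠ pos (D.partner p) := fun h =>
          hPQ _ ((hP p).2 hp) (pos_injective h ▸ hq)
        have hne3 : pos (D.partner q) ≠ pos p := fun h =>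
          hPQ p hp (pos_injective h ▸ (hQ q).2 hq)
        have hne4 : pos (D.partner q) ≠ pos (D.partner p) := fun h =>
          hPQ _ ((hP p).2 hp) (pos_injective h ▸ (hQ q).2 hq)
        have a1 := D.planar p q
        have a2 := D.planar q p
        have a3 := D.planar (D.partner p) q
        have a4 := D.planar q (D.partner p)
        have a5 := D.planar p (D.partner q)
        have a6 := D.planar (D.partner q) p
        have a7 := D.planar (D.partner p) (D.partner q)
        have a8 := D.planar (D.partner q) (D.partner p)
        simp only [D.partner_partner] at a1 a2 a3 a4 a5 a6 a7 a8
        simp only [hq, true_and]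
        split_ifs <;> first | decide | (exfalso; omega)
      · simp [hq]
    · intro q _ _
      exact D.partner_ne q
    · intro q _
      exact Finset.mem_univ _
    · intro q _
      exact D.partner_partner q
  refine Finset.sum_involution (fun p _ => D.partner p) ?_ ?_ ?_ ?_
  · intro p _
    by_cases hp : P p
    · rw [← Finset.sum_add_distrib]
      simpa [hP, hp] using inner p hp
    · simp [hP, hp]
  · intro p _ _
    exact D.partner_ne p
  · intro p _
    exact Finset.mem_univ _
  · intro p _
    exact D.partner_partner p

open Classical in
lemma Diagram.comp_oriented (D : Diagram w w') (E : Diagram w' w'') (p : Pt w w'') :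
    charge (D.compPartner E p) = -charge p := by
  have h1 := D.sum_charge (fun q => D.strings E (outerPt p) (upperPt q))
    (fun q => D.strings_upper E _ q)
  have h2 := E.sum_charge (fun q => D.strings E (outerPt p) (.inr q))
    (fun q => D.strings_lower E _ q)
  have h3 : ∑ q : Pt w w'', (if D.strings E (outerPt p) (outerPt q) then charge q else 0) = 0 := by
    rw [Fintype.sum_sum_type] at h1 h2 ⊢
    have h4 : ∑ j : Fin w'.length, (if D.strings E (outerPt p) (upperPt (.inr j)) then
          charge (.inr j : Pt w w') else 0) =
        -∑ j : Fin w'.length, (if D.strings E (outerPt p) (.inr (.inl j)) then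
          charge (.inl j : Pt w' w'') else 0) := by
      rw [← Finset.sum_neg_distrib]
      refine Finset.sum_congr rfl fun j _ => ?_
      change (if D.strings E (outerPt p) (.inr (.inl j)) then _ else _) = _
      split_ifs <;> simp [charge]
    rw [h4] at h1
    have h5 : ∑ i : Fin w.length, (if D.strings E (outerPt p) (outerPt (.inl i)) then
          charge (.inl i : Pt w w'') else 0) =
        ∑ i : Fin w.length, (if D.strings E (outerPt p) (upperPt (.inl i)) then
          charge (.inl i : Pt w w') else 0) := rfl
    have h6 : ∑ i : Fin w''.length, (if D.strings E (outerPt p) (outerPt (.inr i)) then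
          charge (.inr i : Pt w w'') else 0) =
        ∑ i : Fin w''.length, (if D.strings E (outerPt p) (.inr (.inr i)) then
          charge (.inr i : Pt w' w'') else 0) := rfl
    rw [h5, h6]
    linarith
  simp only [D.strings_outerPt] at h3
  have h7 : ∀ q : Pt w w'', (if q = p ∨ q = D.compPartner E p then charge q else 0) =
      (if q = p then charge q else 0) + (if q = D.compPartner E p then charge q else 0) := by
    intro q
    have := D.compPartner_ne E p
    by_cases a : q = p
    · have b : q ≠ D.compPartner E p := fun h => this (h ▸ a)
      simp [a, this.symm]
    · simp [a]
  simp only [h7, Finset.sum_add_distrib, Finset.sum_ite_eq', Finset.mem_univ, if_true] at h3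
  linarith

open Classical in
lemma sum_cross_split {v v' : Word} (P' Q' : Pt v v' → Prop) :
      ∑ r, ∑ r', (if P' r ∧ Q' r' ∧ pos r' < pos r then (1 : ZMod 2) else 0) =
      (∑ i, ∑ i', (if P' (.inl i) then 1 else 0) * (if Q' (.inl i') then 1 else 0) *
        (if i' < i then 1 else 0)) +
      (∑ j, (if P' (.inr j) then 1 else 0)) * (∑ i, (if Q' (.inl i) then 1 else 0)) +
      (∑ j, ∑ j', (if P' (.inr j) then 1 else 0) * (if Q' (.inr j') then 1 else 0) *
        (if j < j' then 1 else 0)) := by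
    simp only [Fintype.sum_sum_type, Finset.sum_mul_sum]
    have e1 : ∀ (i i' : Fin v.length), (if P' (.inl i) ∧ Q' (.inl i') ∧
        pos (.inl i' : Pt v v') < pos (.inl i : Pt v v') then (1 : ZMod 2) else 0) =
        (if P' (.inl i) then 1 else 0) * (if Q' (.inl i') then 1 else 0) *
        (if i' < i then 1 else 0) := by
      intro i i'
      simp only [pos, Fin.val_fin_lt]
      by_cases hp : P' (.inl i) <;> by_cases hq : Q' (.inl i') <;> simp [hp, hq]
    have e2 : ∀ (i : Fin v.length) (j : Fin v'.length), (if P' (.inl i) ∧ Q' (.inr j) ∧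
        pos (.inr j : Pt v v') < pos (.inl i : Pt v v') then (1 : ZMod 2) else 0) = 0 := by
      intro i j
      have : ¬(pos (.inr j : Pt v v') < pos (.inl i : Pt v v')) := by simp only [pos]; omega
      simp [this]
    have e3 : ∀ (i : Fin v.length) (j : Fin v'.length), (if P' (.inr j) ∧ Q' (.inl i) ∧
        pos (.inl i : Pt v v') < pos (.inr j : Pt v v') then (1 : ZMod 2) else 0) =
        (if P' (.inr j) then 1 else 0) * (if Q' (.inl i) then 1 else 0) := by
      intro i j
      have : (pos (.inl i : Pt v v') < pos (.inr j : Pt v v')) := by simp only [pos]; omega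
      simp only [this, and_true]
      by_cases hp : P' (.inr j) <;> simp [hp]
    have e4 : ∀ (j j' : Fin v'.length), (if P' (.inr j) ∧ Q' (.inr j') ∧
        pos (.inr j' : Pt v v') < pos (.inr j : Pt v v') then (1 : ZMod 2) else 0) =
        (if P' (.inr j) then 1 else 0) * (if Q' (.inr j') then 1 else 0) *
        (if j < j' then 1 else 0) := by
      intro j j'
      have : pos (.inr j' : Pt v v') < pos (.inr j : Pt v v') ↔ j < j' := by
        simp only [pos, Fin.val_rev, Fin.lt_def]; omega
      simp only [this]
      by_cases hp : P' (.inr j) <;> by_cases hq : Q' (.inr j') <;> simp [hp, hq]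
    simp only [e1, e2, e3, e4, Finset.sum_const_zero, add_zero, Finset.sum_add_distrib]
    ring

open Classical in
lemma Diagram.comp_planar (D : Diagram w w') (E : Diagram w' w'') (p q : Pt w w'') :
    ¬(pos p < pos q ∧ pos q < pos (D.compPartner E p) ∧
      pos (D.compPartner E p) < pos (D.compPartner E q)) := by
  rintro ⟨k1, k2, k3⟩
  have hne : ¬D.strings E (outerPt p) (outerPt q) := by
    rw [D.strings_outerPt]
    rintro (h | h)
    · rw [h] at k1; omega
    · rw [h] at k2; omega
  have hdis : ∀ x, D.strings E (outerPt p) x → ¬D.strings E (outerPt q) x := fun x h1 h2 =>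
    hne ((D.strings E).trans h1 ((D.strings E).symm h2))
  set P : GluePt w w' w'' → Prop := fun x => D.strings E (outerPt p) x with hP
  set Q : GluePt w w' w'' → Prop := fun x => D.strings E (outerPt q) x with hQ
  have c1 := D.sum_cross (fun r => P (upperPt r)) (fun r => Q (upperPt r))
    (fun r => D.strings_upper E _ r) (fun r => D.strings_upper E _ r) (fun r => hdis _)
  have c2 := E.sum_cross (fun r => P (.inr r)) (fun r => Q (.inr r))
    (fun r => D.strings_lower E _ r) (fun r => D.strings_lower E _ r) (fun r => hdis _)
  have q1 := D.sum_parity (fun r => Q (upperPt r)) (fun r => D.strings_upper E _ r)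
  let a : GluePt w w' w'' → ZMod 2 := fun x => if P x then 1 else 0
  let b : GluePt w w' w'' → ZMod 2 := fun x => if Q x then 1 else 0
  have hab : ∀ x, a x * b x = 0 := by
    intro x
    by_cases hx : P x
    · simp [a, b, hdis x hx, hQ]
    · simp [a, hx]
  rw [sum_cross_split] at c1 c2
  rw [Fintype.sum_sum_type] at q1
  have hout : ∑ r : Pt w w'', ∑ r' : Pt w w'', (if P (outerPt r) ∧ Q (outerPt r') ∧
      pos r' < pos r then (1 : ZMod 2) else 0) = 0 := by
    rw [sum_cross_split (fun r => P (outerPt r)) (fun r => Q (outerPt r))]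
    have hmid : (∑ j : Fin w'.length, ∑ j' : Fin w'.length,
          a (.inr (.inl j)) * b (.inr (.inl j')) * (if j' < j then 1 else 0)) +
        (∑ j : Fin w'.length, ∑ j' : Fin w'.length,
          a (.inr (.inl j)) * b (.inr (.inl j')) * (if j < j' then 1 else 0)) =
        (∑ j : Fin w'.length, a (.inr (.inl j))) * (∑ j : Fin w'.length, b (.inr (.inl j))) := by
      rw [Finset.sum_mul_sum, ← Finset.sum_add_distrib]
      refine Finset.sum_congr rfl fun j _ => ?_
      rw [← Finset.sum_add_distrib]
      refine Finset.sum_congr rfl fun j' _ => ?_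
      rcases lt_trichotomy j j' with h | h | h
      · rw [if_neg h.not_gt, if_pos h]; ring
      · subst h; simp [hab]
      · rw [if_pos h, if_neg h.not_gt]; ring
    change (∑ i : Fin w.length, b (.inl i)) + (∑ j : Fin w'.length, b (.inr (.inl j))) = 0 at q1
    change (∑ i : Fin w.length, ∑ i' : Fin w.length, a (.inl i) * b (.inl i') *
        (if i' < i then 1 else 0)) +
      (∑ j : Fin w'.length, a (.inr (.inl j))) * (∑ i : Fin w.length, b (.inl i)) +
      (∑ j : Fin w'.length, ∑ j' : Fin w'.length, a (.inr (.inl j)) * b (.inr (.inl j')) *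
        (if j < j' then 1 else 0)) = 0 at c1
    change (∑ i : Fin w'.length, ∑ i' : Fin w'.length, a (.inr (.inl i)) * b (.inr (.inl i')) *
        (if i' < i then 1 else 0)) +
      (∑ j : Fin w''.length, a (.inr (.inr j))) * (∑ i : Fin w'.length, b (.inr (.inl i))) +
      (∑ j : Fin w''.length, ∑ j' : Fin w''.length, a (.inr (.inr j)) * b (.inr (.inr j')) *
        (if j < j' then 1 else 0)) = 0 at c2
    change (∑ i : Fin w.length, ∑ i' : Fin w.length, a (.inl i) * b (.inl i') *
        (if i' < i then 1 else 0)) +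
      (∑ j : Fin w''.length, a (.inr (.inr j))) * (∑ i : Fin w.length, b (.inl i)) +
      (∑ j : Fin w''.length, ∑ j' : Fin w''.length, a (.inr (.inr j)) * b (.inr (.inr j')) *
        (if j < j' then 1 else 0)) = 0
    have two : (2 : ZMod 2) = 0 := by decide
    linear_combination c1 + c2 - hmid +
      (∑ j : Fin w''.length, a (.inr (.inr j))) * q1 -
      (∑ j : Fin w''.length, a (.inr (.inr j))) * (∑ j : Fin w'.length, b (.inr (.inl j))) * two -
      (∑ j : Fin w'.length, a (.inr (.inl j))) * q1
  simp only [hP, hQ, D.strings_outerPt] at hout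
  have hterm : ∀ r r' : Pt w w'', (if (r = p ∨ r = D.compPartner E p) ∧
      (r' = q ∨ r' = D.compPartner E q) ∧ pos r' < pos r then (1 : ZMod 2) else 0) =
      if r = D.compPartner E p then (if r' = q then 1 else 0) else 0 := by
    intro r r'
    by_cases h1 : r = D.compPartner E p
    · by_cases h2 : r' = q
      · subst h1 h2; simp [k2]
      · by_cases h3 : r' = D.compPartner E q
        · subst h1 h3
          have : ¬pos (D.compPartner E q) < pos (D.compPartner E p) := by omega
          simp [this, h2]
        · simp [h2, h3]
    · by_cases h1' : r = p
      · rw [if_neg h1, if_neg]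
        rintro ⟨-, h2 | h2, h3⟩ <;> subst h1' <;> subst h2 <;> omega
      · simp [h1, h1']
  simp only [hterm] at hout
  simp at hout

/-- The concatenation of `D` (upper) and `E` (lower), with the closed loops removed. -/
noncomputable def Diagram.comp (D : Diagram w w') (E : Diagram w' w'') : Diagram w w'' where
  partner := D.compPartner E
  partner_partner := D.compPartner_compPartner E
  oriented := D.comp_oriented E
  planar := D.comp_planar E

/-- The number of closed loops in the concatenation of `D` and `E`. -/
noncomputable def Diagram.loops (D : Diagram w w') (E : Diagram w' w'') : ℕ :=
  Nat.card {c : Quotient (D.strings E) // ∀ p : Pt w w'', Quotient.mk _ (outerPt p) ≠ c}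

end Concatenation

/-! ### Identities and tensor products of diagrams -/

/-- The identity diagram: vertical strings. -/
def Diagram.id (w : Word) : Diagram w w where
  partner := Sum.swap
  partner_partner := Sum.swap_swap
  oriented := by rintro (i | i) <;> simp [charge]
  planar := by
    rintro (i | i) (j | j) <;> simp only [pos, Sum.swap_inl, Sum.swap_inr, Fin.val_rev] <;> omega

/-- The points of a concatenated word. -/
def appendPt (w v : Word) : Fin w.length ⊕ Fin v.length ≃ Fin (w ++ v).length :=
  finSumFinEquiv.trans (finCongr List.length_append.symm)

/-- The boundary points of two rectangles placed side by side. -/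
def juxtaposePt (w w' v v' : Word) : Pt w w' ⊕ Pt v v' ≃ Pt (w ++ v) (w' ++ v') :=
  (Equiv.sumSumSumComm _ _ _ _).trans (Equiv.sumCongr (appendPt w v) (appendPt w' v'))

@[simp] lemma appendPt_inl_val (w v : Word) (i : Fin w.length) :
    (appendPt w v (.inl i) : ℕ) = i := rfl

@[simp] lemma appendPt_inr_val (w v : Word) (i : Fin v.length) :
    (appendPt w v (.inr i) : ℕ) = w.length + i := rfl

lemma charge_juxtapose_inl {w w' v v' : Word} (p : Pt w w') :
    charge (juxtaposePt w w' v v' (.inl p)) = charge p := by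
  rcases p with i | i
  · change ((w ++ v).get (appendPt w v (.inl i))).sign = (w.get i).sign
    simp [List.getElem_append_left]
  · change -((w' ++ v').get (appendPt w' v' (.inl i))).sign = -(w'.get i).sign
    simp [List.getElem_append_left]

lemma charge_juxtapose_inr {w w' v v' : Word} (p : Pt v v') :
    charge (juxtaposePt w w' v v' (.inr p)) = charge p := by
  rcases p with i | i
  · change ((w ++ v).get (appendPt w v (.inr i))).sign = (v.get i).sign
    simp
  · change -((w' ++ v').get (appendPt w' v' (.inr i))).sign = -(v'.get i).sign
    simp

lemma pos_juxtapose_inl {w w' v v' : Word} (p : Pt w w') :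
    (pos (juxtaposePt w w' v v' (.inl p)) = pos p ∧ pos p < w.length) ∨
    (pos (juxtaposePt w w' v v' (.inl p)) = pos p + v.length + v'.length ∧ w.length ≤ pos p) := by
  rcases p with i | i
  · left
    exact ⟨rfl, i.2⟩
  · right
    change (w ++ v).length + (appendPt w' v' (.inl i)).rev.val = _ ∧ _
    simp only [pos, Fin.val_rev, appendPt_inl_val, List.length_append]
    omega

lemma pos_juxtapose_inr {w w' v v' : Word} (p : Pt v v') :
    pos (juxtaposePt w w' v v' (.inr p)) = w.length + pos p ∧ pos p < v.length + v'.length := by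
  rcases p with i | i
  · refine ⟨rfl, ?_⟩
    simp only [pos]; omega
  · change (w ++ v).length + (appendPt w' v' (.inr i)).rev.val = _ ∧ _
    simp only [pos, Fin.val_rev, appendPt_inr_val, List.length_append]
    omega

/-- Horizontal juxtaposition of diagrams. -/
def Diagram.tensor {w w' v v' : Word} (D : Diagram w w') (E : Diagram v v') :
    Diagram (w ++ v) (w' ++ v') where
  partner p := juxtaposePt w w' v v' (Sum.map D.partner E.partner ((juxtaposePt w w' v v').symm p))
  partner_partner p := by
    obtain ⟨p | p, rfl⟩ := (juxtaposePt w w' v v').surjective p <;> simp [partner_partner]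
  oriented p := by
    obtain ⟨p | p, rfl⟩ := (juxtaposePt w w' v v').surjective p <;>
      simp [charge_juxtapose_inl, charge_juxtapose_inr, oriented]
  planar p q := by
    obtain ⟨p | p, rfl⟩ := (juxtaposePt w w' v v').surjective p <;>
    obtain ⟨q | q, rfl⟩ := (juxtaposePt w w' v v').surjective q <;>
    simp only [Equiv.symm_apply_apply, Sum.map_inl, Sum.map_inr]
    · have h1 := pos_juxtapose_inl (v := v) (v' := v') p
      have h2 := pos_juxtapose_inl (v := v) (v' := v') q
      have h3 := pos_juxtapose_inl (v := v) (v' := v') (D.partner p)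
      have h4 := pos_juxtapose_inl (v := v) (v' := v') (D.partner q)
      have h := D.planar p q
      omega
    · have h1 := pos_juxtapose_inl (v := v) (v' := v') p
      have h2 := pos_juxtapose_inr (w := w) (w' := w') q
      have h3 := pos_juxtapose_inl (v := v) (v' := v') (D.partner p)
      have h4 := pos_juxtapose_inr (w := w) (w' := w') (E.partner q)
      omega
    · have h1 := pos_juxtapose_inr (w := w) (w' := w') p
      have h2 := pos_juxtapose_inl (v := v) (v' := v') q
      have h3 := pos_juxtapose_inr (w := w) (w' := w') (E.partner p)
      have h4 := pos_juxtapose_inl (v := v) (v' := v') (D.partner q)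
      omega
    · have h1 := pos_juxtapose_inr (w := w) (w' := w') p
      have h2 := pos_juxtapose_inr (w := w) (w' := w') q
      have h3 := pos_juxtapose_inr (w := w) (w' := w') (E.partner p)
      have h4 := pos_juxtapose_inr (w := w) (w' := w') (E.partner q)
      have h := E.planar p q
      omega

lemma Diagram.tensor_partner_inl {w w' v v' : Word} (D : Diagram w w') (E : Diagram v v')
    (p : Pt w w') : (D.tensor E).partner (juxtaposePt w w' v v' (.inl p)) =
      juxtaposePt w w' v v' (.inl (D.partner p)) := by
  simp [tensor]

lemma Diagram.tensor_partner_inr {w w' v v' : Word} (D : Diagram w w') (E : Diagram v v')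
    (p : Pt v v') : (D.tensor E).partner (juxtaposePt w w' v v' (.inr p)) =
      juxtaposePt w w' v v' (.inr (E.partner p)) := by
  simp [tensor]

/-! ### Two-colourings of strings

Counting the two-colourings of the strings of a diagram gives a faithful matrix representation, from
which the laws of concatenation are read off. -/

section Colouring

variable {w w' w'' : Word}

/-- A colouring of the boundary points that is constant on strings. -/
def Diagram.Compatible (D : Diagram w w') (F : Pt w w' → Bool) : Prop :=
  ∀ p, F (D.partner p) = F p

open Classical in
/-- The matrix of compatible colourings. -/
noncomputable def Diagram.mat (D : Diagram w w') :
    Matrix (Fin w.length → Bool) (Fin w'.length → Bool) ℕ :=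
  fun f g => if D.Compatible (Sum.elim f g) then 1 else 0

lemma Diagram.mat_ext {a b : ℕ} {D E : Diagram w w'} (h : 2 ^ a • D.mat = 2 ^ b • E.mat) :
    a = b ∧ D = E := by
  have h1 : ∀ f g, 2 ^ a * D.mat f g = 2 ^ b * E.mat f g := fun f g => by
    have := congrFun (congrFun h f) g
    simpa using this
  have h2 : 2 ^ a = 2 ^ b := by
    have := h1 (fun _ => true) (fun _ => true)
    have hc : ∀ D : Diagram w w', D.Compatible (Sum.elim (fun _ => true) (fun _ => true)) := by
      intro D p
      cases p <;> cases D.partner _ <;> rfl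
    simpa only [mat, if_pos (hc _), mul_one] using this
  have h3 : a = b := Nat.pow_right_injective le_rfl h2
  refine ⟨h3, ?_⟩
  subst h3
  have h4 : ∀ F, D.Compatible F → E.Compatible F := by
    intro F hF
    have h5 := Nat.eq_of_mul_eq_mul_left (by positivity) (h1 (F ∘ Sum.inl) (F ∘ Sum.inr))
    by_contra hE
    simp [mat, Sum.elim_comp_inl_inr, hF, hE] at h5
  classical
  ext p : 2
  have h6 : D.Compatible (fun q => decide (q = p ∨ q = D.partner p)) := by
    intro q
    have e1 : D.partner q = p ↔ q = D.partner p :=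
      ⟨fun h => by rw [← h, D.partner_partner], fun h => by rw [h, D.partner_partner]⟩
    have e2 : D.partner q = D.partner p ↔ q = p :=
      ⟨fun h => by rw [← D.partner_partner q, h, D.partner_partner], fun h => by rw [h]⟩
    simp only [e1, e2, or_comm]
  have h7 := h4 _ h6 p
  simp only [true_or, decide_true, decide_eq_true_eq, E.partner_ne, false_or] at h7
  exact h7.symm

lemma compatible_iff (D : Diagram w w') (E : Diagram w' w'') (f : Fin w.length → Bool)
    (h : Fin w'.length → Bool) (g : Fin w''.length → Bool) :
    (D.Compatible (Sum.elim f h) ∧ E.Compatible (Sum.elim h g)) ↔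
      (∀ x, (Sum.elim f (Sum.elim h g)) (D.moveUpper x) = (Sum.elim f (Sum.elim h g)) x) ∧
      (∀ x, (Sum.elim f (Sum.elim h g)) (E.moveLower x) = (Sum.elim f (Sum.elim h g)) x) := by
  have key : ∀ p : Pt w w', (Sum.elim f (Sum.elim h g)) (upperPt p) = Sum.elim f h p := by
    rintro (i | i) <;> rfl
  refine and_congr ⟨?_, ?_⟩ ⟨?_, ?_⟩
  · rintro hD (i | j | k)
    · exact (key _).trans (hD _)
    · exact (key _).trans (hD _)
    · rfl
  · intro hD p
    rw [← key, ← key, ← D.moveUpper_upperPt]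
    exact hD _
  · rintro hE (i | p)
    · rfl
    · exact hE p
  · intro hE p
    exact hE (.inr p)

lemma Diagram.mat_mul (D : Diagram w w') (E : Diagram w' w'') :
    D.mat * E.mat = 2 ^ D.loops E • (D.comp E).mat := by
  classical
  ext f g
  have hcount : (D.mat * E.mat) f g =
      Nat.card {h : Fin w'.length → Bool //
        D.Compatible (Sum.elim f h) ∧ E.Compatible (Sum.elim h g)} := by
    rw [Nat.card_eq_fintype_card, Fintype.card_subtype, Matrix.mul_apply,
      Finset.card_filter]
    refine Finset.sum_congr rfl fun h _ => ?_
    simp only [mat, ite_and]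
    split_ifs <;> rfl
  have hconst : ∀ h : Fin w'.length → Bool,
      (D.Compatible (Sum.elim f h) ∧ E.Compatible (Sum.elim h g)) → ∀ x y, D.strings E x y →
      (Sum.elim f (Sum.elim h g)) x = (Sum.elim f (Sum.elim h g)) y := by
    intro h hh x y hxy
    rw [compatible_iff] at hh
    exact glue_const hh.1 hh.2 hxy
  have hout : ∀ (h : Fin w'.length → Bool) (p : Pt w w''),
      (Sum.elim f (Sum.elim h g)) (outerPt p) = Sum.elim f g p := by
    rintro h (i | i) <;> rfl
  rw [hcount, Matrix.smul_apply, mat, smul_eq_mul]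
  split_ifs with hc
  · rw [mul_one, loops]
    let Φ : {h : Fin w'.length → Bool //
        D.Compatible (Sum.elim f h) ∧ E.Compatible (Sum.elim h g)} →
        ({c : Quotient (D.strings E) // ∀ p : Pt w w'', Quotient.mk _ (outerPt p) ≠ c} → Bool) :=
      fun h c => Quotient.lift (Sum.elim f (Sum.elim h.1 g)) (hconst h.1 h.2) c.1
    have hΦ : Function.Bijective Φ := by
      constructor
      · intro h h' hh
        ext j : 2
        by_cases hj : ∀ p : Pt w w'', Quotient.mk (D.strings E) (outerPt p) ≠
            Quotient.mk _ (.inr (.inl j))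
        · exact congrFun hh ⟨_, hj⟩
        · push Not at hj
          obtain ⟨p, hp⟩ := hj
          have hp' := Quotient.exact hp
          have e1 := hconst h.1 h.2 _ _ hp'
          have e2 := hconst h'.1 h'.2 _ _ hp'
          rw [hout] at e1 e2
          exact e1.symm.trans e2
      · intro k
        let ψ : Quotient (D.strings E) → Bool := fun c =>
          if hc : ∀ p : Pt w w'', Quotient.mk (D.strings E) (outerPt p) ≠ c then k ⟨c, hc⟩
          else Sum.elim f g (not_forall_not.1 hc).choose
        have hψ : ∀ p : Pt w w'', ψ (Quotient.mk _ (outerPt p)) = Sum.elim f g p := by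
          intro p
          have hn : ¬∀ q : Pt w w'', Quotient.mk (D.strings E) (outerPt q) ≠
              Quotient.mk _ (outerPt p) := fun h => h p rfl
          simp only [ψ, dif_neg hn]
          have hs := (not_forall_not.1 hn).choose_spec
          have hs' : D.strings E (outerPt _) (outerPt p) := Quotient.exact hs
          rw [D.strings_outerPt] at hs'
          rcases hs' with hs' | hs'
          · rw [← hs']
          · exact ((congrArg (Sum.elim f g) hs').trans (hc _)).symm
        have hh : (Sum.elim f (Sum.elim (fun j => ψ (Quotient.mk _ (.inr (.inl j)))) g)) =
            fun x => ψ (Quotient.mk _ x) := by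
          funext x
          rcases x with i | j | l
          · exact (hψ (.inl i)).symm
          · rfl
          · exact (hψ (.inr l)).symm
        refine ⟨⟨fun j => ψ (Quotient.mk _ (.inr (.inl j))), ?_⟩, ?_⟩
        · rw [compatible_iff, hh]
          refine ⟨fun x => congrArg ψ (Quotient.sound ?_), fun x => congrArg ψ (Quotient.sound ?_)⟩
          · exact (D.strings E).symm (glue_s _ _ x)
          · exact (D.strings E).symm (glue_t _ _ x)
        · funext ⟨c, hc'⟩
          induction c using Quotient.inductionOn with
          | h x =>
            change (Sum.elim f (Sum.elim (fun j => ψ (Quotient.mk _ (.inr (.inl j)))) g)) x = _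
            rw [hh]
            simp only [ψ, dif_pos hc']
    rw [Nat.card_congr (Equiv.ofBijective Φ hΦ), Nat.card_fun]
    simp
  · rw [mul_zero]
    have : IsEmpty {h : Fin w'.length → Bool //
        D.Compatible (Sum.elim f h) ∧ E.Compatible (Sum.elim h g)} := by
      refine ⟨fun ⟨h, hh⟩ => hc fun p => ?_⟩
      rw [← hout h, ← hout h]
      exact (hconst h hh _ _ (D.compPartner_rel E p)).symm
    exact Nat.card_of_isEmpty

lemma Diagram.mat_id (w : Word) : (Diagram.id w).mat = 1 := by
  classical
  ext f g
  have : (Diagram.id w).Compatible (Sum.elim f g) ↔ f = g := by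
    constructor
    · intro h
      funext i
      exact h (.inr i)
    · rintro rfl (i | i) <;> rfl
  simp [mat, Matrix.one_apply, this]

lemma Diagram.id_comp (D : Diagram w w') :
    (Diagram.id w).loops D = 0 ∧ (Diagram.id w).comp D = D := by
  refine mat_ext ?_
  rw [← mat_mul, mat_id, Matrix.one_mul, pow_zero, one_smul]

lemma Diagram.comp_id (D : Diagram w w') :
    D.loops (Diagram.id w') = 0 ∧ D.comp (Diagram.id w') = D := by
  refine mat_ext ?_
  rw [← mat_mul, mat_id, Matrix.mul_one, pow_zero, one_smul]

lemma Diagram.comp_assoc {w''' : Word} (D : Diagram w w') (E : Diagram w' w'')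
    (F : Diagram w'' w''') :
    D.loops E + (D.comp E).loops F = E.loops F + D.loops (E.comp F) ∧
      (D.comp E).comp F = D.comp (E.comp F) := by
  refine mat_ext ?_
  have h := Matrix.mul_assoc D.mat E.mat F.mat
  rw [mat_mul, mat_mul, Matrix.smul_mul, Matrix.mul_smul, mat_mul, mat_mul, smul_smul,
    smul_smul] at h
  rwa [pow_add, pow_add]

lemma Diagram.mat_tensor {v v' : Word} (D : Diagram w w') (E : Diagram v v')
    (f : Fin (w ++ v).length → Bool) (g : Fin (w' ++ v').length → Bool) :
    (D.tensor E).mat f g =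
      D.mat (f ∘ appendPt w v ∘ Sum.inl) (g ∘ appendPt w' v' ∘ Sum.inl) *
      E.mat (f ∘ appendPt w v ∘ Sum.inr) (g ∘ appendPt w' v' ∘ Sum.inr) := by
  classical
  have h1 : ∀ p : Pt w w', Sum.elim f g (juxtaposePt w w' v v' (.inl p)) =
      Sum.elim (f ∘ appendPt w v ∘ Sum.inl) (g ∘ appendPt w' v' ∘ Sum.inl) p := by
    rintro (i | i) <;> rfl
  have h2 : ∀ p : Pt v v', Sum.elim f g (juxtaposePt w w' v v' (.inr p)) =
      Sum.elim (f ∘ appendPt w v ∘ Sum.inr) (g ∘ appendPt w' v' ∘ Sum.inr) p := by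
    rintro (i | i) <;> rfl
  have h : (D.tensor E).Compatible (Sum.elim f g) ↔
      D.Compatible (Sum.elim (f ∘ appendPt w v ∘ Sum.inl) (g ∘ appendPt w' v' ∘ Sum.inl)) ∧
      E.Compatible (Sum.elim (f ∘ appendPt w v ∘ Sum.inr) (g ∘ appendPt w' v' ∘ Sum.inr)) := by
    unfold Compatible
    rw [(juxtaposePt w w' v v').surjective.forall, Sum.forall]
    simp only [tensor_partner_inl, tensor_partner_inr, h1, h2]
  simp only [mat, h, ite_and]
  split_ifs <;> rfl

lemma Diagram.tensor_comp_tensor {v v' v'' : Word} (D : Diagram w w') (D' : Diagram v v')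
    (E : Diagram w' w'') (E' : Diagram v' v'') :
    (D.tensor D').loops (E.tensor E') = D.loops E + D'.loops E' ∧
      (D.tensor D').comp (E.tensor E') = (D.comp E).tensor (D'.comp E') := by
  refine mat_ext ?_
  rw [← mat_mul]
  ext f g
  rw [Matrix.smul_apply, mat_tensor, smul_eq_mul, pow_add, mul_mul_mul_comm]
  have h1 := congrFun (congrFun (D.mat_mul E) (f ∘ appendPt w v ∘ Sum.inl))
    (g ∘ appendPt w'' v'' ∘ Sum.inl)
  have h2 := congrFun (congrFun (D'.mat_mul E') (f ∘ appendPt w v ∘ Sum.inr))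
    (g ∘ appendPt w'' v'' ∘ Sum.inr)
  rw [Matrix.smul_apply, smul_eq_mul] at h1 h2
  rw [← h1, ← h2, Matrix.mul_apply, Matrix.mul_apply, Matrix.mul_apply, Finset.sum_mul_sum,
    ← Fintype.sum_prod_type']
  let e : (Fin (w' ++ v').length → Bool) ≃ (Fin w'.length → Bool) × (Fin v'.length → Bool) :=
    ((appendPt w' v').arrowCongr (Equiv.refl Bool)).symm.trans
      (Equiv.sumArrowEquivProdArrow _ _ _)
  refine Fintype.sum_equiv e _ _ fun h => ?_
  rw [mat_tensor, mat_tensor, mul_mul_mul_comm]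
  rfl

lemma Diagram.id_tensor_id (w v : Word) :
    (Diagram.id w).tensor (Diagram.id v) = Diagram.id (w ++ v) := by
  ext p : 2
  obtain ⟨(i | i) | (i | i), rfl⟩ := (juxtaposePt w w v v).surjective p
  · rw [tensor_partner_inl]; rfl
  · rw [tensor_partner_inl]; rfl
  · rw [tensor_partner_inr]; rfl
  · rw [tensor_partner_inr]; rfl

end Colouring

/-! ### Associativity of juxtaposition -/

section Code

/-- The graph of the pairing, with the boundary points regarded as natural numbers. -/
def Diagram.code {w w' : Word} (D : Diagram w w') (x y : ℕ ⊕ ℕ) : Prop :=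
  ∃ p, Sum.map Fin.val Fin.val p = x ∧ Sum.map Fin.val Fin.val (D.partner p) = y

lemma Diagram.heq_of_code {w w' v v' : Word} {D : Diagram w w'} {E : Diagram v v'} (h : w = v)
    (h' : w' = v') (hDE : ∀ x y, D.code x y ↔ E.code x y) : D ≍ E := by
  subst h h'
  have hinj : Function.Injective (Sum.map Fin.val Fin.val : Pt w w' → ℕ ⊕ ℕ) :=
    Fin.val_injective.sumMap Fin.val_injective
  refine heq_of_eq ?_
  ext p : 2
  obtain ⟨q, h1, h2⟩ := (hDE _ _).1 ⟨p, rfl, rfl⟩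
  rw [← hinj h2, hinj h1]

lemma Diagram.code_tensor {w w' v v' : Word} (D : Diagram w w') (E : Diagram v v') (x y : ℕ ⊕ ℕ) :
    (D.tensor E).code x y ↔ D.code x y ∨ ∃ x' y', E.code x' y' ∧
      Sum.map (w.length + ·) (w'.length + ·) x' = x ∧
      Sum.map (w.length + ·) (w'.length + ·) y' = y := by
  have h1 : ∀ p : Pt w w', Sum.map Fin.val Fin.val (juxtaposePt w w' v v' (.inl p)) =
      Sum.map Fin.val Fin.val p := by
    rintro (i | i) <;> rfl
  have h2 : ∀ p : Pt v v', Sum.map Fin.val Fin.val (juxtaposePt w w' v v' (.inr p)) =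
      Sum.map (w.length + ·) (w'.length + ·) (Sum.map Fin.val Fin.val p) := by
    rintro (i | i) <;> rfl
  unfold code
  rw [(juxtaposePt w w' v v').surjective.exists, Sum.exists]
  simp only [tensor_partner_inl, tensor_partner_inr, h1, h2]
  refine or_congr Iff.rfl ⟨?_, ?_⟩
  · rintro ⟨p, hp, hp'⟩
    exact ⟨_, _, ⟨p, rfl, rfl⟩, hp, hp'⟩
  · rintro ⟨_, _, ⟨p, rfl, rfl⟩, hp, hp'⟩
    exact ⟨p, hp, hp'⟩

lemma Diagram.tensor_assoc {w w' v v' u u' : Word} (D : Diagram w w') (E : Diagram v v')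
    (F : Diagram u u') : (D.tensor E).tensor F ≍ D.tensor (E.tensor F) := by
  refine heq_of_code (List.append_assoc _ _ _) (List.append_assoc _ _ _) fun x y => ?_
  have hmap : ∀ z : ℕ ⊕ ℕ, Sum.map (w.length + ·) (w'.length + ·)
      (Sum.map (v.length + ·) (v'.length + ·) z) =
      Sum.map ((w ++ v).length + ·) ((w' ++ v').length + ·) z := by
    rintro (i | i) <;> simp [add_assoc]
  simp only [code_tensor, or_assoc]
  refine or_congr Iff.rfl ⟨?_, ?_⟩
  · rintro (⟨x', y', h, h1, h2⟩ | ⟨x', y', h, h1, h2⟩)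
    · exact ⟨x', y', Or.inl h, h1, h2⟩
    · exact ⟨_, _, Or.inr ⟨x', y', h, rfl, rfl⟩, (hmap _).trans h1, (hmap _).trans h2⟩
  · rintro ⟨_, _, h | ⟨x', y', h, rfl, rfl⟩, h1, h2⟩
    · exact Or.inl ⟨_, _, h, h1, h2⟩
    · exact Or.inr ⟨x', y', h, (hmap _).symm.trans h1, (hmap _).symm.trans h2⟩

lemma Diagram.id_nil_tensor {w w' : Word} (D : Diagram w w') : (Diagram.id []).tensor D ≍ D := by
  refine heq_of_code rfl rfl fun x y => ?_
  have hmap : ∀ z : ℕ ⊕ ℕ, Sum.map (([] : Word).length + ·) (([] : Word).length + ·) z = z := by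
    rintro (i | i) <;> simp
  have h0 : ¬(Diagram.id []).code x y := by rintro ⟨i | i, -⟩ <;> exact i.elim0
  simp only [code_tensor, hmap, h0, false_or]
  constructor
  · rintro ⟨_, _, h, rfl, rfl⟩
    exact h
  · exact fun h => ⟨_, _, h, rfl, rfl⟩

lemma Diagram.tensor_id_nil {w w' : Word} (D : Diagram w w') : D.tensor (Diagram.id []) ≍ D := by
  refine heq_of_code (List.append_nil _) (List.append_nil _) fun x y => ?_
  have h0 : ∀ x y, ¬(Diagram.id []).code x y := by rintro x y ⟨i | i, -⟩ <;> exact i.elim0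
  simp [code_tensor, h0]

end Code

/-! ### The tensor category of oriented Kauffman diagrams -/

open CategoryTheory MonoidalCategory

/-- The tensor category `O_d`. Its objects are the words in `X` and `X^*`. -/
@[ext]
structure OrientedKauffman (d : ℂ) where
  word : Word

namespace OrientedKauffman

/-- Composition: the bilinear extension of the concatenation of diagrams, every closed loop being
replaced by the factor `d` (whatever its orientation). -/
noncomputable def compHom (d : ℂ) {w w' w'' : Word} :
    (Diagram w w' →₀ ℂ) →ₗ[ℂ] (Diagram w' w'' →₀ ℂ) →ₗ[ℂ] (Diagram w w'' →₀ ℂ) :=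
  Finsupp.linearCombination ℂ fun D =>
    Finsupp.linearCombination ℂ fun E => Finsupp.single (D.comp E) (d ^ D.loops E)

/-- Tensor product: the bilinear extension of the juxtaposition of diagrams. -/
noncomputable def tensorHom {w w' v v' : Word} :
    (Diagram w w' →₀ ℂ) →ₗ[ℂ] (Diagram v v' →₀ ℂ) →ₗ[ℂ] (Diagram (w ++ v) (w' ++ v') →₀ ℂ) :=
  Finsupp.linearCombination ℂ fun D =>
    Finsupp.linearCombination ℂ fun E => Finsupp.single (D.tensor E) 1

lemma compHom_single (d : ℂ) {w w' w'' : Word} (D : Diagram w w') (E : Diagram w' w'') (a b : ℂ) :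
    compHom d (Finsupp.single D a) (Finsupp.single E b) =
      Finsupp.single (D.comp E) (a * b * d ^ D.loops E) := by
  simp only [compHom, Finsupp.linearCombination_single, LinearMap.smul_apply, Finsupp.smul_single,
    smul_eq_mul, mul_assoc]

lemma tensorHom_single {w w' v v' : Word} (D : Diagram w w') (E : Diagram v v') (a b : ℂ) :
    tensorHom (Finsupp.single D a) (Finsupp.single E b) =
      Finsupp.single (D.tensor E) (a * b) := by
  simp only [tensorHom, Finsupp.linearCombination_single, LinearMap.smul_apply,
    Finsupp.smul_single, smul_eq_mul, mul_one]

variable {d : ℂ}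

noncomputable instance : Category (OrientedKauffman d) where
  Hom X Y := Diagram X.word Y.word →₀ ℂ
  id X := Finsupp.single (Diagram.id X.word) 1
  comp f g := compHom d f g
  id_comp f := by
    induction f using Finsupp.induction_linear with
    | zero => simp
    | add f g hf hg => simp only [map_add, hf, hg]
    | single D a => rw [compHom_single, D.id_comp.1, D.id_comp.2]; simp
  comp_id f := by
    induction f using Finsupp.induction_linear with
    | zero => simp
    | add f g hf hg => simp only [map_add, LinearMap.add_apply, hf, hg]
    | single D a => rw [compHom_single, D.comp_id.1, D.comp_id.2]; simp
  assoc f g h := by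
    induction f using Finsupp.induction_linear with
    | zero => simp
    | add f f' hf hf' => simp only [map_add, LinearMap.add_apply, hf, hf']
    | single D a =>
    induction g using Finsupp.induction_linear with
    | zero => simp
    | add f f' hf hf' => simp only [map_add, LinearMap.add_apply, hf, hf']
    | single E b =>
    induction h using Finsupp.induction_linear with
    | zero => simp
    | add f f' hf hf' => simp only [map_add, hf, hf']
    | single F c =>
    simp only [compHom_single]
    obtain ⟨h1, h2⟩ := D.comp_assoc E F
    rw [h2]
    congr 1
    calc a * b * d ^ D.loops E * c * d ^ (D.comp E).loops F
        = a * b * c * d ^ (D.loops E + (D.comp E).loops F) := by ring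
      _ = a * (b * c * d ^ E.loops F) * d ^ D.loops (E.comp F) := by rw [h1]; ring

noncomputable instance : Preadditive (OrientedKauffman d) where
  homGroup X Y := inferInstanceAs (AddCommGroup (Diagram X.word Y.word →₀ ℂ))
  add_comp _ _ _ _ _ _ := by exact LinearMap.map_add₂ (compHom d) _ _ _
  comp_add _ _ _ _ _ _ := by exact map_add (compHom d _) _ _

noncomputable instance : Linear ℂ (OrientedKauffman d) where
  homModule X Y := inferInstanceAs (Module ℂ (Diagram X.word Y.word →₀ ℂ))
  smul_comp _ _ _ _ _ _ := by exact LinearMap.map_smul₂ (compHom d) _ _ _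
  comp_smul _ _ _ _ _ _ := by exact map_smul (compHom d _) _ _

/-- A diagram regarded as a morphism of `O_d`. -/
noncomputable def ofDiagram (d : ℂ) {w w' : Word} (D : Diagram w w') :
    (⟨w⟩ : OrientedKauffman d) ⟶ ⟨w'⟩ :=
  Finsupp.single D (1 : ℂ)

lemma append_assoc' (X Y Z : OrientedKauffman d) :
    (⟨(X.word ++ Y.word) ++ Z.word⟩ : OrientedKauffman d) = ⟨X.word ++ (Y.word ++ Z.word)⟩ :=
  congrArg mk (List.append_assoc _ _ _)

lemma append_nil' (X : OrientedKauffman d) : (⟨X.word ++ []⟩ : OrientedKauffman d) = X :=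
  congrArg mk (List.append_nil _)

/-- The tensor product is strict: objects are multiplied by joining words, the unit object is the
empty word, and the associativity and unit constraints are identities. -/
noncomputable instance : MonoidalCategoryStruct (OrientedKauffman d) where
  tensorObj X Y := ⟨X.word ++ Y.word⟩
  whiskerLeft X _ _ f := tensorHom (Finsupp.single (Diagram.id X.word) 1) f
  whiskerRight f Y := tensorHom f (Finsupp.single (Diagram.id Y.word) 1)
  tensorHom f g := tensorHom f g
  tensorUnit := ⟨[]⟩
  associator X Y Z := eqToIso (append_assoc' X Y Z)
  leftUnitor X := Iso.refl X
  rightUnitor X := eqToIso (append_nil' X)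

lemma single_comp_eqToHom {X Y X' Y' : OrientedKauffman d} (D : Diagram X.word Y.word)
    (D' : Diagram X'.word Y'.word) (hX : X = X') (hY : Y = Y') (h : D ≍ D') (a : ℂ) :
    (Finsupp.single D a : X ⟶ Y) ≫ eqToHom hY =
      eqToHom hX ≫ (Finsupp.single D' a : X' ⟶ Y') := by
  subst hX hY
  obtain rfl := eq_of_heq h
  simp

lemma id_tensorHom_id' (X Y : OrientedKauffman d) : (𝟙 X ⊗ₘ 𝟙 Y) = 𝟙 (X ⊗ Y) := by
  change tensorHom (Finsupp.single _ _) (Finsupp.single _ _) = Finsupp.single _ _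
  rw [tensorHom_single, Diagram.id_tensor_id, one_mul]
  rfl

lemma eqToHom_tensorHom_eqToHom {X X' Y Y' : OrientedKauffman d} (hX : X = X') (hY : Y = Y') :
    (eqToHom hX ⊗ₘ eqToHom hY) = eqToHom (by rw [hX, hY]) := by
  subst hX hY
  exact id_tensorHom_id' _ _

noncomputable instance : MonoidalCategory (OrientedKauffman d) :=
  MonoidalCategory.ofTensorHom
    (id_tensorHom_id := id_tensorHom_id')
    (id_tensorHom := fun _ _ _ _ => rfl)
    (tensorHom_id := fun _ _ => rfl)
    (tensorHom_comp_tensorHom := by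
      intro X₁ Y₁ Z₁ X₂ Y₂ Z₂ f₁ f₂ g₁ g₂
      change compHom d (tensorHom f₁ f₂) (tensorHom g₁ g₂) =
        tensorHom (compHom d f₁ g₁) (compHom d f₂ g₂)
      induction f₁ using Finsupp.induction_linear with
      | zero => simp
      | add f f' hf hf' => simp only [map_add, LinearMap.add_apply, hf, hf']
      | single D a =>
      induction f₂ using Finsupp.induction_linear with
      | zero => simp
      | add f f' hf hf' => simp only [map_add, LinearMap.add_apply, hf, hf']
      | single D' a' =>
      induction g₁ using Finsupp.induction_linear with
      | zero => simp
      | add f f' hf hf' => simp only [map_add, LinearMap.add_apply, hf, hf']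
      | single E b =>
      induction g₂ using Finsupp.induction_linear with
      | zero => simp
      | add f f' hf hf' => simp only [map_add, hf, hf']
      | single E' b' =>
      simp only [compHom_single, tensorHom_single]
      obtain ⟨h1, h2⟩ := D.tensor_comp_tensor D' E E'
      rw [h1, h2, pow_add]
      congr 1
      ring)
    (associator_naturality := by
      intro X₁ X₂ X₃ Y₁ Y₂ Y₃ f₁ f₂ f₃
      change compHom d (tensorHom (tensorHom f₁ f₂) f₃) (eqToHom (append_assoc' Y₁ Y₂ Y₃)) =
        compHom d (eqToHom (append_assoc' X₁ X₂ X₃)) (tensorHom f₁ (tensorHom f₂ f₃))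
      induction f₁ using Finsupp.induction_linear with
      | zero => simp
      | add f f' hf hf' => simp only [map_add, LinearMap.add_apply, hf, hf']
      | single D a =>
      induction f₂ using Finsupp.induction_linear with
      | zero => simp
      | add f f' hf hf' => simp only [map_add, LinearMap.add_apply, hf, hf']
      | single E b =>
      induction f₃ using Finsupp.induction_linear with
      | zero => simp
      | add f f' hf hf' => simp only [map_add, LinearMap.add_apply, hf, hf']
      | single F c =>
      simp only [tensorHom_single]
      rw [← mul_assoc]
      exact single_comp_eqToHom (d := d) (X := ⟨(X₁.word ++ X₂.word) ++ X₃.word⟩)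
        (Y := ⟨(Y₁.word ++ Y₂.word) ++ Y₃.word⟩) (X' := ⟨X₁.word ++ (X₂.word ++ X₃.word)⟩)
        (Y' := ⟨Y₁.word ++ (Y₂.word ++ Y₃.word)⟩) _ _ (append_assoc' X₁ X₂ X₃)
        (append_assoc' Y₁ Y₂ Y₃) (D.tensor_assoc E F) (a * b * c))
    (leftUnitor_naturality := by
      intro X Y f
      change compHom d (tensorHom (Finsupp.single (Diagram.id []) 1) f) (𝟙 Y) =
        compHom d (𝟙 X) f
      induction f using Finsupp.induction_linear with
      | zero => simp
      | add f f' hf hf' => simp only [map_add, hf, hf', LinearMap.add_apply]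
      | single D a =>
      rw [tensorHom_single, one_mul]
      exact single_comp_eqToHom (d := d) (X := X) (Y := Y) (X' := X) (Y' := Y)
        _ _ rfl rfl (D.id_nil_tensor) a)
    (rightUnitor_naturality := by
      intro X Y f
      change compHom d (tensorHom f (Finsupp.single (Diagram.id []) 1)) (eqToHom (append_nil' Y)) =
        compHom d (eqToHom (append_nil' X)) f
      induction f using Finsupp.induction_linear with
      | zero => simp
      | add f f' hf hf' => simp only [map_add, hf, hf', LinearMap.add_apply]
      | single D a =>
      rw [tensorHom_single, mul_one]
      exact single_comp_eqToHom (d := d) (X := ⟨X.word ++ []⟩) (Y := ⟨Y.word ++ []⟩) (X' := X)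
        (Y' := Y) _ _ (append_nil' X) (append_nil' Y) (D.tensor_id_nil) a)
    (pentagon := by
      intro W X Y Z
      change (eqToHom (append_assoc' W X Y) ⊗ₘ eqToHom rfl) ≫ eqToHom (append_assoc' W (X ⊗ Y) Z) ≫
        (eqToHom rfl ⊗ₘ eqToHom (append_assoc' X Y Z)) =
        eqToHom (append_assoc' (W ⊗ X) Y Z) ≫ eqToHom (append_assoc' W X (Y ⊗ Z))
      simp only [eqToHom_tensorHom_eqToHom]
      exact (congrArg _ (eqToHom_trans _ _)).trans ((eqToHom_trans _ _).trans
        (eqToHom_trans _ _).symm))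
    (triangle := by
      intro X Y
      change eqToHom (append_assoc' X (𝟙_ _) Y) ≫ (eqToHom rfl ⊗ₘ eqToHom rfl) =
        (eqToHom (append_nil' X) ⊗ₘ eqToHom rfl)
      simp only [eqToHom_tensorHom_eqToHom]
      exact eqToHom_trans _ _)

instance : MonoidalPreadditive (OrientedKauffman d) where
  whiskerLeft_zero := by intros; exact map_zero (tensorHom _)
  zero_whiskerRight := by intros; exact LinearMap.map_zero₂ tensorHom _
  whiskerLeft_add := by intros; exact map_add (tensorHom _) _ _
  add_whiskerRight := by intros; exact LinearMap.map_add₂ tensorHom _ _ _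

instance : MonoidalLinear ℂ (OrientedKauffman d) where
  whiskerLeft_smul := by intros; exact map_smul (tensorHom _) _ _
  smul_whiskerRight := by intros; exact LinearMap.map_smul₂ tensorHom _ _ _

end OrientedKauffman

/-! ### Reflection of diagrams and the number of arcs -/

/-- The reflection of a diagram in a horizontal line, with the orientation of all strings reversed
(so that the labels of the boundary points are kept). -/
def Diagram.reflect {w w' : Word} (D : Diagram w w') : Diagram w' w where
  partner p := (D.partner p.swap).swap
  partner_partner p := by simp [D.partner_partner]
  oriented p := by
    have h : ∀ {v v' : Word} (q : Pt v v'), charge q.swap = -charge q := by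
      rintro v v' (i | i) <;> simp [charge]
    rw [h, D.oriented, h, neg_neg]
  planar p q := by
    have h : ∀ {v v' : Word} (q : Pt v v'), pos q.swap + pos q + 1 = v.length + v'.length := by
      rintro v v' (i | i) <;> simp only [pos, Sum.swap_inl, Sum.swap_inr, Fin.val_rev] <;> omega
    have h1 := h p
    have h2 := h q
    have h3 := h (D.partner p.swap)
    have h4 := h (D.partner q.swap)
    have h5 := D.planar (D.partner q.swap) (D.partner p.swap)
    simp only [D.partner_partner] at h5
    omega

/-- The number of arcs joining two upper points, i.e. of the morphisms `ε_X : X ⊗ X^* → I` and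
`ε_{X^*} : X^* ⊗ X → I` inside `D`. -/
noncomputable def Diagram.upperArcs {w w' : Word} (D : Diagram w w') : ℕ :=
  Nat.card {i : Fin w.length // ∃ i', i < i' ∧ D.partner (.inl i) = .inl i'}

/-- The number of arcs joining two lower points, i.e. of the morphisms `δ_X : I → X^* ⊗ X` and
`δ_{X^*} : I → X ⊗ X^*` inside `D`. -/
noncomputable def Diagram.lowerArcs {w w' : Word} (D : Diagram w w') : ℕ :=
  Nat.card {j : Fin w'.length // ∃ j', j < j' ∧ D.partner (.inr j) = .inr j'}

/-- The integer `♯(D)`. -/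
noncomputable def Diagram.sharp {w w' : Word} (D : Diagram w w') : ℤ := D.upperArcs - D.lowerArcs

/-! ### C*-structures on tensor categories -/

section CStar

variable (C : Type*) [Category C] [Preadditive C] [Linear ℂ C] [MonoidalCategory C]

/-- A `*`-structure compatible with the tensor structure: a contravariant, antilinear, involutive
operation on morphisms that fixes the objects and respects tensor products (the associativity and
unit constraints being unitary). -/
structure StarStructure where
  star : ∀ {X Y : C}, (X ⟶ Y) → (Y ⟶ X)
  star_add : ∀ {X Y : C} (f g : X ⟶ Y), star (f + g) = star f + star g
  star_smul : ∀ {X Y : C} (c : ℂ) (f : X ⟶ Y), star (c • f) = (starRingEnd ℂ c) • star f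
  star_star : ∀ {X Y : C} (f : X ⟶ Y), star (star f) = f
  star_comp : ∀ {X Y Z : C} (f : X ⟶ Y) (g : Y ⟶ Z), star (f ≫ g) = star g ≫ star f
  star_tensor : ∀ {X Y X' Y' : C} (f : X ⟶ Y) (g : X' ⟶ Y'), star (f ⊗ₘ g) = star f ⊗ₘ star g
  star_associator : ∀ X Y Z : C, star (α_ X Y Z).hom = (α_ X Y Z).inv
  star_leftUnitor : ∀ X : C, star (λ_ X).hom = (λ_ X).inv
  star_rightUnitor : ∀ X : C, star (ρ_ X).hom = (ρ_ X).inv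

variable {C}

/-- Norms on the spaces of morphisms that make a category with `*`-structure a C*-category. Note that
`f ≫ star f` is the endomorphism `f^* f` of the source of `f`. -/
structure StarStructure.CStarNorm (S : StarStructure C) where
  norm : ∀ X Y : C, Seminorm ℂ (X ⟶ Y)
  eq_zero_of_norm : ∀ {X Y : C} (f : X ⟶ Y), norm X Y f = 0 → f = 0
  complete : ∀ {X Y : C} (u : ℕ → (X ⟶ Y)),
    (∀ ε : ℝ, 0 < ε → ∃ N, ∀ m ≥ N, ∀ n ≥ N, norm X Y (u m - u n) < ε) →
    ∃ f, Filter.Tendsto (fun n => norm X Y (u n - f)) Filter.atTop (nhds 0)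
  norm_comp_le : ∀ {X Y Z : C} (f : X ⟶ Y) (g : Y ⟶ Z),
    norm X Z (f ≫ g) ≤ norm X Y f * norm Y Z g
  norm_star_mul_self : ∀ {X Y : C} (f : X ⟶ Y), norm X X (f ≫ S.star f) = norm X Y f ^ 2
  positive : ∀ {X Y : C} (f : X ⟶ Y), ∃ g : X ⟶ X, f ≫ S.star f = g ≫ S.star g

/-- A compatible C*-structure is a compatible `*`-structure that admits C*-norms (these are then
determined by the `*`-structure). -/
def StarStructure.IsCStar (S : StarStructure C) : Prop := Nonempty S.CStarNorm

/-- Equivalence of `*`-structures on a tensor category: there is a linear monoidal self-equivalence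
that takes the first `*`-operation to the second one and has unitary structure isomorphisms. -/
def StarStructure.Equivalent (S T : StarStructure C) : Prop :=
  ∃ (F : C ⥤ C) (_ : F.Monoidal), F.IsEquivalence ∧ F.Additive ∧ F.Linear ℂ ∧
    (∀ (X Y : C) (f : X ⟶ Y), F.map (S.star f) = T.star (F.map f)) ∧
    T.star (Functor.LaxMonoidal.ε F) = Functor.OplaxMonoidal.η F ∧
    ∀ X Y : C, T.star (Functor.LaxMonoidal.μ F X Y) = Functor.OplaxMonoidal.δ F X Y

end CStar

end KauffmanDiagrams

open KauffmanDiagrams OrientedKauffman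

namespace KauffmanDiagrams

/-! ### Reflections -/

/-! Three independent arguments are combined.

Existence. Colour both ends of every string with two colours that differ along the string, weight
each string at its first end, and normalise by the weight of the source word. The resulting matrices
multiply like diagrams as soon as the weights of a closed loop sum to `d` (`Diagram.weightMat_mul`).
They are linearly independent, because a planar pairing is determined by its opening ends, just as a
bracketing is (`Diagram.linearIndependent_weightMat`). So every parametrisation `d = s (t ^ 2 +
t⁻²)` with `s = ±1` and `d ≠ 0` represents the category faithfully. If `t` is real, which needs `|d|
≥ 2`, the conjugate transpose of the matrix of `D` is the matrix of `s ^ ♯(D) D'`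
(`Diagram.weightMat_reflect`). Operator norms and square roots of positive matrices then provide the
C*-structure (`signStar_isCStar`).

Rigidity. Every diagram is built from identities by caps and cups (`Diagram.induction_caps`), and
the relevant morphism space of a single arc is one-dimensional. A star operation is therefore fixed
by one scalar per letter. The zigzag relation makes the two scalars conjugate, and positivity of
scalars in the endomorphisms of the unit object forces both to be the same real number `a`, with `d`
real and `a d > 0` (`StarStructure.IsCStar.exists_real`). Thus `D^* = a ^ ♯(D) D'`. As `2 ♯(D)` is
the difference of the lengths of the two words, rescaling morphisms by powers of a positive number
indexed by this difference changes `a` by any positive factor. This yields the equivalence of any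
two structures.

Necessity of `d ^ 2 ≥ 4`. On an alternating word the hooks satisfy the Temperley-Lieb relations and
are self-adjoint. Wenzl's recursion produces self-adjoint idempotents, and the fact that `x x^* = 0`
only for `x = 0` forces each ratio of consecutive quantum integers to have the sign of `d`
(`TemperleyLieb.ratio_pos`). For `d ^ 2 < 4` this fails at some stage
(`exists_quantumRatio_mul_le_zero`). -/

lemma charge_swap {w w' : Word} (p : Pt w w') : charge p.swap = -charge p := by
  rcases p with i | i <;> simp [charge]

lemma pos_swap_add {w w' : Word} (p : Pt w w') :
    pos p.swap + pos p + 1 = w.length + w'.length := by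
  rcases p with i | i <;> simp only [pos, Sum.swap_inl, Sum.swap_inr, Fin.val_rev] <;> omega

@[simp] lemma Diagram.reflect_partner {w w' : Word} (D : Diagram w w') (p : Pt w' w) :
    D.reflect.partner p = (D.partner p.swap).swap := rfl

@[simp] lemma Diagram.reflect_reflect {w w' : Word} (D : Diagram w w') : D.reflect.reflect = D := by
  ext p : 2
  simp

@[simp] lemma Diagram.reflect_id (w : Word) : (Diagram.id w).reflect = Diagram.id w := by
  ext p : 2
  simp [Diagram.id]

lemma Diagram.mat_reflect {w w' : Word} (D : Diagram w w') : D.reflect.mat = D.mat.transpose := by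
  classical
  have key : ∀ {v v' : Word} (D : Diagram v v') f g, D.Compatible (Sum.elim f g) →
      D.reflect.Compatible (Sum.elim g f) := by
    intro v v' D f g h p
    have h1 : ∀ q : Pt v v', Sum.elim g f q.swap = Sum.elim f g q := by rintro (i | i) <;> rfl
    rw [reflect_partner, h1, h, ← h1, Sum.swap_swap]
  ext g f
  have : D.reflect.Compatible (Sum.elim g f) ↔ D.Compatible (Sum.elim f g) :=
    ⟨fun h => by simpa using key _ _ _ h, key _ _ _⟩
  simp [mat, this]

/-- The composite and its number of loops are both read off from the colouring matrices, where
reflection is transposition. -/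
lemma Diagram.reflect_comp {w w' w'' : Word} (D : Diagram w w') (E : Diagram w' w'') :
    E.reflect.loops D.reflect = D.loops E ∧
      E.reflect.comp D.reflect = (D.comp E).reflect := by
  refine mat_ext ?_
  rw [← mat_mul, mat_reflect, mat_reflect, mat_reflect, ← Matrix.transpose_mul, mat_mul,
    Matrix.transpose_smul]

lemma Diagram.reflect_tensor {w w' v v' : Word} (D : Diagram w w') (E : Diagram v v') :
    (D.tensor E).reflect = D.reflect.tensor E.reflect := by
  have h1 : ∀ p : Pt w' w ⊕ Pt v' v, (juxtaposePt w' w v' v p).swap =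
      juxtaposePt w w' v v' (Sum.map Sum.swap Sum.swap p) := by
    rintro ((i | i) | (i | i)) <;> rfl
  have h2 : ∀ p : Pt w w' ⊕ Pt v v', (juxtaposePt w w' v v' p).swap =
      juxtaposePt w' w v' v (Sum.map Sum.swap Sum.swap p) := by
    rintro ((i | i) | (i | i)) <;> rfl
  ext p : 2
  obtain ⟨p | p, rfl⟩ := (juxtaposePt w' w v' v).surjective p
  · rw [tensor_partner_inl, reflect_partner, h1, Sum.map_inl, tensor_partner_inl, h2]
    rfl
  · rw [tensor_partner_inr, reflect_partner, h1, Sum.map_inr, tensor_partner_inr, h2]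
    rfl

/-! ### Elementary caps and cups -/

/-- The other letter. -/
def Letter.flip : Letter → Letter
  | X => Xstar
  | Xstar => X

@[simp] lemma Letter.sign_flip (l : Letter) : l.flip.sign = -l.sign := by cases l <;> rfl

lemma Letter.sign_injective : Function.Injective Letter.sign := by
  rintro (_ | _) (_ | _) h <;> simp_all [Letter.sign]

/-- The string that joins two neighbouring upper points. -/
def arc (l : Letter) : Diagram [l, l.flip] [] where
  partner := Sum.map Fin.rev (fun i => i)
  partner_partner := by rintro (i | i) <;> simp
  oriented := by
    rintro (i | i)
    · change Fin 2 at i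
      fin_cases i
      · change l.flip.sign = -l.sign
        simp
      · change l.sign = -l.flip.sign
        simp
    · exact i.elim0
  planar := by
    rintro (i | i) (j | j)
    · change Fin 2 at i
      change Fin 2 at j
      fin_cases i <;> fin_cases j <;> simp [pos]
    · exact j.elim0
    · exact i.elim0
    · exact j.elim0

/-- The diagram with a single upper arc, which joins two neighbouring points. -/
def cap (u : Word) (l : Letter) (v : Word) : Diagram (u ++ l :: l.flip :: v) (u ++ v) :=
  (Diagram.id u).tensor ((arc l).tensor (Diagram.id v))

/-- The diagram with a single lower arc, which joins two neighbouring points. -/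
def cup (u : Word) (l : Letter) (v : Word) : Diagram (u ++ v) (u ++ l :: l.flip :: v) :=
  (cap u l v).reflect

lemma cup_eq_tensor (u : Word) (l : Letter) (v : Word) :
    cup u l v = (Diagram.id u).tensor ((arc l).reflect.tensor (Diagram.id v)) := by
  unfold cup cap
  rw [Diagram.reflect_tensor, Diagram.reflect_tensor, Diagram.reflect_id, Diagram.reflect_id]

/-! ### Inserting two neighbouring letters into a word -/

section Insert

variable (u : Word) (l : Letter) (v : Word)

/-- The position of the first inserted letter. -/
def leftPt : Fin (u ++ l :: l.flip :: v).length := ⟨u.length, by simp⟩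

/-- The position of the second inserted letter. -/
def rightPt : Fin (u ++ l :: l.flip :: v).length := ⟨u.length + 1, by simp⟩

/-- The positions of the other letters. -/
def skip (k : Fin (u ++ v).length) : Fin (u ++ l :: l.flip :: v).length :=
  ⟨if (k : ℕ) < u.length then k else k + 2, by
    have := k.2
    simp only [List.length_append, List.length_cons] at this ⊢
    split_ifs <;> omega⟩

lemma skip_val (k : Fin (u ++ v).length) :
    (skip u l v k : ℕ) = if (k : ℕ) < u.length then (k : ℕ) else k + 2 := rfl

/-- All positions after the insertion of two letters. -/
noncomputable def insertEquiv :
    Bool ⊕ Fin (u ++ v).length ≃ Fin (u ++ l :: l.flip :: v).length :=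
  Equiv.ofBijective (Sum.elim (fun b => bif b then leftPt u l v else rightPt u l v) (skip u l v)) <| by
    rw [Fintype.bijective_iff_injective_and_card]
    constructor
    · rintro (b | k) (b' | k') h <;> have h := congrArg Fin.val h
      · cases b <;> cases b' <;> simp_all [leftPt, rightPt]
      · cases b <;> simp only [Sum.elim_inl, Sum.elim_inr, skip_val, cond_true, cond_false,
          leftPt, rightPt] at h <;> split_ifs at h <;> omega
      · cases b' <;> simp only [Sum.elim_inl, Sum.elim_inr, skip_val, cond_true, cond_false,
          leftPt, rightPt] at h <;> split_ifs at h <;> omega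
      · simp only [Sum.elim_inr, skip_val] at h
        rw [Sum.inr.injEq, Fin.ext_iff]
        split_ifs at h <;> omega
    · simp
      omega

@[simp] lemma insertEquiv_true : insertEquiv u l v (.inl true) = leftPt u l v := rfl
@[simp] lemma insertEquiv_false : insertEquiv u l v (.inl false) = rightPt u l v := rfl
@[simp] lemma insertEquiv_inr (k) : insertEquiv u l v (.inr k) = skip u l v k := rfl

variable {u l v}

lemma skip_injective : Function.Injective (skip u l v) :=
  (insertEquiv u l v).injective.comp Sum.inr_injective

lemma skip_ne_left (k) : skip u l v k ≠ leftPt u l v :=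
  fun h => by simpa using (insertEquiv u l v).injective (a₁ := .inr k) (a₂ := .inl true) h

lemma skip_ne_right (k) : skip u l v k ≠ rightPt u l v :=
  fun h => by simpa using (insertEquiv u l v).injective (a₁ := .inr k) (a₂ := .inl false) h

lemma insert_cases (j : Fin (u ++ l :: l.flip :: v).length) :
    j = leftPt u l v ∨ j = rightPt u l v ∨ ∃ k, j = skip u l v k := by
  obtain ⟨(_ | _) | k, rfl⟩ := (insertEquiv u l v).surjective j
  · exact Or.inr (Or.inl rfl)
  · exact Or.inl rfl
  · exact Or.inr (Or.inr ⟨k, rfl⟩)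

lemma get_left : (u ++ l :: l.flip :: v).get (leftPt u l v) = l := by
  simp [leftPt]

lemma get_right : (u ++ l :: l.flip :: v).get (rightPt u l v) = l.flip := by
  simp [rightPt]

lemma get_skip (k) : (u ++ l :: l.flip :: v).get (skip u l v k) = (u ++ v).get k := by
  by_cases h : (k : ℕ) < u.length
  · simp [skip, h]
  · simp only [skip, h, if_false, List.get_eq_getElem]
    rw [List.getElem_append_right (by omega), List.getElem_append_right (by omega)]
    have : (k : ℕ) + 2 - u.length = (k - u.length) + 1 + 1 := by omega
    simp only [this, List.getElem_cons_succ]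

/-- This and the following values of the pairing are what the tracing of strings through caps and
cups relies on. -/
lemma cap_partner_left :
    (cap u l v).partner (.inl (leftPt u l v)) = .inl (rightPt u l v) := by
  have h := (Diagram.id u).tensor_partner_inr ((arc l).tensor (Diagram.id v))
    (juxtaposePt _ _ v v (.inl (.inl (0 : Fin 2))))
  rw [Diagram.tensor_partner_inl] at h
  exact h

lemma cap_partner_right :
    (cap u l v).partner (.inl (rightPt u l v)) = .inl (leftPt u l v) := by
  rw [← cap_partner_left, Diagram.partner_partner]

lemma cap_partner_skip (k) :
    (cap u l v).partner (.inl (skip u l v k)) = .inr k := by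
  obtain ⟨k | k, rfl⟩ := (appendPt u v).surjective k
  · have h2 := (Diagram.id u).tensor_partner_inl ((arc l).tensor (Diagram.id v)) (.inl k)
    have h1 : skip u l v (appendPt u v (.inl k)) = appendPt u ([l, l.flip] ++ v) (.inl k) :=
      Fin.ext (if_pos k.2)
    rw [h1]
    exact h2
  · have h2 := (Diagram.id u).tensor_partner_inr ((arc l).tensor (Diagram.id v))
      (juxtaposePt _ _ v v (.inr (.inl k)))
    have h1 : skip u l v (appendPt u v (.inr k)) =
        appendPt u ([l, l.flip] ++ v) (.inr (appendPt [l, l.flip] v (.inr k))) := by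
      refine Fin.ext ?_
      change (if u.length + (k : ℕ) < u.length then _ else u.length + (k : ℕ) + 2) =
          u.length + (2 + (k : ℕ))
      rw [if_neg (by omega)]; omega
    have h3 : appendPt u v (.inr k) = appendPt u ([] ++ v) (.inr (appendPt [] v (.inr k))) := by
      refine Fin.ext ?_
      change u.length + (k : ℕ) = u.length + (0 + (k : ℕ))
      omega
    rw [h1, h3]
    refine h2.trans ?_
    rw [Diagram.tensor_partner_inr]
    rfl

lemma cap_partner_inr (k) :
    (cap u l v).partner (.inr k) = .inl (skip u l v k) := by
  rw [← cap_partner_skip, Diagram.partner_partner]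

lemma cup_partner_left :
    (cup u l v).partner (.inr (leftPt u l v)) = .inr (rightPt u l v) := by
  simp [cup, cap_partner_left]

lemma cup_partner_right :
    (cup u l v).partner (.inr (rightPt u l v)) = .inr (leftPt u l v) := by
  simp [cup, cap_partner_right]

lemma cup_partner_skip (k) :
    (cup u l v).partner (.inr (skip u l v k)) = .inl k := by
  simp [cup, cap_partner_skip]

lemma cup_partner_inl (k) :
    (cup u l v).partner (.inl k) = .inr (skip u l v k) := by
  simp [cup, cap_partner_inr]

variable {w : Word}

/-- The boundary points that remain when two neighbouring lower points are removed. -/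
def keepPt : Pt w (u ++ v) → Pt w (u ++ l :: l.flip :: v) := Sum.map id (skip u l v)

lemma keepPt_injective : Function.Injective (keepPt : Pt w (u ++ v) → Pt w (u ++ l :: l.flip :: v)) :=
  Function.injective_id.sumMap skip_injective

lemma keepPt_ne_left (p : Pt w (u ++ v)) : keepPt p ≠ .inr (leftPt u l v) := by
  rcases p with i | k
  · simp [keepPt]
  · simpa [keepPt] using skip_ne_left k

lemma keepPt_ne_right (p : Pt w (u ++ v)) : keepPt p ≠ .inr (rightPt u l v) := by
  rcases p with i | k
  · simp [keepPt]
  · simpa [keepPt] using skip_ne_right k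

lemma keepPt_cases (x : Pt w (u ++ l :: l.flip :: v)) :
    x = .inr (leftPt u l v) ∨ x = .inr (rightPt u l v) ∨ ∃ p, x = keepPt p := by
  rcases x with i | j
  · exact Or.inr (Or.inr ⟨.inl i, rfl⟩)
  · rcases insert_cases j with rfl | rfl | ⟨k, rfl⟩
    · exact Or.inl rfl
    · exact Or.inr (Or.inl rfl)
    · exact Or.inr (Or.inr ⟨.inr k, rfl⟩)

lemma charge_keepPt (p : Pt w (u ++ v)) :
    charge (keepPt p : Pt w (u ++ l :: l.flip :: v)) = charge p := by
  rcases p with i | k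
  · rfl
  · exact congrArg (fun a : Letter => -a.sign) (get_skip k)

lemma charge_left : charge (.inr (leftPt u l v) : Pt w (u ++ l :: l.flip :: v)) = -l.sign :=
  congrArg (fun a : Letter => -a.sign) get_left

lemma charge_right : charge (.inr (rightPt u l v) : Pt w (u ++ l :: l.flip :: v)) = l.sign := by
  rw [charge, get_right, Letter.sign_flip, neg_neg]

lemma pos_keepPt (p : Pt w (u ++ v)) :
    (pos (keepPt p : Pt w (u ++ l :: l.flip :: v)) = pos p ∧ pos p < w.length + v.length) ∨
    (pos (keepPt p : Pt w (u ++ l :: l.flip :: v)) = pos p + 2 ∧ w.length + v.length ≤ pos p) := by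
  rcases p with i | k
  · exact Or.inl ⟨rfl, by simp only [pos]; omega⟩
  · have hk := k.2
    simp only [keepPt, Sum.map_inr, pos, Fin.val_rev, skip_val, List.length_append,
      List.length_cons] at hk ⊢
    split_ifs <;> omega

lemma pos_left : pos (.inr (leftPt u l v) : Pt w (u ++ l :: l.flip :: v)) =
    w.length + v.length + 1 := by
  simp only [pos, Fin.val_rev, leftPt, List.length_append, List.length_cons]; omega

lemma pos_right : pos (.inr (rightPt u l v) : Pt w (u ++ l :: l.flip :: v)) =
    w.length + v.length := by
  simp only [pos, Fin.val_rev, rightPt, List.length_append, List.length_cons]; omega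

lemma pos_keepPt_lt (p q : Pt w (u ++ v)) :
    pos (keepPt p : Pt w (u ++ l :: l.flip :: v)) < pos (keepPt q : Pt w (u ++ l :: l.flip :: v)) ↔
      pos p < pos q := by
  have h1 := pos_keepPt (l := l) p
  have h2 := pos_keepPt (l := l) q
  omega

/-! ### Attaching a cap or a cup -/

lemma Diagram.partner_comp_eq {w w' w'' : Word} (D : Diagram w w') (E : Diagram w' w'')
    {p q : Pt w w''} (hne : q ≠ p) (h : D.strings E (outerPt p) (outerPt q)) :
    (D.comp E).partner p = q := by
  rw [D.strings_outerPt] at h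
  exact (h.resolve_left hne).symm

/-- The cap continues each kept point by a vertical string, so a string of the composite can be
followed inside `D`. -/
lemma strings_cap_keep (D : Diagram w (u ++ l :: l.flip :: v)) (p : Pt w (u ++ v)) :
    D.strings (cap u l v) (outerPt p) (upperPt (keepPt p)) := by
  rcases p with i | k
  · exact (D.strings _).refl _
  · have h := (D.strings_lower (cap u l v) (outerPt (.inr k)) (.inr k)).2 ((D.strings _).refl _)
    rw [cap_partner_inr] at h
    exact h

lemma strings_cap_arc (D : Diagram w (u ++ l :: l.flip :: v)) :
    D.strings (cap u l v) (upperPt (.inr (leftPt u l v))) (upperPt (.inr (rightPt u l v))) := by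
  have h := (D.strings_lower (cap u l v) (upperPt (.inr (leftPt u l v)))
    (.inl (leftPt u l v))).2 ((D.strings _).refl _)
  rw [cap_partner_left] at h
  exact h

lemma strings_partner {w w' w'' : Word} (D : Diagram w w') (E : Diagram w' w'') (p : Pt w w') :
    D.strings E (upperPt p) (upperPt (D.partner p)) :=
  (D.strings_upper E _ p).2 ((D.strings E).refl _)

lemma comp_cap_partner_of_keep (D : Diagram w (u ++ l :: l.flip :: v)) {p q : Pt w (u ++ v)}
    (h : D.partner (keepPt p) = keepPt q) : (D.comp (cap u l v)).partner p = q := by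
  have hne : q ≠ p := fun h' => D.partner_ne (keepPt p) (h' ▸ h)
  refine D.partner_comp_eq _ hne ?_
  refine (D.strings _).trans (strings_cap_keep D p) ?_
  refine (D.strings _).trans ?_ ((D.strings _).symm (strings_cap_keep D q))
  rw [← h]
  exact strings_partner D _ _

/-- The string starting at `p` reaches one foot of the arc, passes along it to the other foot, and
leaves towards `q`. -/
lemma comp_cap_partner_of_join (D : Diagram w (u ++ l :: l.flip :: v)) {p q : Pt w (u ++ v)}
    (hp : D.partner (.inr (leftPt u l v)) = keepPt p)
    (hq : D.partner (.inr (rightPt u l v)) = keepPt q) :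
    (D.comp (cap u l v)).partner p = q := by
  -- If `p` and `q` coincided, the two feet of the arc would have the same partner.
  have hne : q ≠ p := by
    rintro rfl
    have h1 : (.inr (leftPt u l v) : Pt w _) = .inr (rightPt u l v) := by
      rw [← D.partner_partner (.inr (leftPt u l v)), hp, ← hq, D.partner_partner]
    simp [leftPt, rightPt] at h1
  refine D.partner_comp_eq _ hne ?_
  refine (D.strings _).trans (strings_cap_keep D p) ?_
  refine (D.strings _).trans ?_ ((D.strings _).symm (strings_cap_keep D q))
  rw [← hp, ← hq]
  refine (D.strings _).trans ((D.strings _).symm (strings_partner D _ _)) ?_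
  exact (D.strings _).trans (strings_cap_arc D) (strings_partner D _ _)

lemma keepPt_partner_comp_cap (D : Diagram w (u ++ l :: l.flip :: v))
    (h : D.partner (.inr (leftPt u l v)) = .inr (rightPt u l v)) (p : Pt w (u ++ v)) :
    D.partner (keepPt p) = keepPt ((D.comp (cap u l v)).partner p) := by
  rcases keepPt_cases (D.partner (keepPt p)) with h1 | h1 | ⟨q, h1⟩
  · have h2 := D.partner_partner (keepPt p)
    rw [h1, h] at h2
    exact absurd h2.symm (keepPt_ne_right p)
  · have h2 := D.partner_partner (keepPt p)
    rw [h1, ← h, D.partner_partner] at h2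
    exact absurd h2.symm (keepPt_ne_left p)
  · rw [comp_cap_partner_of_keep D h1, h1]

/-- The two feet are closed under both pairings and thus form a loop, while every other point is
connected to the outer boundary. -/
lemma loops_cap_eq_one (D : Diagram w (u ++ l :: l.flip :: v))
    (h : D.partner (.inr (leftPt u l v)) = .inr (rightPt u l v)) :
    D.loops (cap u l v) = 1 := by
  let L : GluePt w (u ++ l :: l.flip :: v) (u ++ v) := upperPt (.inr (leftPt u l v))
  let R : GluePt w (u ++ l :: l.flip :: v) (u ++ v) := upperPt (.inr (rightPt u l v))
  have h' : D.partner (.inr (rightPt u l v)) = .inr (leftPt u l v) := by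
    rw [← h, D.partner_partner]
  have hLR : D.strings (cap u l v) L R := strings_cap_arc D
  have hmem : ∀ x, D.strings (cap u l v) L x → x = L ∨ x = R := by
    intro x hx
    have h1 : (L = L ∨ L = R) = (x = L ∨ x = R) := by
      refine glue_const (f := fun x => (x = L ∨ x = R)) ?_ ?_ hx
      · have e1 : D.moveUpper L = R := by rw [D.moveUpper_upperPt, h]
        have e2 : D.moveUpper R = L := by rw [← e1, D.moveUpper_moveUpper]
        intro y
        have e3 : D.moveUpper y = L ↔ y = R :=
          ⟨fun h => by rw [← D.moveUpper_moveUpper y, h, e1], fun h => by rw [h, e2]⟩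
        have e4 : D.moveUpper y = R ↔ y = L :=
          ⟨fun h => by rw [← D.moveUpper_moveUpper y, h, e2], fun h => by rw [h, e1]⟩
        rw [e3, e4, or_comm]
      · have e1 : (cap u l v).moveLower L = R := congrArg Sum.inr cap_partner_left
        have e2 : (cap u l v).moveLower R = L := by
          rw [← e1, (cap u l v).moveLower_moveLower]
        intro y
        have e3 : (cap u l v).moveLower y = L ↔ y = R :=
          ⟨fun h => by rw [← (cap u l v).moveLower_moveLower y, h, e1], fun h => by rw [h, e2]⟩
        have e4 : (cap u l v).moveLower y = R ↔ y = L :=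
          ⟨fun h => by rw [← (cap u l v).moveLower_moveLower y, h, e2], fun h => by rw [h, e1]⟩
        rw [e3, e4, or_comm]
    rw [← h1]
    exact Or.inl rfl
  have hout : ∀ x, x = L ∨ x = R ∨ ∃ p : Pt w (u ++ v), D.strings (cap u l v) (outerPt p) x := by
    rintro (i | j | k)
    · exact Or.inr (Or.inr ⟨.inl i, (D.strings _).refl _⟩)
    · rcases insert_cases j with rfl | rfl | ⟨k, rfl⟩
      · exact Or.inl rfl
      · exact Or.inr (Or.inl rfl)
      · exact Or.inr (Or.inr ⟨.inr k, strings_cap_keep D (.inr k)⟩)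
    · exact Or.inr (Or.inr ⟨.inr k, (D.strings _).refl _⟩)
  rw [Diagram.loops, Nat.card_eq_one_iff_exists]
  refine ⟨⟨Quotient.mk _ L, fun p hp => ?_⟩, ?_⟩
  · have h1 := hmem _ ((D.strings _).symm (Quotient.exact hp))
    rcases p with i | k <;> rcases h1 with h1 | h1 <;> simp [outerPt, L, R, upperPt] at h1
  · rintro ⟨c, hc⟩
    induction c using Quotient.inductionOn with
    | h x =>
    rw [Subtype.mk.injEq]
    rcases hout x with rfl | rfl | ⟨p, hp⟩
    · rfl
    · exact Quotient.sound ((D.strings _).symm hLR)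
    · exact absurd (Quotient.sound hp) (hc p)

/-- Here `D` joins the left foot to a kept point, so the string through both feet also reaches the
boundary. -/
lemma loops_cap_eq_zero (D : Diagram w (u ++ l :: l.flip :: v))
    (h : D.partner (.inr (leftPt u l v)) ≠ .inr (rightPt u l v)) :
    D.loops (cap u l v) = 0 := by
  rw [Diagram.loops, Nat.card_eq_zero]
  left
  refine ⟨?_⟩
  rintro ⟨c, hc⟩
  induction c using Quotient.inductionOn with
  | h x =>
  have hL : ∃ p : Pt w (u ++ v), D.strings (cap u l v) (outerPt p)
      (upperPt (.inr (leftPt u l v))) := by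
    rcases keepPt_cases (D.partner (.inr (leftPt u l v))) with h1 | h1 | ⟨p, h1⟩
    · exact absurd h1 (D.partner_ne _)
    · exact absurd h1 h
    · refine ⟨p, (D.strings _).trans (strings_cap_keep D p) ?_⟩
      rw [← h1]
      exact (D.strings _).symm (strings_partner D _ _)
  obtain ⟨p, hp⟩ : ∃ p : Pt w (u ++ v), D.strings (cap u l v) (outerPt p) x := by
    rcases x with i | j | k
    · exact ⟨.inl i, (D.strings _).refl _⟩
    · rcases insert_cases j with rfl | rfl | ⟨k, rfl⟩
      · exact hL
      · obtain ⟨p, hp⟩ := hL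
        exact ⟨p, (D.strings _).trans hp (strings_cap_arc D)⟩
      · exact ⟨.inr k, strings_cap_keep D (.inr k)⟩
    · exact ⟨.inr k, (D.strings _).refl _⟩
  exact hc p (Quotient.sound hp)

lemma strings_cup_keep (D : Diagram w (u ++ v)) (p : Pt w (u ++ v)) :
    D.strings (cup u l v) (outerPt (keepPt p)) (upperPt p) := by
  rcases p with i | k
  · exact (D.strings _).refl _
  · have h := (D.strings_lower (cup u l v) (outerPt (.inr (skip u l v k)))
      (.inr (skip u l v k))).2 ((D.strings _).refl _)
    rw [cup_partner_skip] at h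
    exact h

lemma comp_cup_partner_keep (D : Diagram w (u ++ v)) (p : Pt w (u ++ v)) :
    (D.comp (cup u l v)).partner (keepPt p) = keepPt (D.partner p) := by
  refine D.partner_comp_eq _ (fun h => D.partner_ne p (keepPt_injective h)) ?_
  refine (D.strings _).trans (strings_cup_keep D p) ?_
  exact (D.strings _).trans (strings_partner D _ _) ((D.strings _).symm (strings_cup_keep D _))

lemma comp_cup_partner_left (D : Diagram w (u ++ v)) :
    (D.comp (cup u l v)).partner (.inr (leftPt u l v)) = .inr (rightPt u l v) := by
  refine D.partner_comp_eq _ (by simp [leftPt, rightPt]) ?_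
  have h := (D.strings_lower (cup u l v) (outerPt (.inr (leftPt u l v)))
    (.inr (leftPt u l v))).2 ((D.strings _).refl _)
  rw [cup_partner_left] at h
  exact h

/-- A diagram is determined by its arc and the remaining strings. -/
lemma Diagram.ext_of_arc {D E : Diagram w (u ++ l :: l.flip :: v)}
    (hD : D.partner (.inr (leftPt u l v)) = .inr (rightPt u l v))
    (hE : E.partner (.inr (leftPt u l v)) = .inr (rightPt u l v))
    (h : ∀ p : Pt w (u ++ v), D.partner (keepPt p) = E.partner (keepPt p)) : D = E := by
  ext x : 2
  rcases keepPt_cases x with rfl | rfl | ⟨p, rfl⟩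
  · rw [hD, hE]
  · rw [← hD, D.partner_partner, hD, ← hE, E.partner_partner]
  · exact h p

/-- The cap turns the arc of `D` into a loop, which is discarded, and the cup restores the arc; the
other strings are untouched. Hence a lower arc between neighbours can be split off. -/
lemma comp_cap_comp_cup (D : Diagram w (u ++ l :: l.flip :: v))
    (h : D.partner (.inr (leftPt u l v)) = .inr (rightPt u l v)) :
    (D.comp (cap u l v)).comp (cup u l v) = D :=
  Diagram.ext_of_arc (comp_cup_partner_left _) h fun p => by
    rw [comp_cup_partner_keep, keepPt_partner_comp_cap D h]

lemma cap_comp_cup_comp {w : Word} (D : Diagram (u ++ l :: l.flip :: v) w)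
    (h : D.partner (.inl (leftPt u l v)) = .inl (rightPt u l v)) :
    (cap u l v).comp ((cup u l v).comp D) = D := by
  have h1 := comp_cap_comp_cup D.reflect (by simp [h])
  have e1 : (cap u l v) = (cup u l v).reflect := by simp [cup]
  have h2 := congrArg Diagram.reflect h1
  rw [← (Diagram.reflect_comp _ _).2, ← (Diagram.reflect_comp _ _).2] at h2
  simpa [cup] using h2

end Insert

end KauffmanDiagrams

namespace KauffmanDiagrams

/-! ### Generation by caps and cups -/

lemma pos_lt_iff {w w' : Word} (p : Pt w w') : pos p < w.length ↔ ∃ i, p = .inl i := by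
  rcases p with i | j
  · simp [pos]
  · simp [pos]

/-- An innermost arc joins neighbours. If `i` and `i'` are not neighbours, planarity traps the
partner of the point after `i` strictly between them, which gives an arc of smaller width. -/
lemma Diagram.exists_adjacent {w w' : Word} (D : Diagram w w') (n : ℕ) :
    ∀ i i' : Fin w.length, i < i' → (i' : ℕ) - i ≤ n → D.partner (.inl i) = .inl i' →
      ∃ j j' : Fin w.length, (j' : ℕ) = j + 1 ∧ D.partner (.inl j) = .inl j' := by
  induction n with
  | zero => intro i i' h h'; omega
  | succ n ih =>
    intro i i' h hn hi
    by_cases h1 : (i' : ℕ) = i + 1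
    · exact ⟨i, i', h1, hi⟩
    · have hi' := i'.2
      let m : Fin w.length := ⟨i + 1, by omega⟩
      have hm : pos (.inl m : Pt w w') = i + 1 := rfl
      have hpi : pos (.inl i : Pt w w') = i := rfl
      have hpi' : pos (.inl i' : Pt w w') = i' := rfl
      have a1 := D.planar (.inl i) (.inl m)
      have a2 := D.planar (D.partner (.inl m)) (.inl i)
      rw [D.partner_partner] at a2
      have n1 : pos (D.partner (.inl m)) ≠ pos (.inl m : Pt w w') :=
        fun h => D.partner_ne _ (pos_injective h)
      have n2 : pos (D.partner (.inl m)) ≠ pos (.inl i : Pt w w') := fun h => by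
        have h2 := pos_injective h
        have h3 := D.partner_partner (.inl m)
        rw [h2, hi] at h3
        have := congrArg pos h3
        omega
      have n3 : pos (D.partner (.inl m)) ≠ pos (.inl i' : Pt w w') := fun h => by
        have h2 := pos_injective h
        have h3 := D.partner_partner (.inl m)
        rw [h2, ← hi, D.partner_partner] at h3
        have := congrArg pos h3
        omega
      rw [hi] at a1 a2
      rw [hm, hpi, hpi'] at a1 a2
      rw [hm] at n1
      rw [hpi] at n2
      rw [hpi'] at n3
      obtain ⟨k, hk⟩ := (pos_lt_iff (D.partner (.inl m))).1 (by omega)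
      rw [hk] at a1 a2 n1 n2 n3
      simp only [pos] at a1 a2 n1 n2 n3
      refine ih m k ?_ ?_ hk
      · rw [Fin.lt_def]; change (i : ℕ) + 1 < k; omega
      · change (k : ℕ) - (i + 1) ≤ n; omega

lemma exists_split {w : Word} {j j' : Fin w.length} (hj : (j' : ℕ) = j + 1)
    (hs : (w.get j').sign = -(w.get j).sign) :
    ∃ (u : Word) (l : Letter) (v : Word), w = u ++ l :: l.flip :: v ∧ u.length = j := by
  refine ⟨w.take j, w.get j, w.drop (j + 2), ?_, by simp⟩
  have h1 : w.get j' = (w.get j).flip := Letter.sign_injective (by rw [hs, Letter.sign_flip])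
  have h2 : w.drop j = w.get j :: w.drop (j + 1) := List.drop_eq_getElem_cons j.2
  have h3 : w.drop (j + 1) = w.get j' :: w.drop (j + 2) := by
    have := List.drop_eq_getElem_cons j'.2
    simpa only [List.get_eq_getElem, hj] using this
  conv_lhs => rw [← List.take_append_drop j w, h2, h3]
  rw [h1]

/-- The orientation of an arc between neighbours forces their letters to be opposite, so the word
splits as required for a cap. -/
lemma Diagram.exists_cap {w w' : Word} (D : Diagram w w')
    (h : ∃ i i', D.partner (.inl i) = .inl i') :
    ∃ u l v, ∃ hw : w = u ++ l :: l.flip :: v,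
      (hw ▸ D).partner (.inl (leftPt u l v)) = .inl (rightPt u l v) := by
  obtain ⟨i, i', h⟩ := h
  wlog hlt : i < i' generalizing i i'
  · refine this i' i (by rw [← h, D.partner_partner]) ?_
    have : i' ≠ i := fun h' => D.partner_ne (.inl i) (by rw [h, h'])
    omega
  obtain ⟨j, j', hj, hD⟩ := D.exists_adjacent _ i i' hlt le_rfl h
  obtain ⟨u, l, v, rfl, hu⟩ := exists_split hj (by
    have := D.oriented (.inl j)
    rwa [hD] at this)
  refine ⟨u, l, v, rfl, ?_⟩
  have e1 : leftPt u l v = j := Fin.ext hu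
  have e2 : rightPt u l v = j' := Fin.ext (by rw [hj, ← hu]; rfl)
  rw [e1, e2]
  exact hD

/-- Without arcs the pairing is a bijection between upper and lower points, increasing by planarity,
hence it preserves positions; the orientation then identifies the letters. -/
lemma Diagram.eq_id_of_through {w w' : Word} (D : Diagram w w')
    (h : ∀ i i', D.partner (.inl i) ≠ .inl i') (h' : ∀ j j', D.partner (.inr j) ≠ .inr j') :
    ∃ hw : w = w', hw ▸ D = Diagram.id w' := by
  have hf : ∀ i, ∃ j, D.partner (.inl i) = .inr j := by
    intro i
    rcases hD : D.partner (.inl i) with i' | j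
    · exact absurd hD (h i i')
    · exact ⟨j, rfl⟩
  choose f hf using hf
  have hmono : StrictMono f := by
    intro i i' hlt
    have a := D.planar (.inl i) (.inl i')
    rw [hf, hf] at a
    have hne : f i ≠ f i' := fun h => by
      have h2 := D.partner_partner (.inl i)
      rw [hf, h, ← hf, D.partner_partner] at h2
      exact hlt.ne' (Sum.inl_injective h2)
    simp only [pos, Fin.val_rev] at a
    rw [Fin.lt_def] at hlt ⊢
    rw [Ne, Fin.ext_iff] at hne
    omega
  have hsurj : Function.Surjective f := by
    intro j
    rcases hD : D.partner (.inr j) with i | j'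
    · refine ⟨i, Sum.inr_injective (α := Fin w.length) ?_⟩
      rw [← hf, ← hD, D.partner_partner]
    · exact absurd hD (h' j j')
  have hlen : w.length = w'.length := by
    have := Fintype.card_of_bijective ⟨hmono.injective, hsurj⟩
    simpa using this
  have hcast : f = Fin.cast hlen := by
    refine (StrictMono.range_inj hmono (fun _ _ h => h)).1 ?_
    exact hsurj.range_eq.trans (finCongr hlen).surjective.range_eq.symm
  have hw : w = w' := by
    refine List.ext_get hlen fun n h1 h2 => Letter.sign_injective ?_
    have h3 := D.oriented (.inl ⟨n, h1⟩)
    rw [hf, hcast] at h3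
    simp only [charge, neg_inj] at h3
    exact h3.symm
  subst hw
  refine ⟨rfl, ?_⟩
  ext p : 2
  rcases p with i | j
  · change D.partner (.inl i) = .inr i
    rw [hf, hcast]
    rfl
  · change D.partner (.inr j) = .inl j
    have : D.partner (.inl j) = .inr j := by rw [hf, hcast]; rfl
    rw [← this, D.partner_partner]

/-- Every diagram arises from an identity by attaching caps and cups. -/
theorem Diagram.induction_caps {P : ∀ {w w' : Word}, Diagram w w' → Prop}
    (id : ∀ w, P (Diagram.id w))
    (cap : ∀ (u : Word) (l : Letter) (v : Word) {w' : Word} (E : Diagram (u ++ v) w'),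
      P E → P ((cap u l v).comp E))
    (cup : ∀ (u : Word) (l : Letter) (v : Word) {w : Word} (E : Diagram w (u ++ v)),
      P E → P (E.comp (cup u l v)))
    {w w' : Word} (D : Diagram w w') : P D := by
  -- Splitting off an arc removes two boundary points. Lower arcs are handled by finding an upper
  -- arc of the reflection.
  induction hn : w.length + w'.length using Nat.strong_induction_on generalizing w w' with
  | _ n ih =>
  subst hn
  by_cases h : ∃ i i', D.partner (.inl i) = .inl i'
  · obtain ⟨u, l, v, rfl, hD⟩ := D.exists_cap h
    rw [← cap_comp_cup_comp D hD]
    exact cap u l v _ (ih _ (by simp) _ rfl)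
  · by_cases h' : ∃ j j', D.partner (.inr j) = .inr j'
    · obtain ⟨u, l, v, rfl, hD⟩ := D.reflect.exists_cap (by
        obtain ⟨j, j', h'⟩ := h'
        exact ⟨j, j', by simp [h']⟩)
      have hD' : D.partner (.inr (leftPt u l v)) = .inr (rightPt u l v) := by
        have := congrArg Sum.swap hD
        simpa using this
      rw [← comp_cap_comp_cup D hD']
      exact cup u l v _ (ih _ (by simp) _ rfl)
    · push Not at h h'
      obtain ⟨rfl, hD⟩ := D.eq_id_of_through h h'
      have hD : D = Diagram.id w := hD
      rw [hD]
      exact id w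

/-! ### The number of arcs -/

/-- An upper point is the left end of an arc, the right end of an arc, or the end of a through
string; arcs put the first two kinds in bijection. -/
lemma Diagram.card_upper {w w' : Word} (D : Diagram w w') :
    w.length = 2 * D.upperArcs + Nat.card {i // ∃ j, D.partner (.inl i) = .inr j} := by
  classical
  have e : {i // ∃ i', i < i' ∧ D.partner (.inl i) = .inl i'} ≃
      {i // ∃ i', i' < i ∧ D.partner (.inl i) = .inl i'} := by
    refine Equiv.ofBijective (fun x => ⟨x.2.choose, x.1, x.2.choose_spec.1, ?_⟩) ⟨?_, ?_⟩
    · rw [← x.2.choose_spec.2, D.partner_partner]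
    · intro x y h
      have h1 := congrArg Subtype.val h
      have h2 : D.partner (.inl x.1) = D.partner (.inl y.1) := by
        rw [x.2.choose_spec.2, y.2.choose_spec.2]
        exact congrArg _ h1
      refine Subtype.ext (Sum.inl_injective (β := Fin w'.length) ?_)
      rw [← D.partner_partner (.inl x.1), h2, D.partner_partner]
    · rintro ⟨i, i', hlt, h⟩
      have h' : D.partner (.inl i') = .inl i := by rw [← h, D.partner_partner]
      let x : {i // ∃ i', i < i' ∧ D.partner (.inl i) = .inl i'} := ⟨i', i, hlt, h'⟩
      refine ⟨x, Subtype.ext (Sum.inl_injective (β := Fin w'.length) ?_)⟩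
      change Sum.inl x.2.choose = _
      rw [← x.2.choose_spec.2, ← h', ]
  have h1 := Nat.card_congr e
  simp only [Nat.card_eq_fintype_card, Fintype.card_subtype] at h1
  simp only [upperArcs, Nat.card_eq_fintype_card, Fintype.card_subtype]
  conv_lhs => rw [← Fintype.card_fin w.length, ← Finset.card_univ]
  rw [two_mul]
  nth_rewrite 2 [h1]
  rw [← Finset.card_union_of_disjoint, ← Finset.card_union_of_disjoint]
  · congr 1
    ext i
    simp only [Finset.mem_univ, Finset.mem_union, Finset.mem_filter, true_and, true_iff]
    rcases hD : D.partner (.inl i) with i' | j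
    · have : i ≠ i' := fun h => D.partner_ne (.inl i) (by rw [hD, h])
      rcases lt_or_gt_of_ne this with h | h
      · exact Or.inl (Or.inl ⟨i', h, rfl⟩)
      · exact Or.inl (Or.inr ⟨i', h, rfl⟩)
    · exact Or.inr ⟨j, rfl⟩
  · rw [Finset.disjoint_left]
    intro i
    simp only [Finset.mem_union, Finset.mem_filter, Finset.mem_univ, true_and]
    rintro (⟨i', -, h⟩ | ⟨i', -, h⟩) ⟨j, h'⟩ <;> simp [h] at h'
  · rw [Finset.disjoint_left]
    intro i
    simp only [Finset.mem_filter, Finset.mem_univ, true_and]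
    rintro ⟨i', h1, h⟩ ⟨j, h2, h'⟩
    rw [h, Sum.inl.injEq] at h'
    omega

lemma Diagram.upperArcs_reflect {w w' : Word} (D : Diagram w w') :
    D.reflect.upperArcs = D.lowerArcs := by
  unfold upperArcs lowerArcs
  refine Nat.card_congr (Equiv.subtypeEquivRight fun j => ?_)
  refine exists_congr fun j' => and_congr_right fun _ => ?_
  rw [reflect_partner, Sum.swap_inl]
  constructor
  · intro h
    simpa using congrArg Sum.swap h
  · intro h
    simp [h]

/-- Through strings use one point above and one below, so they cancel in the difference. Thus
`sharp` depends on the words alone, which makes it additive under composition and tensor product. -/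
lemma Diagram.two_mul_sharp {w w' : Word} (D : Diagram w w') :
    2 * D.sharp = (w.length : ℤ) - w'.length := by
  have h1 := D.card_upper
  have h2 := D.reflect.card_upper
  rw [D.upperArcs_reflect] at h2
  have e : {i // ∃ j, D.partner (.inl i) = .inr j} ≃
      {j // ∃ i, D.reflect.partner (.inl j) = .inr i} := by
    refine Equiv.ofBijective (fun x => ⟨x.2.choose, x.1, ?_⟩) ⟨?_, ?_⟩
    · rw [reflect_partner, Sum.swap_inl, ← x.2.choose_spec, D.partner_partner, Sum.swap_inl]
    · intro x y h
      have h1 := congrArg Subtype.val h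
      have h2 : D.partner (.inl x.1) = D.partner (.inl y.1) := by
        rw [x.2.choose_spec, y.2.choose_spec]
        exact congrArg _ h1
      refine Subtype.ext (Sum.inl_injective (β := Fin w'.length) ?_)
      rw [← D.partner_partner (.inl x.1), h2, D.partner_partner]
    · rintro ⟨j, i, h⟩
      have h' : D.partner (.inr j) = .inl i := by simpa using congrArg Sum.swap h
      have h'' : D.partner (.inl i) = .inr j := by rw [← h', D.partner_partner]
      let x : {i // ∃ j, D.partner (.inl i) = .inr j} := ⟨i, j, h''⟩
      refine ⟨x, Subtype.ext (Sum.inr_injective (α := Fin w.length) ?_)⟩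
      change Sum.inr x.2.choose = _
      rw [← x.2.choose_spec, ← h'']
  rw [← Nat.card_congr e] at h2
  unfold sharp
  omega

lemma Diagram.sharp_comp {w w' w'' : Word} (D : Diagram w w') (E : Diagram w' w'') :
    (D.comp E).sharp = D.sharp + E.sharp := by
  have h1 := D.two_mul_sharp
  have h2 := E.two_mul_sharp
  have h3 := (D.comp E).two_mul_sharp
  omega

lemma Diagram.sharp_tensor {w w' v v' : Word} (D : Diagram w w') (E : Diagram v v') :
    (D.tensor E).sharp = D.sharp + E.sharp := by
  have h1 := D.two_mul_sharp
  have h2 := E.two_mul_sharp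
  have h3 := (D.tensor E).two_mul_sharp
  simp only [List.length_append] at h3
  omega

lemma Diagram.sharp_id (w : Word) : (Diagram.id w).sharp = 0 := by
  have h := (Diagram.id w).two_mul_sharp
  omega

lemma Diagram.sharp_reflect {w w' : Word} (D : Diagram w w') : D.reflect.sharp = -D.sharp := by
  have h1 := D.two_mul_sharp
  have h2 := D.reflect.two_mul_sharp
  omega

lemma sharp_cap (u : Word) (l : Letter) (v : Word) : (cap u l v).sharp = 1 := by
  have h := (cap u l v).two_mul_sharp
  simp only [List.length_append, List.length_cons] at h
  omega

lemma sharp_cup (u : Word) (l : Letter) (v : Word) : (cup u l v).sharp = -1 := by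
  rw [cup, Diagram.sharp_reflect, sharp_cap]

end KauffmanDiagrams

namespace KauffmanDiagrams

/-! ### Weighted colourings

A second orientation of the strings is recorded by a colouring of the boundary points whose values
at the two ends of each string differ. Each string is weighted by a function of the data at its
first end. -/

section Weights

variable {w w' : Word}

/-- A colouring that takes different values at the two ends of each string. -/
def Diagram.Alternating (D : Diagram w w') (F : Pt w w' → Bool) : Prop :=
  ∀ p, F (D.partner p) = !F p

/-- The weight of the string through `p`, counted at its first end. -/
noncomputable def Diagram.stringWeight (K : ℤ → Bool → ℂ) (D : Diagram w w') (F : Pt w w' → Bool)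
    (p : Pt w w') : ℂ :=
  if pos p < pos (D.partner p) then K (charge p) (F p) else 1

open Classical in
/-- The product of the weights of the strings if the colouring is alternating. -/
noncomputable def Diagram.amplitude (K : ℤ → Bool → ℂ) (D : Diagram w w') (F : Pt w w' → Bool) :
    ℂ :=
  if D.Alternating F then ∏ p, D.stringWeight K F p else 0

/-- The weight of a colouring of a word, i.e. the weight of the identity diagram. -/
noncomputable def wordWeight (K : ℤ → Bool → ℂ) (w : Word) (f : Fin w.length → Bool) : ℂ :=
  ∏ i, K (w.get i).sign (f i)

/-- The matrix of a diagram. -/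
noncomputable def Diagram.weightMat (K : ℤ → Bool → ℂ) (D : Diagram w w') :
    Matrix (Fin w.length → Bool) (Fin w'.length → Bool) ℂ :=
  fun f g => D.amplitude K (Sum.elim f fun j => !g j) / wordWeight K w f

variable {K : ℤ → Bool → ℂ}

lemma wordWeight_ne_zero (hK : ∀ c b, K c b ≠ 0) (f : Fin w.length → Bool) :
    wordWeight K w f ≠ 0 :=
  Finset.prod_ne_zero_iff.2 fun _ _ => hK _ _

/-- The negation of the target colouring in `weightMat` turns alternation along vertical strings
into equality of colourings, and the division by the word weight normalises the diagonal. -/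
lemma Diagram.weightMat_id (hK : ∀ c b, K c b ≠ 0) (w : Word) :
    (Diagram.id w).weightMat K = 1 := by
  classical
  ext f g
  have h : (Diagram.id w).Alternating (Sum.elim f fun j => !g j) ↔ f = g := by
    constructor
    · intro h
      funext i
      have := h (.inr i)
      simpa [Diagram.id] using this
    · rintro rfl (i | i) <;> simp [Diagram.id]
  rw [weightMat, amplitude, Matrix.one_apply]
  simp only [h]
  split_ifs with hfg
  · rw [Fintype.prod_sum_type]
    have e1 : ∀ i, (Diagram.id w).stringWeight K (Sum.elim f fun j => !g j) (.inl i) =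
        K (w.get i).sign (f i) := by
      intro i
      have : pos (.inl i : Pt w w) < pos (.inr i : Pt w w) := by simp only [pos]; omega
      simp [stringWeight, Diagram.id, this, charge]
    have e2 : ∀ i, (Diagram.id w).stringWeight K (Sum.elim f fun j => !g j) (.inr i) = 1 := by
      intro i
      have : ¬pos (.inr i : Pt w w) < pos (.inl i : Pt w w) := by simp only [pos]; omega
      simp only [stringWeight, Diagram.id, Sum.swap_inr, this, if_false]
    simp only [e1, e2, Finset.prod_const_one, mul_one]
    exact div_self (wordWeight_ne_zero hK f)
  · simp

/-! ### Matrices of caps and cups -/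

section Insert

variable {u v : Word} {l : Letter}

/-- Extension of a colouring to two inserted letters. -/
noncomputable def insertColour (u : Word) (l : Letter) (v : Word) (g : Fin (u ++ v).length → Bool)
    (a b : Bool) : Fin (u ++ l :: l.flip :: v).length → Bool :=
  fun j => Sum.elim (fun x => bif x then a else b) g ((insertEquiv u l v).symm j)

variable (g : Fin (u ++ v).length → Bool) (a b : Bool)

@[simp] lemma insertColour_left : insertColour u l v g a b (leftPt u l v) = a := by
  rw [insertColour, ← insertEquiv_true, Equiv.symm_apply_apply]; rfl

@[simp] lemma insertColour_right : insertColour u l v g a b (rightPt u l v) = b := by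
  rw [insertColour, ← insertEquiv_false, Equiv.symm_apply_apply]; rfl

@[simp] lemma insertColour_skip (k) : insertColour u l v g a b (skip u l v k) = g k := by
  rw [insertColour, ← insertEquiv_inr, Equiv.symm_apply_apply]; rfl

lemma insertColour_eta (h : Fin (u ++ l :: l.flip :: v).length → Bool) :
    insertColour u l v (h ∘ skip u l v) (h (leftPt u l v)) (h (rightPt u l v)) = h := by
  funext j
  rcases insert_cases j with rfl | rfl | ⟨k, rfl⟩ <;> simp

/-- In a product with the matrix of a cap, the only freedom in the intermediate colouring is the
colour of the left foot. -/
lemma sum_insertColour (φ : (Fin (u ++ l :: l.flip :: v).length → Bool) → ℂ)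
    (h0 : ∀ h, ¬(h ∘ skip u l v = g ∧ h (rightPt u l v) = !h (leftPt u l v)) → φ h = 0) :
    ∑ h, φ h = ∑ c, φ (insertColour u l v g c (!c)) := by
  refine (Fintype.sum_of_injective (fun c => insertColour u l v g c (!c)) ?_ _ _ ?_ ?_).symm
  · intro c c' h
    simpa using congrFun h (leftPt u l v)
  · intro h hh
    refine h0 h fun ⟨h1, h2⟩ => hh ⟨h (leftPt u l v), ?_⟩
    have := insertColour_eta h
    rw [h1, h2] at this
    exact this
  · intro c
    rfl

lemma prod_insert {M : Type*} [CommMonoid M] (T : Fin (u ++ l :: l.flip :: v).length → M) :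
    ∏ j, T j = T (leftPt u l v) * T (rightPt u l v) * ∏ k, T (skip u l v k) := by
  rw [← (insertEquiv u l v).prod_comp, Fintype.prod_sum_type, Fintype.prod_bool]
  rfl

lemma prod_keepPt {M : Type*} [CommMonoid M] (T : Pt w (u ++ l :: l.flip :: v) → M) :
    ∏ x, T x = T (.inr (leftPt u l v)) * T (.inr (rightPt u l v)) * ∏ p, T (keepPt p) := by
  rw [Fintype.prod_sum_type, Fintype.prod_sum_type, prod_insert]
  simp only [keepPt, Sum.map_inl, Sum.map_inr, id]
  exact mul_left_comm _ _ _

lemma wordWeight_insert (f : Fin (u ++ l :: l.flip :: v).length → Bool) :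
    wordWeight K _ f = K l.sign (f (leftPt u l v)) * K (-l.sign) (f (rightPt u l v)) *
      wordWeight K (u ++ v) (f ∘ skip u l v) := by
  unfold wordWeight
  rw [prod_insert]
  simp only [get_left, get_right, get_skip, Letter.sign_flip, Function.comp]

/-- The arc is weighted at its left foot only, whereas the word weight in the denominator contains
both feet; the factor of the right foot survives as an inverse. -/
lemma weightMat_cap (hK : ∀ c b, K c b ≠ 0) (h : Fin (u ++ l :: l.flip :: v).length → Bool) :
    (cap u l v).weightMat K h g =
      if h ∘ skip u l v = g ∧ h (rightPt u l v) = !h (leftPt u l v) then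
        (K (-l.sign) (h (rightPt u l v)))⁻¹ else 0 := by
  classical
  have hA : (cap u l v).Alternating (Sum.elim h fun j => !g j) ↔
      (h ∘ skip u l v = g ∧ h (rightPt u l v) = !h (leftPt u l v)) := by
    constructor
    · intro hA
      constructor
      · funext k
        have := hA (.inr k)
        rw [cap_partner_inr] at this
        simpa using this
      · have := hA (.inl (leftPt u l v))
        rw [cap_partner_left] at this
        exact this
    · rintro ⟨rfl, h2⟩ (j | k)
      · rcases insert_cases j with rfl | rfl | ⟨k, rfl⟩
        · rw [cap_partner_left]; exact h2
        · rw [cap_partner_right]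
          simp [h2]
        · rw [cap_partner_skip]; rfl
      · rw [cap_partner_inr]
        simp
  rw [Diagram.weightMat, Diagram.amplitude]
  simp only [hA]
  split_ifs with hc
  · obtain ⟨rfl, h2⟩ := hc
    rw [Fintype.prod_sum_type, prod_insert, wordWeight_insert]
    have e1 : (cap u l v).stringWeight K (Sum.elim h fun j => !(h ∘ skip u l v) j)
        (.inl (leftPt u l v)) = K l.sign (h (leftPt u l v)) := by
      rw [Diagram.stringWeight, cap_partner_left, if_pos (by simp [pos, leftPt, rightPt]), charge,
        get_left]
      rfl
    have e2 : (cap u l v).stringWeight K (Sum.elim h fun j => !(h ∘ skip u l v) j)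
        (.inl (rightPt u l v)) = 1 := by
      rw [Diagram.stringWeight, cap_partner_right, if_neg (by simp [pos, leftPt, rightPt])]
    have e3 : ∀ k, (cap u l v).stringWeight K (Sum.elim h fun j => !(h ∘ skip u l v) j)
        (.inl (skip u l v k)) = K ((u ++ v).get k).sign (h (skip u l v k)) := by
      intro k
      rw [Diagram.stringWeight, cap_partner_skip, if_pos (by simp only [pos]; omega), charge,
        get_skip]
      rfl
    have e4 : ∀ k, (cap u l v).stringWeight K (Sum.elim h fun j => !(h ∘ skip u l v) j)
        (.inr k) = 1 := by
      intro k
      rw [Diagram.stringWeight, cap_partner_inr, if_neg (by simp only [pos]; omega)]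
    simp only [e1, e2, e3, e4, Finset.prod_const_one, mul_one]
    have h3 : (∏ k, K ((u ++ v).get k).sign (h (skip u l v k))) =
      wordWeight K (u ++ v) (h ∘ skip u l v) := rfl
    have h4 := wordWeight_ne_zero hK (h ∘ skip u l v)
    have h5 := hK l.sign (h (leftPt u l v))
    have h6 := hK (-l.sign) (h (rightPt u l v))
    rw [h3]
    field_simp
  · exact zero_div _

/-- Going clockwise, the first end of a lower arc is the right one. Its charge is `l.sign`, and its
colour, negated as a target colour, is that of `h` at the left foot. -/
lemma weightMat_cup (hK : ∀ c b, K c b ≠ 0) (h : Fin (u ++ l :: l.flip :: v).length → Bool) :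
    (cup u l v).weightMat K g h =
      if h ∘ skip u l v = g ∧ h (rightPt u l v) = !h (leftPt u l v) then
        K l.sign (h (leftPt u l v)) else 0 := by
  classical
  have hA : (cup u l v).Alternating (Sum.elim g fun j => !h j) ↔
      (h ∘ skip u l v = g ∧ h (rightPt u l v) = !h (leftPt u l v)) := by
    constructor
    · intro hA
      constructor
      · funext k
        have := hA (.inl k)
        rw [cup_partner_inl] at this
        simpa using this
      · have := hA (.inr (leftPt u l v))
        rw [cup_partner_left] at this
        simpa using this
    · rintro ⟨rfl, h2⟩ (k | j)
      · rw [cup_partner_inl]; rfl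
      · rcases insert_cases j with rfl | rfl | ⟨k, rfl⟩
        · rw [cup_partner_left]; simp [h2]
        · rw [cup_partner_right]
          simp [h2]
        · rw [cup_partner_skip]; simp
  rw [Diagram.weightMat, Diagram.amplitude]
  simp only [hA]
  split_ifs with hc
  · obtain ⟨rfl, h2⟩ := hc
    rw [Fintype.prod_sum_type, prod_insert]
    have e1 : (cup u l v).stringWeight K (Sum.elim (h ∘ skip u l v) fun j => !h j)
        (.inr (leftPt u l v)) = 1 := by
      rw [Diagram.stringWeight, cup_partner_left, if_neg (by rw [pos_left, pos_right]; omega)]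
    have e2 : (cup u l v).stringWeight K (Sum.elim (h ∘ skip u l v) fun j => !h j)
        (.inr (rightPt u l v)) = K l.sign (h (leftPt u l v)) := by
      rw [Diagram.stringWeight, cup_partner_right, if_pos (by rw [pos_left, pos_right]; omega),
        charge_right, Sum.elim_inr, h2, Bool.not_not]
    have e3 : ∀ k, (cup u l v).stringWeight K (Sum.elim (h ∘ skip u l v) fun j => !h j)
        (.inr (skip u l v k)) = 1 := by
      intro k
      rw [Diagram.stringWeight, cup_partner_skip, if_neg (by simp only [pos]; omega)]
    have e4 : ∀ k, (cup u l v).stringWeight K (Sum.elim (h ∘ skip u l v) fun j => !h j)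
        (.inl k) = K ((u ++ v).get k).sign (h (skip u l v k)) := by
      intro k
      rw [Diagram.stringWeight, cup_partner_inl, if_pos (by simp only [pos]; omega), charge]
      rfl
    simp only [e1, e2, e3, e4, Finset.prod_const_one, mul_one, one_mul]
    have h3 : (∏ k, K ((u ++ v).get k).sign (h (skip u l v k))) =
      wordWeight K (u ++ v) (h ∘ skip u l v) := rfl
    have h4 := wordWeight_ne_zero hK (h ∘ skip u l v)
    rw [h3]
    field_simp
  · exact zero_div _

lemma elim_insert_comp_keepPt (f : Fin w.length → Bool)
    (h : Fin (u ++ l :: l.flip :: v).length → Bool) :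
    (Sum.elim f fun j => !h j : Pt w _ → Bool) ∘ keepPt =
      Sum.elim f fun j => !(h ∘ skip u l v) j := by
  funext p
  rcases p with i | k <;> rfl

/-- The arc contributes its own factor. On the other strings the insertion of two points changes
neither the charges nor the order of the ends. -/
lemma amplitude_of_arc {D : Diagram w (u ++ l :: l.flip :: v)} {E : Diagram w (u ++ v)}
    (hD : D.partner (.inr (leftPt u l v)) = .inr (rightPt u l v))
    (hDE : ∀ p, D.partner (keepPt p) = keepPt (E.partner p))
    (F : Pt w (u ++ l :: l.flip :: v) → Bool) :
    D.amplitude K F = if F (.inr (rightPt u l v)) = !F (.inr (leftPt u l v)) then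
      K l.sign (F (.inr (rightPt u l v))) * E.amplitude K (F ∘ keepPt) else 0 := by
  classical
  have hD' : D.partner (.inr (rightPt u l v)) = .inr (leftPt u l v) := by
    rw [← hD, D.partner_partner]
  have hA : D.Alternating F ↔ (F (.inr (rightPt u l v)) = !F (.inr (leftPt u l v))) ∧
      E.Alternating (F ∘ keepPt) := by
    constructor
    · intro h
      refine ⟨by rw [← hD, h], fun p => ?_⟩
      rw [Function.comp, ← hDE, h]
      rfl
    · rintro ⟨h1, h2⟩ x
      rcases keepPt_cases x with rfl | rfl | ⟨p, rfl⟩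
      · rw [hD, h1]
      · rw [hD', h1, Bool.not_not]
      · rw [hDE]
        exact h2 p
  unfold Diagram.amplitude
  simp only [hA, ite_and]
  split_ifs with h1 h2
  · rw [prod_keepPt]
    have e1 : D.stringWeight K F (.inr (leftPt u l v)) = 1 := by
      rw [Diagram.stringWeight, hD, if_neg (by rw [pos_left, pos_right]; omega)]
    have e2 : D.stringWeight K F (.inr (rightPt u l v)) =
        K l.sign (F (.inr (rightPt u l v))) := by
      rw [Diagram.stringWeight, hD', if_pos (by rw [pos_left, pos_right]; omega), charge_right]
    have e3 : ∀ p, D.stringWeight K F (keepPt p) = E.stringWeight K (F ∘ keepPt) p := by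
      intro p
      simp only [Diagram.stringWeight, hDE, pos_keepPt_lt, charge_keepPt, Function.comp]
    simp only [e1, e2, e3, one_mul]
  · rw [mul_zero]
  · rfl

/-- Two strings of `D` merge into one. Whichever ends come first, the quotient of the weights is the
same factor, exactly the one that the cap entry cancels in `weightMat_mul_cap`. -/
lemma amplitude_of_join {D : Diagram w (u ++ l :: l.flip :: v)} {p q : Pt w (u ++ v)}
    (hp : D.partner (.inr (leftPt u l v)) = keepPt p)
    (hq : D.partner (.inr (rightPt u l v)) = keepPt q)
    {F : Pt w (u ++ l :: l.flip :: v) → Bool}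
    (hF : F (.inr (rightPt u l v)) = !F (.inr (leftPt u l v))) :
    D.amplitude K F = if F (.inr (leftPt u l v)) = !F (keepPt p) then
      K (-l.sign) (F (.inr (leftPt u l v))) * (D.comp (cap u l v)).amplitude K (F ∘ keepPt)
      else 0 := by
  classical
  set E := D.comp (cap u l v) with hE
  have hEp : E.partner p = q := comp_cap_partner_of_join D hp hq
  have hEq : E.partner q = p := by rw [← hEp, E.partner_partner]
  have hp' : D.partner (keepPt p) = .inr (leftPt u l v) := by rw [← hp, D.partner_partner]
  have hq' : D.partner (keepPt q) = .inr (rightPt u l v) := by rw [← hq, D.partner_partner]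
  have hpq : p ≠ q := fun h => E.partner_ne p (by rw [hEp, h])
  have hother : ∀ r, r ≠ p → r ≠ q → D.partner (keepPt r) = keepPt (E.partner r) := by
    intro r hrp hrq
    rcases keepPt_cases (D.partner (keepPt r)) with h1 | h1 | ⟨r', h1⟩
    · refine absurd (keepPt_injective (l := l) ?_) hrp
      rw [← hp, ← h1, D.partner_partner]
    · refine absurd (keepPt_injective (l := l) ?_) hrq
      rw [← hq, ← h1, D.partner_partner]
    · rw [h1, comp_cap_partner_of_keep D h1]
  have hA : D.Alternating F ↔ (F (.inr (leftPt u l v)) = !F (keepPt p)) ∧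
      E.Alternating (F ∘ keepPt) := by
    constructor
    · intro h
      have h1 : F (.inr (leftPt u l v)) = !F (keepPt p) := by rw [← hp', h]
      have h2 : F (.inr (rightPt u l v)) = !F (keepPt q) := by rw [← hq', h]
      refine ⟨h1, fun r => ?_⟩
      simp only [Function.comp]
      by_cases hrp : r = p
      · rw [hrp, hEp, ← h1, ← Bool.not_not (F (keepPt q)), ← h2, hF, Bool.not_not]
      by_cases hrq : r = q
      · rw [hrq, hEq, ← h2, hF, h1, Bool.not_not]
      · rw [← hother r hrp hrq, h]
    · rintro ⟨h1, h2⟩ x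
      have h3 : F (keepPt q) = !F (keepPt p) := by
        have := h2 p
        rwa [hEp] at this
      rcases keepPt_cases x with rfl | rfl | ⟨r, rfl⟩
      · rw [hp, h1, Bool.not_not]
      · rw [hq, hF, h3, h1, Bool.not_not]
      · by_cases hrp : r = p
        · rw [hrp, hp', h1]
        by_cases hrq : r = q
        · rw [hrq, hq', hF, h3, h1]
        · rw [hother r hrp hrq]
          exact h2 r
  unfold Diagram.amplitude
  simp only [hA, ite_and]
  split_ifs with h1 h2
  · have hFq : F (keepPt q) = F (.inr (leftPt u l v)) := by
      have := h2 p
      rw [hEp] at this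
      rw [h1]
      exact this
    have hFp : F (keepPt p) = !F (.inr (leftPt u l v)) := by rw [h1, Bool.not_not]
    have hcp : charge (keepPt p : Pt w (u ++ l :: l.flip :: v)) = l.sign := by
      rw [← hp, D.oriented, charge_left, neg_neg]
    have hcq : charge (keepPt q : Pt w (u ++ l :: l.flip :: v)) = -l.sign := by
      rw [← hq, D.oriented, charge_right]
    -- Only the factors at `p`, `q` and the two feet can change, so these are isolated.
    have hsplit : ∀ T : Pt w (u ++ v) → ℂ,
        ∏ r, T r = T p * T q * ∏ r ∈ (Finset.univ.erase p).erase q, T r := by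
      intro T
      rw [← Finset.mul_prod_erase _ _ (Finset.mem_univ p),
        ← Finset.mul_prod_erase _ _ (Finset.mem_erase.2 ⟨hpq.symm, Finset.mem_univ q⟩), mul_assoc]
    rw [prod_keepPt, hsplit, hsplit (E.stringWeight K (F ∘ keepPt))]
    have e : ∏ r ∈ (Finset.univ.erase p).erase q, D.stringWeight K F (keepPt r) =
        ∏ r ∈ (Finset.univ.erase p).erase q, E.stringWeight K (F ∘ keepPt) r := by
      refine Finset.prod_congr rfl fun r hr => ?_
      simp only [Finset.mem_erase, Finset.mem_univ, and_true] at hr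
      simp only [Diagram.stringWeight, hother r hr.2 hr.1, pos_keepPt_lt, charge_keepPt,
        Function.comp]
    rw [e]
    simp only [← mul_assoc]
    congr 1
    simp only [Diagram.stringWeight, hp, hq, hp', hq', hEp, hEq, hF, hFp, hFq, charge_left,
      charge_right, hcp, hcq, Function.comp, ← pos_keepPt_lt (l := l) p q,
      ← pos_keepPt_lt (l := l) q p, ← charge_keepPt (l := l) p, ← charge_keepPt (l := l) q]
    have a1 := D.planar (keepPt p) (keepPt q)
    have a2 := D.planar (keepPt q) (keepPt p)
    have a3 := D.planar (keepPt p) (.inr (rightPt u l v))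
    have a4 := D.planar (.inr (rightPt u l v)) (keepPt p)
    have a5 := D.planar (.inr (rightPt u l v)) (.inr (leftPt u l v))
    rw [hp', hq'] at a1 a2
    rw [hq, hp'] at a3 a4
    rw [hq, hp] at a5
    have n1 : pos (keepPt p : Pt w (u ++ l :: l.flip :: v)) ≠ pos (keepPt q : Pt w _) :=
      fun h => hpq (keepPt_injective (pos_injective h))
    have n2 : pos (keepPt p : Pt w (u ++ l :: l.flip :: v)) ≠ pos (.inr (leftPt u l v) : Pt w _) :=
      fun h => keepPt_ne_left p (pos_injective h)
    have n3 : pos (keepPt q : Pt w (u ++ l :: l.flip :: v)) ≠ pos (.inr (leftPt u l v) : Pt w _) :=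
      fun h => keepPt_ne_left q (pos_injective h)
    have n4 : pos (keepPt p : Pt w (u ++ l :: l.flip :: v)) ≠ pos (.inr (rightPt u l v) : Pt w _) :=
      fun h => keepPt_ne_right p (pos_injective h)
    have n5 : pos (keepPt q : Pt w (u ++ l :: l.flip :: v)) ≠ pos (.inr (rightPt u l v) : Pt w _) :=
      fun h => keepPt_ne_right q (pos_injective h)
    -- The feet occupy consecutive positions. Planarity leaves three arrangements: `p` before `q`
    -- before the feet, the feet before `p` before `q`, and `q` before the feet before `p`.
    rw [pos_left] at *
    rw [pos_right] at *
    split_ifs <;> first | (exfalso; omega) | ring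
  · rw [mul_zero]
  · rfl

/-- Attaching a cup is compatible with the passage to matrices. -/
lemma weightMat_mul_cup (hK : ∀ c b, K c b ≠ 0) (D : Diagram w (u ++ v)) :
    D.weightMat K * (cup u l v).weightMat K = (D.comp (cup u l v)).weightMat K := by
  classical
  ext f h
  simp only [Matrix.mul_apply, weightMat_cup _ hK]
  rw [Diagram.weightMat, amplitude_of_arc (comp_cup_partner_left D) (comp_cup_partner_keep D),
    elim_insert_comp_keepPt, Finset.sum_eq_single (h ∘ skip u l v)]
  · simp only [true_and, Sum.elim_inr, Bool.not_inj_iff]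
    by_cases hc : h (rightPt u l v) = !h (leftPt u l v)
    · simp only [hc, if_true, Bool.not_not]
      rw [Diagram.weightMat]
      ring
    · simp [hc]
  · intro g _ hg
    rw [if_neg fun hh => hg hh.1.symm, mul_zero]
  · simp

/-- Attaching a cap is compatible with the passage to matrices. -/
lemma weightMat_mul_cap {d : ℂ} (hK : ∀ c b, K c b ≠ 0)
    (hd : ∀ l : Letter, ∑ b, K l.sign b / K (-l.sign) (!b) = d)
    (D : Diagram w (u ++ l :: l.flip :: v)) :
    D.weightMat K * (cap u l v).weightMat K =
      d ^ D.loops (cap u l v) • (D.comp (cap u l v)).weightMat K := by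
  classical
  ext f g
  rw [Matrix.smul_apply, Matrix.mul_apply, sum_insertColour g]
  swap
  · intro h hh
    rw [weightMat_cap _ hK, if_neg hh, mul_zero]
  have hskip : ∀ c, insertColour u l v g c (!c) ∘ skip u l v = g := fun c => by
    funext k; simp
  simp only [weightMat_cap _ hK, hskip, insertColour_left, insertColour_right, true_and, if_true]
  simp only [Diagram.weightMat]
  -- If the cap closes a loop, the colour of the left foot is free and its two weights sum to `d`.
  -- Otherwise the string through that foot prescribes its colour and one term remains.
  by_cases h : D.partner (.inr (leftPt u l v)) = .inr (rightPt u l v)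
  · rw [loops_cap_eq_one D h, pow_one, smul_eq_mul, ← hd l, Finset.sum_mul]
    refine Finset.sum_congr rfl fun c _ => ?_
    rw [amplitude_of_arc h (keepPt_partner_comp_cap D h), elim_insert_comp_keepPt, hskip]
    simp only [Sum.elim_inr, insertColour_left, insertColour_right, Bool.not_not, if_true]
    ring
  · rw [loops_cap_eq_zero D h, pow_zero, one_smul]
    obtain ⟨p, hp⟩ : ∃ p, D.partner (.inr (leftPt u l v)) = keepPt p := by
      rcases keepPt_cases (D.partner (.inr (leftPt u l v))) with h1 | h1 | h1
      · exact absurd h1 (D.partner_ne _)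
      · exact absurd h1 h
      · exact h1
    obtain ⟨q, hq⟩ : ∃ p, D.partner (.inr (rightPt u l v)) = keepPt p := by
      rcases keepPt_cases (D.partner (.inr (rightPt u l v))) with h1 | h1 | h1
      · exact absurd (by rw [← h1, D.partner_partner]) h
      · exact absurd h1 (D.partner_ne _)
      · exact h1
    have hkeep : ∀ c, (Sum.elim f fun j => !insertColour u l v g c (!c) j : Pt w _ → Bool)
        (keepPt p) = (Sum.elim f fun j => !g j : Pt w _ → Bool) p := by
      intro c
      have := congrFun (elim_insert_comp_keepPt f (insertColour u l v g c (!c))) p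
      rwa [hskip] at this
    -- The colour at `p` is opposite to that of the foot of `D` joined to it. The foot carries the
    -- negation of `c`, so `c` must be the colour at `p`.
    rw [Finset.sum_eq_single ((Sum.elim f fun j => !g j : Pt w _ → Bool) p)]
    · rw [amplitude_of_join hp hq (by simp), elim_insert_comp_keepPt, hskip, hkeep]
      simp only [Sum.elim_inr, insertColour_left, if_true]
      have := hK (-l.sign) (!(Sum.elim f fun j => !g j : Pt w _ → Bool) p)
      field_simp
    · intro c _ hc
      rw [amplitude_of_join hp hq (by simp), hkeep, if_neg]
      · simp
      · simpa using hc
    · simp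

end Insert

/-- The passage to matrices is functorial. -/
theorem Diagram.weightMat_mul {d : ℂ} (hK : ∀ c b, K c b ≠ 0)
    (hd : ∀ l : Letter, ∑ b, K l.sign b / K (-l.sign) (!b) = d) (hd0 : d ≠ 0) {w'' : Word}
    (D : Diagram w w') (E : Diagram w' w'') :
    D.weightMat K * E.weightMat K = d ^ D.loops E • (D.comp E).weightMat K := by
  -- Multiplicativity on the right by two diagrams passes to their composite by associativity, once
  -- the factor from their common loops is cancelled; this is where `d ≠ 0` enters.
  have key : ∀ {w₁ w₂ w₃ : Word} (E₁ : Diagram w₁ w₂) (E₂ : Diagram w₂ w₃),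
      (∀ {w} (D : Diagram w w₁),
        D.weightMat K * E₁.weightMat K = d ^ D.loops E₁ • (D.comp E₁).weightMat K) →
      (∀ {w} (D : Diagram w w₂),
        D.weightMat K * E₂.weightMat K = d ^ D.loops E₂ • (D.comp E₂).weightMat K) →
      ∀ {w} (D : Diagram w w₁), D.weightMat K * (E₁.comp E₂).weightMat K =
        d ^ D.loops (E₁.comp E₂) • (D.comp (E₁.comp E₂)).weightMat K := by
    intro w₁ w₂ w₃ E₁ E₂ h₁ h₂ w D
    obtain ⟨h3, h4⟩ := D.comp_assoc E₁ E₂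
    have h5 : d ^ E₁.loops E₂ • (D.weightMat K * (E₁.comp E₂).weightMat K) =
        d ^ E₁.loops E₂ • (d ^ D.loops (E₁.comp E₂) • (D.comp (E₁.comp E₂)).weightMat K) := by
      rw [← Matrix.mul_smul, ← h₂, ← Matrix.mul_assoc, h₁, Matrix.smul_mul, h₂, smul_smul,
        smul_smul, ← pow_add, ← pow_add, h3, h4]
    exact smul_right_injective _ (pow_ne_zero _ hd0) h5
  induction E using Diagram.induction_caps generalizing w with
  | id w' => rw [weightMat_id hK, Matrix.mul_one, D.comp_id.1, D.comp_id.2, pow_zero, one_smul]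
  | cap u l v E ih =>
    exact key _ _ (fun D => weightMat_mul_cap hK hd D) (fun D => ih D) D
  | cup u l v E ih =>
    refine key _ _ (fun D => ih D) (fun D => ?_) D
    -- A further cap closes exactly one loop, both against the composite of `D` with the cup and
    -- against the cup alone. Comparing the two ways of counting loops leaves none between `D` and
    -- the cup.
    have h1 : D.loops (cup u l v) = 0 := by
      have h2 := (Diagram.comp_assoc D (cup u l v) (cap u l v)).1
      have h3 := loops_cap_eq_one _ (comp_cup_partner_left (l := l) D)
      have h4 := loops_cap_eq_one (cup u l v) cup_partner_left
      have h5 : (cup u l v).comp (cap u l v) = Diagram.id (u ++ v) := by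
        have h6 := fun p => keepPt_partner_comp_cap (cup u l v) cup_partner_left p
        ext p : 2
        refine keepPt_injective (l := l) ?_
        rw [← h6]
        rcases p with k | k
        · exact cup_partner_inl k
        · exact cup_partner_skip k
      rw [h3, h4, h5, D.comp_id.1] at h2
      omega
    rw [h1, pow_zero, one_smul, weightMat_mul_cup hK]

end Weights

end KauffmanDiagrams

namespace KauffmanDiagrams

/-! ### Linear independence of the matrices of diagrams -/

section Independence

variable {w w' : Word}

/-- A diagram is determined by the first ends of its strings. -/
lemma Diagram.ext_of_first_ends {D E : Diagram w w'}
    (h : ∀ p, pos p < pos (D.partner p) ↔ pos p < pos (E.partner p)) : D = E := by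
  have hne : ∀ (D : Diagram w w') p, pos (D.partner p) ≠ pos p := fun D p hp =>
    D.partner_ne p (pos_injective hp)
  -- If `E` closes `y` with a later opening than `D` does, then `D` must close that opening before
  -- `y`, by planarity. At this earlier closing end the two diagrams already agree, so `E` pairs the
  -- opening twice.
  have aux : ∀ (D E : Diagram w w'), (∀ p, pos p < pos (D.partner p) ↔ pos p < pos (E.partner p)) →
      ∀ y, (∀ z, pos z < pos y → ¬pos z < pos (D.partner z) → D.partner z = E.partner z) →
      pos (D.partner y) < pos (E.partner y) → pos (E.partner y) < pos y → False := by
    intro D E h y ih h1 h2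
    have h3 : pos (E.partner y) < pos (D.partner (E.partner y)) := by
      rw [h, E.partner_partner]
      exact h2
    have h4 := D.planar (D.partner y) (E.partner y)
    rw [D.partner_partner] at h4
    have h5 : D.partner (E.partner y) ≠ y := fun h5 => by
      rw [← h5, D.partner_partner] at h1
      rw [h5] at h1
      omega
    have h6 : pos (D.partner (E.partner y)) ≠ pos y := fun h6 => h5 (pos_injective h6)
    have h7 := ih (D.partner (E.partner y)) (by omega) (by rw [D.partner_partner]; omega)
    rw [D.partner_partner] at h7
    have h8 := congrArg E.partner h7
    rw [E.partner_partner, E.partner_partner] at h8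
    exact h5 h8.symm
  have key : ∀ n y, pos y = n → ¬pos y < pos (D.partner y) → D.partner y = E.partner y := by
    intro n
    induction n using Nat.strong_induction_on with
    | _ n ih =>
    rintro y rfl hy
    have hy' : ¬pos y < pos (E.partner y) := by rwa [← h]
    have h1 := hne D y
    have h2 := hne E y
    rcases lt_trichotomy (pos (D.partner y)) (pos (E.partner y)) with h3 | h3 | h3
    · exact (aux D E h y (fun z hz hz' => ih _ hz z rfl hz') h3 (by omega)).elim
    · exact pos_injective h3
    · refine (aux E D (fun p => (h p).symm) y (fun z hz hz' => ?_) h3 (by omega)).elim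
      exact (ih _ hz z rfl (by rwa [h])).symm
  ext p : 2
  by_cases hp : pos p < pos (D.partner p)
  · have h1 := key _ (D.partner p) rfl (by rw [D.partner_partner]; omega)
    rw [D.partner_partner] at h1
    have h2 := congrArg E.partner h1
    rw [E.partner_partner] at h2
    exact h2.symm
  · exact key _ p rfl hp

/-- The colouring of the first ends of the strings. -/
noncomputable def Diagram.firstEnds (D : Diagram w w') (p : Pt w w') : Bool :=
  decide (pos p < pos (D.partner p))

lemma Diagram.alternating_firstEnds (D : Diagram w w') : D.Alternating D.firstEnds := by
  intro p
  have h : pos (D.partner p) ≠ pos p := fun h => D.partner_ne p (pos_injective h)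
  simp only [firstEnds, D.partner_partner]
  rw [← decide_not, decide_eq_decide]
  omega

/-- The sum of the positions of the coloured points. -/
def colourSum (F : Pt w w' → Bool) : ℕ := ∑ p, if F p then pos p else 0

/-- An alternating colouring selects one end of each string, and the total position is least,
uniquely, when it is always the first end. This gives the triangularity behind linear independence.
-/
lemma Diagram.Alternating.colourSum_le {D : Diagram w w'} {F : Pt w w' → Bool}
    (hF : D.Alternating F) : colourSum D.firstEnds ≤ colourSum F ∧
      (colourSum F ≤ colourSum D.firstEnds → F = D.firstEnds) := by
  -- Doubling makes the comparison local: each summand now involves both ends of one string.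
  have hdouble : ∀ G : Pt w w' → Bool, 2 * colourSum G =
      ∑ p, ((if G p then pos p else 0) + (if G (D.partner p) then pos (D.partner p) else 0)) := by
    intro G
    rw [Finset.sum_add_distrib, two_mul]
    congr 1
    exact (Equiv.sum_comp (Function.Involutive.toPerm D.partner D.partner_partner)
      (fun p => if G p then pos p else 0)).symm
  have hterm : ∀ p ∈ Finset.univ, ((if D.firstEnds p then pos p else 0) +
      (if D.firstEnds (D.partner p) then pos (D.partner p) else 0)) ≤
      ((if F p then pos p else 0) + (if F (D.partner p) then pos (D.partner p) else 0)) := by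
    intro p _
    rw [hF p, D.alternating_firstEnds p]
    have h : pos (D.partner p) ≠ pos p := fun h => D.partner_ne p (pos_injective h)
    by_cases h1 : pos p < pos (D.partner p) <;> cases F p <;> simp [firstEnds, h1] <;> omega
  have hle := Finset.sum_le_sum hterm
  rw [← hdouble, ← hdouble] at hle
  refine ⟨by omega, fun hle' => ?_⟩
  have heq : 2 * colourSum D.firstEnds = 2 * colourSum F := by omega
  rw [hdouble, hdouble, Finset.sum_eq_sum_iff_of_le hterm] at heq
  funext p
  have h1 := heq p (Finset.mem_univ p)
  rw [hF p, D.alternating_firstEnds p] at h1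
  have h : pos (D.partner p) ≠ pos p := fun h => D.partner_ne p (pos_injective h)
  revert h1
  cases F p <;> cases D.firstEnds p <;> simp <;> omega

lemma Diagram.amplitude_firstEnds_ne_zero {K : ℤ → Bool → ℂ} (hK : ∀ c b, K c b ≠ 0)
    {D : Diagram w w'} {F : Pt w w' → Bool} (hF : D.Alternating F) : D.amplitude K F ≠ 0 := by
  rw [amplitude, if_pos hF]
  refine Finset.prod_ne_zero_iff.2 fun p _ => ?_
  rw [stringWeight]
  split_ifs
  · exact hK _ _
  · exact one_ne_zero

/-- The matrices of the diagrams are linearly independent. -/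
theorem Diagram.linearIndependent_weightMat {K : ℤ → Bool → ℂ} (hK : ∀ c b, K c b ≠ 0) :
    LinearIndependent ℂ (fun D : Diagram w w' => D.weightMat K) := by
  rw [linearIndependent_iff]
  intro c hc
  by_contra hne
  -- At the colouring of first ends of a minimal `D`, any other diagram of the support with a
  -- nonzero entry would have the same first ends as `D`, hence be `D`.
  obtain ⟨D, hD, hmin⟩ := Finset.exists_min_image c.support (fun D => colourSum D.firstEnds)
    (Finsupp.support_nonempty_iff.2 hne)
  let f : Fin w.length → Bool := fun i => D.firstEnds (.inl i)
  let g : Fin w'.length → Bool := fun j => !D.firstEnds (.inr j)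
  have hfg : (Sum.elim f fun j => !g j) = D.firstEnds := by
    funext p
    rcases p with i | j
    · rfl
    · exact Bool.not_not _
  have h1 := congrFun (congrFun hc f) g
  rw [Finsupp.linearCombination_apply, Finsupp.sum, Matrix.sum_apply, Finset.sum_eq_single_of_mem D hD] at h1
  · simp only [Matrix.smul_apply, weightMat, hfg, smul_eq_mul, Matrix.zero_apply, mul_eq_zero,
      div_eq_zero_iff, wordWeight_ne_zero hK f, or_false,
      amplitude_firstEnds_ne_zero hK D.alternating_firstEnds] at h1
    exact (Finsupp.mem_support_iff.1 hD) h1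
  · intro E hE hED
    rw [Matrix.smul_apply, weightMat, hfg, amplitude, if_neg, zero_div, smul_zero]
    intro hA
    refine hED (Diagram.ext_of_first_ends fun p => ?_)
    have h2 := (Alternating.colourSum_le hA).2 (hmin E hE)
    have h3 := congrFun h2 p
    simp only [firstEnds, decide_eq_decide] at h3
    exact h3.symm

end Independence

/-! ### The matrices of reflected diagrams -/

section Reflect

variable {w w' : Word}

/-- Reflection reverses the clockwise order, so first ends become last ends. Passing to the partner
restores the order, and charge and colour are negated twice. -/
lemma Diagram.amplitude_reflect (K : ℤ → Bool → ℂ) (D : Diagram w w') (f : Fin w.length → Bool)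
    (g : Fin w'.length → Bool) :
    D.reflect.amplitude K (Sum.elim g fun i => !f i) =
      D.amplitude K (Sum.elim f fun j => !g j) := by
  classical
  have hswap : ∀ p : Pt w w', (Sum.elim g fun i => !f i : Pt w' w → Bool) p.swap =
      !(Sum.elim f fun j => !g j : Pt w w' → Bool) p := by
    rintro (i | j)
    · rfl
    · exact (Bool.not_not _).symm
  have hA : D.reflect.Alternating (Sum.elim g fun i => !f i) ↔
      D.Alternating (Sum.elim f fun j => !g j) := by
    unfold Alternating
    rw [← (Equiv.sumComm _ _).forall_congr_right]
    refine forall_congr' fun p => ?_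
    simp only [reflect_partner, Equiv.sumComm_apply, Sum.swap_swap, hswap, Bool.not_inj_iff]
  unfold amplitude
  simp only [hA]
  split_ifs with h
  · let e : Pt w w' ≃ Pt w' w :=
      (Function.Involutive.toPerm D.partner D.partner_partner).trans (Equiv.sumComm _ _)
    rw [← e.prod_comp]
    refine Finset.prod_congr rfl fun p _ => ?_
    have h1 := pos_swap_add p
    have h2 := pos_swap_add (D.partner p)
    have h3 : pos (D.partner p).swap < pos p.swap ↔ pos p < pos (D.partner p) := by omega
    change D.reflect.stringWeight K _ (D.partner p).swap = _
    simp only [stringWeight, reflect_partner, Sum.swap_swap, D.partner_partner, h3, charge_swap,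
      D.oriented, neg_neg, hswap, h p, Bool.not_not]
  · rfl

/-- The weights `t^{±1}`, with an additional factor `s` at the starting points of strings. -/
noncomputable def turnWeight (s t : ℂ) (c : ℤ) (b : Bool) : ℂ :=
  (if c = 1 then s else 1) * (if b then t else t⁻¹)

lemma turnWeight_ne_zero {s t : ℂ} (hs : s ≠ 0) (ht : t ≠ 0) (c : ℤ) (b : Bool) :
    turnWeight s t c b ≠ 0 := by
  unfold turnWeight
  refine mul_ne_zero ?_ ?_ <;> split_ifs <;> simp [hs, ht]

/-- The two orientations of a loop carry the factors `s` and `s⁻¹`; these agree because `s` squares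
to one. -/
lemma sum_turnWeight {s t d : ℂ} (hs : s * s = 1) (ht : t ≠ 0) (hd : s * (t ^ 2 + (t ^ 2)⁻¹) = d)
    (l : Letter) :
    ∑ b, turnWeight s t l.sign b / turnWeight s t (-l.sign) (!b) = d := by
  have hs0 : s ≠ 0 := left_ne_zero_of_mul_eq_one hs
  have h : s⁻¹ = s := inv_eq_of_mul_eq_one_left hs
  rw [Fintype.sum_bool, ← hd]
  cases l
  · simp only [turnWeight, Letter.sign]
    norm_num
    field_simp
  · simp only [turnWeight, Letter.sign]
    norm_num
    field_simp
    linear_combination (-(1 : ℂ) - t ^ 4) * hs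

lemma wordWeight_turnWeight {s t : ℂ} (hs : s ≠ 0) (ht : t ≠ 0) (f : Fin w.length → Bool) :
    wordWeight (turnWeight s t) w f =
      s ^ (∑ i, if (w.get i).sign = 1 then (1 : ℤ) else 0) *
        t ^ (∑ i, if f i then (1 : ℤ) else -1) := by
  have hz : ∀ (a : ℂ) (ha : a ≠ 0) (x : Fin w.length → ℤ), a ^ (∑ i, x i) = ∏ i, a ^ x i := by
    intro a ha x
    induction (Finset.univ : Finset (Fin w.length)) using Finset.induction_on with
    | empty => simp
    | insert i S hi ih => rw [Finset.sum_insert hi, Finset.prod_insert hi, zpow_add₀ ha, ih]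
  rw [hz s hs, hz t ht, ← Finset.prod_mul_distrib, wordWeight]
  refine Finset.prod_congr rfl fun i _ => ?_
  unfold turnWeight
  congr 1 <;> split_ifs <;> simp

/-- Alternation makes the colours above and below balance, so the powers of `t` agree. The power of
`s` counts the letters `X`: total charge is conserved, hence this count changes by half the
difference of the lengths, which is `D.sharp`. -/
lemma Diagram.Alternating.wordWeight_eq {s t : ℂ} (hs : s ≠ 0) (ht : t ≠ 0) {D : Diagram w w'}
    {f : Fin w.length → Bool} {g : Fin w'.length → Bool}
    (h : D.Alternating (Sum.elim f fun j => !g j)) :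
    wordWeight (turnWeight s t) w f = s ^ D.sharp * wordWeight (turnWeight s t) w' g := by
  have h1 : ∑ i, (if f i then (1 : ℤ) else -1) = ∑ j, (if g j then (1 : ℤ) else -1) := by
    have h2 : ∑ p, (if (Sum.elim f fun j => !g j : Pt w w' → Bool) p then (1 : ℤ) else -1) = 0 := by
      refine Finset.sum_involution (fun p _ => D.partner p) (fun p _ => ?_)
        (fun p _ _ => D.partner_ne p) (fun _ _ => Finset.mem_univ _)
        (fun p _ => D.partner_partner p)
      rw [h p]
      cases (Sum.elim f fun j => !g j : Pt w w' → Bool) p <;> rfl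
    rw [Fintype.sum_sum_type] at h2
    have h3 : ∀ j, (if (Sum.elim f fun j => !g j : Pt w w' → Bool) (.inr j) then (1 : ℤ) else -1) =
        -(if g j then (1 : ℤ) else -1) := by
      intro j
      rw [Sum.elim_inr]
      cases g j <;> rfl
    simp only [h3, Finset.sum_neg_distrib, Sum.elim_inl] at h2
    rw [add_neg_eq_zero] at h2
    exact h2
  have h2 : ∑ i, (if (w.get i).sign = 1 then (1 : ℤ) else 0) =
      D.sharp + ∑ j, (if (w'.get j).sign = 1 then (1 : ℤ) else 0) := by
    have h3 := D.sum_charge (fun _ => True) (fun _ => Iff.rfl)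
    simp only [if_true, Fintype.sum_sum_type, charge, Finset.sum_neg_distrib] at h3
    have h4 : ∀ w : Word, 2 * ∑ i, (if (w.get i).sign = 1 then (1 : ℤ) else 0) =
        ∑ i, (w.get i).sign + w.length := by
      intro w
      have h5 : (w.length : ℤ) = ∑ _i : Fin w.length, (1 : ℤ) := by simp
      rw [h5, ← Finset.sum_add_distrib, Finset.mul_sum]
      refine Finset.sum_congr rfl fun i _ => ?_
      cases w.get i <;> simp [Letter.sign]
    have h5 := h4 w
    have h6 := h4 w'
    have h7 := D.two_mul_sharp
    omega
  rw [wordWeight_turnWeight hs ht, wordWeight_turnWeight hs ht, h1, h2, zpow_add₀ hs, mul_assoc]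

/-- Amplitudes are real and symmetric under reflection. The two matrices differ only by their
normalising word weights, whose quotient is the power of `s` on the left. -/
lemma Diagram.weightMat_reflect {s t : ℝ} (hs : s * s = 1) (ht : t ≠ 0) (D : Diagram w w') :
    (s : ℂ) ^ D.sharp • D.reflect.weightMat (turnWeight s t) =
      (D.weightMat (turnWeight s t)).conjTranspose := by
  have hs' : (s : ℂ) ≠ 0 := by exact_mod_cast left_ne_zero_of_mul_eq_one hs
  have ht' : (t : ℂ) ≠ 0 := by exact_mod_cast ht
  have hreal : ∀ c b, (starRingEnd ℂ) (turnWeight s t c b) = turnWeight s t c b := by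
    intro c b
    unfold turnWeight
    split_ifs <;> simp
  have hsw : ∀ F p, (starRingEnd ℂ) (D.stringWeight (turnWeight s t) F p) =
      D.stringWeight (turnWeight s t) F p := by
    intro F p
    unfold stringWeight
    split_ifs
    · exact hreal _ _
    · exact map_one _
  ext g f
  have hww : (starRingEnd ℂ) (wordWeight (turnWeight s t) w f) = wordWeight (turnWeight s t) w f := by
    simp only [wordWeight, map_prod, hreal]
  rw [Matrix.smul_apply, Matrix.conjTranspose_apply, weightMat, weightMat, amplitude_reflect,
    RCLike.star_def, map_div₀, hww, smul_eq_mul]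
  by_cases h : D.Alternating (Sum.elim f fun j => !g j)
  · rw [h.wordWeight_eq hs' ht']
    have h1 := wordWeight_ne_zero (turnWeight_ne_zero hs' ht') g
    have h2 := zpow_ne_zero D.sharp hs'
    rw [amplitude, if_pos h, map_prod]
    simp only [hsw]
    have h3 : (s : ℂ) ^ D.sharp * (s : ℂ) ^ D.sharp = 1 := by
      rw [← mul_zpow, ← Complex.ofReal_mul, hs, Complex.ofReal_one, one_zpow]
    rw [mul_div_assoc', div_eq_div_iff h1 (mul_ne_zero h2 h1)]
    linear_combination (∏ p, D.stringWeight (turnWeight s t) (Sum.elim f fun j => !g j) p) *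
      wordWeight (turnWeight s t) w' g * h3
  · rw [amplitude, if_neg h]
    simp

end Reflect

end KauffmanDiagrams

namespace KauffmanDiagrams
open CategoryTheory MonoidalCategory

/-! ### Linear extension from diagrams to morphisms -/

section Morphisms

variable {d : ℂ}

lemma OrientedKauffman.hom_induction {X Y : OrientedKauffman d} {P : (X ⟶ Y) → Prop} (f : X ⟶ Y)
    (zero : P 0) (add : ∀ f g : X ⟶ Y, P f → P g → P (f + g))
    (smul : ∀ (c : ℂ) (D : Diagram X.word Y.word), P (c • ofDiagram d D)) : P f := by
  refine Finsupp.induction_linear f zero add fun D c => ?_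
  have h : (Finsupp.single D c : X ⟶ Y) = c • ofDiagram d D := by
    change _ = c • Finsupp.single D (1 : ℂ)
    rw [Finsupp.smul_single_one]
  exact h ▸ smul c D

lemma ofDiagram_comp {X Y Z : OrientedKauffman d} (D : Diagram X.word Y.word)
    (E : Diagram Y.word Z.word) :
    (ofDiagram d D : X ⟶ Y) ≫ (ofDiagram d E : Y ⟶ Z) =
      (d ^ D.loops E • ofDiagram d (D.comp E) : X ⟶ Z) := by
  change compHom d (Finsupp.single D 1) (Finsupp.single E 1) = _ • Finsupp.single _ (1 : ℂ)
  rw [compHom_single, one_mul, one_mul, Finsupp.smul_single_one]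

lemma ofDiagram_tensor {X Y X' Y' : OrientedKauffman d} (D : Diagram X.word Y.word)
    (E : Diagram X'.word Y'.word) :
    (ofDiagram d D : X ⟶ Y) ⊗ₘ (ofDiagram d E : X' ⟶ Y') =
      (ofDiagram d (D.tensor E) : X ⊗ X' ⟶ Y ⊗ Y') := by
  change tensorHom (Finsupp.single D 1) (Finsupp.single E 1) = Finsupp.single _ (1 : ℂ)
  rw [tensorHom_single, one_mul]

lemma ofDiagram_id (w : Word) : ofDiagram d (Diagram.id w) = 𝟙 (⟨w⟩ : OrientedKauffman d) := rfl

lemma smul_tensor_smul {X Y X' Y' : OrientedKauffman d} (a b : ℂ) (f : X ⟶ Y) (g : X' ⟶ Y') :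
    (a • f) ⊗ₘ (b • g) = (a * b) • (f ⊗ₘ g) := by
  change OrientedKauffman.tensorHom (a • f) (b • g) = (a * b) • OrientedKauffman.tensorHom f g
  rw [map_smul, LinearMap.map_smul₂, smul_smul, mul_comm]

/-! ### The matrix representation of the category -/

/-- The linear extension of the passage from diagrams to matrices. -/
noncomputable def weightHom (K : ℤ → Bool → ℂ) (X Y : OrientedKauffman d) :
    (X ⟶ Y) →ₗ[ℂ] Matrix (Fin X.word.length → Bool) (Fin Y.word.length → Bool) ℂ :=
  Finsupp.linearCombination ℂ fun D : Diagram X.word Y.word => D.weightMat K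

lemma weightHom_ofDiagram (K : ℤ → Bool → ℂ) {X Y : OrientedKauffman d}
    (D : Diagram X.word Y.word) : weightHom K X Y (ofDiagram d D) = D.weightMat K := by
  refine (Finsupp.linearCombination_single ℂ (1 : ℂ) D).trans ?_
  rw [one_smul]

lemma weightHom_injective {K : ℤ → Bool → ℂ} (hK : ∀ c b, K c b ≠ 0) (X Y : OrientedKauffman d) :
    Function.Injective (weightHom K X Y) :=
  Diagram.linearIndependent_weightMat hK

lemma weightHom_comp {K : ℤ → Bool → ℂ} (hK : ∀ c b, K c b ≠ 0)
    (hd : ∀ l : Letter, ∑ b, K l.sign b / K (-l.sign) (!b) = d) (hd0 : d ≠ 0)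
    {X Y Z : OrientedKauffman d} (f : X ⟶ Y) (g : Y ⟶ Z) :
    weightHom K X Z (f ≫ g) = weightHom K X Y f * weightHom K Y Z g := by
  induction f using OrientedKauffman.hom_induction with
  | zero => simp
  | add f f' h h' => rw [Preadditive.add_comp, map_add, map_add, Matrix.add_mul, h, h']
  | smul a D =>
  induction g using OrientedKauffman.hom_induction with
  | zero => simp
  | add f f' h h' => rw [Preadditive.comp_add, map_add, map_add, Matrix.mul_add, h, h']
  | smul b E =>
  rw [Linear.smul_comp, Linear.comp_smul, map_smul, map_smul, map_smul, map_smul, Matrix.smul_mul,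
    Matrix.mul_smul, weightHom_ofDiagram, weightHom_ofDiagram, ofDiagram_comp, map_smul,
    weightHom_ofDiagram, Diagram.weightMat_mul hK hd hd0]

lemma weightHom_id {K : ℤ → Bool → ℂ} (hK : ∀ c b, K c b ≠ 0) (X : OrientedKauffman d) :
    weightHom K X X (𝟙 X) = 1 :=
  (weightHom_ofDiagram K (Diagram.id X.word)).trans (Diagram.weightMat_id hK _)

/-! ### The star operation -/

/-- The antilinear extension of the reflection of diagrams, with the factor `s ^ ♯(D)`. -/
noncomputable def starHom (s : ℂ) {X Y : OrientedKauffman d} (f : X ⟶ Y) : Y ⟶ X :=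
  Finsupp.sum (M := ℂ) (N := Y ⟶ X) f fun (D : Diagram X.word Y.word) c =>
    (starRingEnd ℂ c * s ^ D.sharp) • ofDiagram d D.reflect

lemma starHom_add (s : ℂ) {X Y : OrientedKauffman d} (f g : X ⟶ Y) :
    starHom s (f + g) = starHom s f + starHom s g :=
  Finsupp.sum_add_index' (fun _ => by simp) fun _ _ _ => by rw [map_add, add_mul, add_smul]

lemma starHom_smul_ofDiagram (s c : ℂ) {X Y : OrientedKauffman d} (D : Diagram X.word Y.word) :
    starHom s (c • ofDiagram d D : X ⟶ Y) =
      ((starRingEnd ℂ c * s ^ D.sharp) • ofDiagram d D.reflect : Y ⟶ X) := by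
  have h : (c • ofDiagram d D : X ⟶ Y) = Finsupp.single D c := by
    change c • Finsupp.single D (1 : ℂ) = _
    rw [Finsupp.smul_single_one]
  rw [h]
  exact Finsupp.sum_single_index (by simp)

lemma starHom_ofDiagram (s : ℂ) {X Y : OrientedKauffman d} (D : Diagram X.word Y.word) :
    starHom s (ofDiagram d D : X ⟶ Y) = (s ^ D.sharp • ofDiagram d D.reflect : Y ⟶ X) := by
  have := starHom_smul_ofDiagram (d := d) s 1 D
  rwa [one_smul, map_one, one_mul] at this

lemma starHom_zero (s : ℂ) {X Y : OrientedKauffman d} : starHom s (0 : X ⟶ Y) = 0 :=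
  Finsupp.sum_zero_index

lemma starHom_smul (s c : ℂ) {X Y : OrientedKauffman d} (f : X ⟶ Y) :
    starHom s (c • f) = (starRingEnd ℂ c) • starHom s f := by
  induction f using OrientedKauffman.hom_induction with
  | zero => rw [smul_zero, starHom_zero, smul_zero]
  | add f g hf hg => rw [smul_add, starHom_add, hf, hg, starHom_add, smul_add]
  | smul a D =>
    rw [smul_smul, starHom_smul_ofDiagram, starHom_smul_ofDiagram, smul_smul, map_mul, mul_assoc]

lemma starHom_id (s : ℂ) (X : OrientedKauffman d) : starHom s (𝟙 X) = 𝟙 X := by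
  have h := starHom_ofDiagram (X := X) (Y := X) s (Diagram.id X.word)
  rw [Diagram.sharp_id, zpow_zero, one_smul, Diagram.reflect_id] at h
  exact h

lemma starHom_eqToHom (s : ℂ) {X Y : OrientedKauffman d} (h : X = Y) :
    starHom s (eqToHom h) = eqToHom h.symm := by
  subst h
  exact starHom_id s X

/-- The star structure on diagrams given by a sign. -/
noncomputable def signStar (s : ℝ) (hs : s * s = 1) (hd : starRingEnd ℂ d = d) :
    StarStructure (OrientedKauffman d) where
  star := starHom s
  star_add := starHom_add _
  star_smul c f := starHom_smul _ c f
  star_star f := by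
    induction f using OrientedKauffman.hom_induction with
    | zero => rw [starHom_zero, starHom_zero]
    | add f g hf hg => rw [starHom_add, starHom_add, hf, hg]
    | smul a D =>
      rw [starHom_smul_ofDiagram, starHom_smul_ofDiagram, Diagram.reflect_reflect,
        Diagram.sharp_reflect, map_mul, Complex.conj_conj, map_zpow₀, Complex.conj_ofReal, mul_assoc,
        ← zpow_add₀ (by exact_mod_cast left_ne_zero_of_mul_eq_one hs), add_neg_cancel, zpow_zero,
        mul_one]
  star_comp f g := by
    induction f using OrientedKauffman.hom_induction with
    | zero => rw [Limits.zero_comp, starHom_zero, starHom_zero, Limits.comp_zero]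
    | add f f' h h' => rw [Preadditive.add_comp, starHom_add, starHom_add, Preadditive.comp_add, h, h']
    | smul a D =>
    induction g using OrientedKauffman.hom_induction with
    | zero => rw [Limits.comp_zero, starHom_zero, starHom_zero, Limits.zero_comp]
    | add f f' h h' => rw [Preadditive.comp_add, starHom_add, starHom_add, Preadditive.add_comp, h, h']
    | smul b E =>
      have hs0 : (s : ℂ) ≠ 0 := by exact_mod_cast left_ne_zero_of_mul_eq_one hs
      -- Reflection preserves the number of loops, so antilinearity requires that `d` be fixed by
      -- conjugation.
      obtain ⟨h1, h2⟩ := D.reflect_comp E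
      rw [starHom_smul, starHom_smul, Linear.smul_comp, Linear.comp_smul, Linear.smul_comp,
        Linear.comp_smul, starHom_smul, starHom_smul, starHom_ofDiagram, starHom_ofDiagram,
        ofDiagram_comp, starHom_smul, Linear.smul_comp, Linear.comp_smul, starHom_ofDiagram,
        ofDiagram_comp, h1, h2, map_pow, hd, Diagram.sharp_comp, zpow_add₀ hs0]
      simp only [smul_smul]
      congr 1
      ring
  star_tensor f g := by
    induction f using OrientedKauffman.hom_induction with
    | zero => rw [MonoidalPreadditive.zero_tensor, starHom_zero, starHom_zero,
        MonoidalPreadditive.zero_tensor]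
    | add f f' h h' => rw [MonoidalPreadditive.add_tensor, starHom_add, starHom_add,
        MonoidalPreadditive.add_tensor, h, h']
    | smul a D =>
    induction g using OrientedKauffman.hom_induction with
    | zero => rw [MonoidalPreadditive.tensor_zero, starHom_zero, starHom_zero,
        MonoidalPreadditive.tensor_zero]
    | add f f' h h' => rw [MonoidalPreadditive.tensor_add, starHom_add, starHom_add,
        MonoidalPreadditive.tensor_add, h, h']
    | smul b E =>
      have hs0 : (s : ℂ) ≠ 0 := by exact_mod_cast left_ne_zero_of_mul_eq_one hs
      rw [smul_tensor_smul, starHom_smul, starHom_smul_ofDiagram, starHom_smul_ofDiagram,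
        smul_tensor_smul, ofDiagram_tensor, starHom_ofDiagram, ofDiagram_tensor]
      change _ • _ • ofDiagram d (D.tensor E).reflect = _
      rw [Diagram.reflect_tensor, Diagram.sharp_tensor, zpow_add₀ hs0, smul_smul, map_mul]
      congr 1
      ring
  star_associator X Y Z := starHom_eqToHom _ (append_assoc' X Y Z)
  star_leftUnitor X := starHom_id _ X
  star_rightUnitor X := starHom_eqToHom _ (append_nil' X)

end Morphisms

end KauffmanDiagrams

namespace KauffmanDiagrams
open CategoryTheory MonoidalCategory

/-! ### Existence of the C*-structure -/

section CStar

variable {d : ℂ}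

/-- With real `t` the faithful matrix representation respects adjoints, so the C*-axioms can be
checked on matrices. -/
lemma weightHom_star {s t : ℝ} (hs : s * s = 1) (ht : t ≠ 0) {X Y : OrientedKauffman d}
    (f : X ⟶ Y) : weightHom (turnWeight s t) Y X (starHom s f) =
      (weightHom (turnWeight s t) X Y f).conjTranspose := by
  induction f using OrientedKauffman.hom_induction with
  | zero => rw [starHom_zero, map_zero, map_zero, Matrix.conjTranspose_zero]
  | add f g hf hg => rw [starHom_add, map_add, map_add, hf, hg, Matrix.conjTranspose_add]
  | smul a D =>
    rw [starHom_smul, starHom_ofDiagram, map_smul, map_smul, map_smul, weightHom_ofDiagram,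
      weightHom_ofDiagram, Matrix.conjTranspose_smul, Diagram.weightMat_reflect hs ht]
    rfl

open scoped Matrix.Norms.L2Operator MatrixOrder ComplexOrder

/-- A star subalgebra of a matrix algebra contains the square roots of its positive elements. -/
lemma exists_mul_self_of_posSemidef {n : Type*} [Fintype n] [DecidableEq n]
    (S : StarSubalgebra ℝ (Matrix n n ℂ)) {A : Matrix n n ℂ} (hA : A.PosSemidef) (hAS : A ∈ S) :
    ∃ B ∈ S, B.conjTranspose = B ∧ B * B = A := by
  have hsa : IsSelfAdjoint A := hA.isHermitian
  have hcont : ContinuousOn Real.sqrt (spectrum ℝ A) := Real.continuous_sqrt.continuousOn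
  refine ⟨cfc Real.sqrt A, ?_, ?_, ?_⟩
  -- In finite dimension the subalgebra is closed, so it contains the closed star algebra generated
  -- by `A`, in which the functional calculus takes its values.
  · have hclosed : IsClosed (S : Set (Matrix n n ℂ)) :=
      Submodule.closed_of_finiteDimensional (Subalgebra.toSubmodule S.toSubalgebra)
    exact StarAlgebra.elemental.le_of_mem hclosed hAS (cfc_mem_elemental (𝕜 := ℝ) _ _)
  · exact cfc_predicate (R := ℝ) Real.sqrt A
  · rw [← cfc_mul Real.sqrt Real.sqrt A]
    conv_rhs => rw [← cfc_id ℝ A]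
    refine cfc_congr fun x hx => ?_
    exact Real.mul_self_sqrt (spectrum_nonneg_of_nonneg hA.nonneg hx)

/-- The matrices of the endomorphisms of an object form a star algebra. -/
noncomputable def weightSubalgebra {s t : ℝ} (hs : s * s = 1) (ht : t ≠ 0)
    (hd : ∀ l : Letter, ∑ b, turnWeight s t l.sign b / turnWeight s t (-l.sign) (!b) = d)
    (hd0 : d ≠ 0) (X : OrientedKauffman d) :
    StarSubalgebra ℝ (Matrix (Fin X.word.length → Bool) (Fin X.word.length → Bool) ℂ) :=
  have hK : ∀ c b, turnWeight (s : ℂ) t c b ≠ 0 := turnWeight_ne_zero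
    (by exact_mod_cast left_ne_zero_of_mul_eq_one hs) (by exact_mod_cast ht)
  { carrier := Set.range (weightHom (turnWeight s t) X X)
    mul_mem' := by
      rintro _ _ ⟨f, rfl⟩ ⟨g, rfl⟩
      exact ⟨f ≫ g, weightHom_comp hK hd hd0 f g⟩
    add_mem' := by
      rintro _ _ ⟨f, rfl⟩ ⟨g, rfl⟩
      exact ⟨f + g, map_add _ _ _⟩
    algebraMap_mem' := fun r => ⟨(r : ℂ) • 𝟙 X, by
      rw [map_smul, weightHom_id hK, Algebra.algebraMap_eq_smul_one]
      rfl⟩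
    star_mem' := by
      rintro _ ⟨f, rfl⟩
      exact ⟨starHom s f, weightHom_star hs ht f⟩ }

/-- The norms given by the matrices. -/
theorem signStar_isCStar {s t : ℝ} (hs : s * s = 1) (ht : t ≠ 0)
    (hst : (s : ℂ) * ((t : ℂ) ^ 2 + ((t : ℂ) ^ 2)⁻¹) = d) (hd0 : d ≠ 0)
    (hreal : starRingEnd ℂ d = d) : (signStar s hs hreal).IsCStar := by
  have hs' : (s : ℂ) ≠ 0 := by exact_mod_cast left_ne_zero_of_mul_eq_one hs
  have ht' : (t : ℂ) ≠ 0 := by exact_mod_cast ht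
  have hK : ∀ c b, turnWeight (s : ℂ) t c b ≠ 0 := turnWeight_ne_zero hs' ht'
  have hd : ∀ l : Letter, ∑ b, turnWeight s t l.sign b / turnWeight s t (-l.sign) (!b) = d :=
    sum_turnWeight (by exact_mod_cast hs) ht' hst
  refine ⟨{
    norm := fun X Y => (normSeminorm ℂ _).comp (weightHom (turnWeight s t) X Y)
    eq_zero_of_norm := ?_
    complete := ?_
    norm_comp_le := ?_
    norm_star_mul_self := ?_
    positive := ?_ }⟩
  · intro X Y f hf
    refine weightHom_injective hK X Y ?_
    rw [map_zero]
    exact norm_eq_zero.1 hf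
  · intro X Y u hu
    have hc : CauchySeq fun n => weightHom (turnWeight s t) X Y (u n) := by
      rw [Metric.cauchySeq_iff]
      intro ε hε
      obtain ⟨N, hN⟩ := hu ε hε
      refine ⟨N, fun m hm n hn => ?_⟩
      rw [dist_eq_norm, ← map_sub]
      exact hN m hm n hn
    -- The limit of matrices of morphisms is again the matrix of a morphism, as a finite-dimensional
    -- subspace is closed.
    have hclosed := Submodule.closed_of_finiteDimensional
      (LinearMap.range (weightHom (turnWeight s t) X Y))
    obtain ⟨_, ⟨f, rfl⟩, hf⟩ := cauchySeq_tendsto_of_isComplete hclosed.isComplete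
      (fun n => ⟨u n, rfl⟩) hc
    refine ⟨f, ?_⟩
    have h := tendsto_iff_norm_sub_tendsto_zero.1 hf
    simp only [← map_sub] at h
    exact h
  · intro X Y Z f g
    change ‖weightHom _ X Z (f ≫ g)‖ ≤ ‖weightHom _ X Y f‖ * ‖weightHom _ Y Z g‖
    rw [weightHom_comp hK hd hd0]
    exact Matrix.l2_opNorm_mul _ _
  · intro X Y f
    change ‖weightHom _ X X (f ≫ starHom s f)‖ = ‖weightHom _ X Y f‖ ^ 2
    rw [weightHom_comp hK hd hd0, weightHom_star hs ht]
    have h := Matrix.l2_opNorm_conjTranspose_mul_self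
      (weightHom (turnWeight s t) X Y f).conjTranspose
    rw [Matrix.conjTranspose_conjTranspose, Matrix.l2_opNorm_conjTranspose] at h
    rw [h, sq]
  · intro X Y f
    have hmem : weightHom (turnWeight s t) X X (f ≫ starHom s f) ∈
      weightSubalgebra hs ht hd hd0 X := ⟨_, rfl⟩
    have hpos : (weightHom (turnWeight s t) X X (f ≫ starHom s f)).PosSemidef := by
      rw [weightHom_comp hK hd hd0, weightHom_star hs ht]
      exact Matrix.posSemidef_self_mul_conjTranspose _
    -- The square root lies in the image of the endomorphisms, so it comes from a morphism; being
    -- self-adjoint, it serves as its own adjoint.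
    obtain ⟨_, ⟨g, rfl⟩, h1, h2⟩ := exists_mul_self_of_posSemidef _ hpos hmem
    refine ⟨g, weightHom_injective hK X X ?_⟩
    change weightHom _ X X (f ≫ starHom s f) = weightHom _ X X (g ≫ starHom s g)
    rw [weightHom_comp hK hd hd0 g, weightHom_star hs ht, h1, h2]

/-- For a real parameter of absolute value at least two there is a C*-structure. -/
theorem exists_isCStar {r : ℝ} (hr : 4 ≤ r ^ 2) :
    ∃ S : StarStructure (OrientedKauffman (r : ℂ)), S.IsCStar ∧
      ∀ (w w' : Word) (D : Diagram w w'), S.star (ofDiagram (r : ℂ) D) =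
        ((r : ℂ) / (‖(r : ℂ)‖ : ℂ)) ^ D.sharp • ofDiagram (r : ℂ) D.reflect := by
  have hr0 : r ≠ 0 := by rintro rfl; norm_num at hr
  have habs : 2 ≤ |r| := by
    rw [← abs_of_pos (two_pos (α := ℝ)), ← sq_le_sq]
    linarith
  have habs0 : |r| ≠ 0 := by linarith
  let s : ℝ := r / |r|
  have hs : s * s = 1 := by
    simp only [s]
    rw [div_mul_div_comm, abs_mul_abs_self, div_self (mul_self_ne_zero.2 hr0)]
  -- The larger root of `x ^ 2 - |r| x + 1`, real because `|r| ≥ 2`; the weights use `t = √q`.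
  let q : ℝ := (|r| + √(|r| ^ 2 - 4)) / 2
  have hroot : √(|r| ^ 2 - 4) * √(|r| ^ 2 - 4) = |r| ^ 2 - 4 :=
    Real.mul_self_sqrt (by rw [sq_abs]; linarith)
  have hq : 0 < q := by
    have := Real.sqrt_nonneg (|r| ^ 2 - 4)
    simp only [q]; linarith
  have hqq : q + q⁻¹ = |r| := by
    have h1 : q * q + 1 = |r| * q := by
      simp only [q]
      linear_combination hroot / 4
    field_simp
    linarith
  have ht : √q ≠ 0 := (Real.sqrt_pos.2 hq).ne'
  have hst : s * ((√q) ^ 2 + ((√q) ^ 2)⁻¹) = r := by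
    rw [Real.sq_sqrt hq.le, hqq]
    exact div_mul_cancel₀ r habs0
  refine ⟨signStar s hs (Complex.conj_ofReal r), signStar_isCStar hs ht (by exact_mod_cast hst)
    (by exact_mod_cast hr0) _, fun w w' D => ?_⟩
  refine (starHom_ofDiagram (X := ⟨w⟩) (Y := ⟨w'⟩) _ D).trans ?_
  simp [s]

end CStar

end KauffmanDiagrams

/-! ### Rigidity of C*-structures -/

namespace KauffmanDiagrams
open CategoryTheory MonoidalCategory

/-- There is at most one diagram with a single string. -/
lemma Diagram.subsingleton_of_length_le {w w' : Word} (h : w.length + w'.length ≤ 2) :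
    Subsingleton (Diagram w w') := by
  classical
  refine ⟨fun D E => ?_⟩
  ext p : 2
  by_contra hne
  -- Two different partners of one point would require three boundary points.
  have h1 : ({p, D.partner p, E.partner p} : Finset (Pt w w')).card = 3 :=
    Finset.card_eq_three.2 ⟨_, _, _, (D.partner_ne p).symm, (E.partner_ne p).symm, hne, rfl⟩
  have h2 := Finset.card_le_univ ({p, D.partner p, E.partner p} : Finset (Pt w w'))
  simp only [Fintype.card_sum, Fintype.card_fin] at h2
  omega

section StarOnDiagrams

variable {d : ℂ}

lemma OrientedKauffman.exists_smul_ofDiagram {X Y : OrientedKauffman d}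
    (h : X.word.length + Y.word.length ≤ 2) (D : Diagram X.word Y.word) (f : X ⟶ Y) :
    ∃ c : ℂ, f = c • ofDiagram d D := by
  induction f using OrientedKauffman.hom_induction with
  | zero => exact ⟨0, (zero_smul _ _).symm⟩
  | add f g hf hg =>
    obtain ⟨a, ha⟩ := hf
    obtain ⟨b, hb⟩ := hg
    exact ⟨a + b, by rw [ha, hb, add_smul]⟩
  | smul c E =>
    have := Diagram.subsingleton_of_length_le h
    exact ⟨c, by rw [Subsingleton.elim E D]⟩

lemma ofDiagram_ne_zero {w w' : Word} (D : Diagram w w') : ofDiagram d D ≠ 0 :=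
  Finsupp.single_ne_zero.2 one_ne_zero

lemma smul_ofDiagram_injective {w w' : Word} (D : Diagram w w') {a b : ℂ}
    (h : a • ofDiagram d D = b • ofDiagram d D) : a = b :=
  smul_left_injective ℂ (ofDiagram_ne_zero D) h

lemma comp_ofDiagram {w w' w'' : Word} (D : Diagram w w') (E : Diagram w' w'') :
    ofDiagram d D ≫ ofDiagram d E = d ^ D.loops E • ofDiagram d (D.comp E) :=
  ofDiagram_comp (X := ⟨w⟩) (Y := ⟨w'⟩) (Z := ⟨w''⟩) D E

namespace StarStructure

variable {C : Type*} [Category C] [Preadditive C] [Linear ℂ C] [MonoidalCategory C]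

lemma star_id (S : StarStructure C) (X : C) : S.star (𝟙 X) = 𝟙 X := by
  have h := S.star_comp (𝟙 X) (S.star (𝟙 X))
  rw [Category.id_comp, S.star_star, Category.id_comp] at h
  exact h.symm

lemma star_zero (S : StarStructure C) (X Y : C) : S.star (0 : X ⟶ Y) = 0 := by
  have h := S.star_smul 0 (0 : X ⟶ Y)
  rwa [zero_smul, map_zero, zero_smul] at h

/-- The C*-identity makes the involution proper. For bounding the parameter, no other consequence of
the norm is used beyond the form of the star on diagrams. -/
lemma eq_zero_of_comp_star {S : StarStructure C} (hS : S.IsCStar) {X Y : C} {f : X ⟶ Y}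
    (h : f ≫ S.star f = 0) : f = 0 := by
  obtain ⟨N⟩ := hS
  refine N.eq_zero_of_norm f ?_
  have h1 := N.norm_star_mul_self f
  rw [h, map_zero] at h1
  exact pow_eq_zero_iff two_ne_zero |>.1 h1.symm

variable (S : StarStructure (OrientedKauffman d))

/-- The adjoint of a bare arc lies in a one-dimensional space, and the star commutes with tensoring
by identities; hence the scalar depends only on the letter. -/
lemma exists_star_cap : ∃ a : Letter → ℂ, ∀ (u : Word) (l : Letter) (v : Word),
    S.star (ofDiagram d (cap u l v)) = a l • ofDiagram d (cup u l v) := by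
  have h : ∀ l : Letter, ∃ a : ℂ, S.star (ofDiagram d (arc l)) = a • ofDiagram d (arc l).reflect :=
    fun l => OrientedKauffman.exists_smul_ofDiagram (by simp) _ _
  choose a ha using h
  refine ⟨a, fun u l v => ?_⟩
  have h1 : ofDiagram d (cap u l v) = 𝟙 (⟨u⟩ : OrientedKauffman d) ⊗ₘ
      (ofDiagram d (arc l) ⊗ₘ 𝟙 (⟨v⟩ : OrientedKauffman d)) := by
    rw [← ofDiagram_id u, ← ofDiagram_id v, ofDiagram_tensor, ofDiagram_tensor]
    rfl
  have h2 : ofDiagram d (cup u l v) = 𝟙 (⟨u⟩ : OrientedKauffman d) ⊗ₘ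
      (ofDiagram d (arc l).reflect ⊗ₘ 𝟙 (⟨v⟩ : OrientedKauffman d)) := by
    rw [← ofDiagram_id u, ← ofDiagram_id v, ofDiagram_tensor, ofDiagram_tensor, cup_eq_tensor]
  have h3 := S.star_tensor (𝟙 (⟨u⟩ : OrientedKauffman d))
    (ofDiagram d (arc l) ⊗ₘ 𝟙 (⟨v⟩ : OrientedKauffman d))
  rw [S.star_tensor (ofDiagram d (arc l)) (𝟙 _), ha, S.star_id, S.star_id] at h3
  have h4 : (a l • ofDiagram d (arc l).reflect) ⊗ₘ 𝟙 (⟨v⟩ : OrientedKauffman d) =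
      a l • (ofDiagram d (arc l).reflect ⊗ₘ 𝟙 (⟨v⟩ : OrientedKauffman d)) := by
    have := smul_tensor_smul (a l) 1 (ofDiagram d (arc l).reflect) (𝟙 (⟨v⟩ : OrientedKauffman d))
    rwa [one_smul, mul_one] at this
  have h5 := smul_tensor_smul 1 (a l) (𝟙 (⟨u⟩ : OrientedKauffman d))
    (ofDiagram d (arc l).reflect ⊗ₘ 𝟙 (⟨v⟩ : OrientedKauffman d))
  rw [one_smul, one_mul] at h5
  rw [h4, h5] at h3
  rw [h1, h2]
  exact h3

/-- Involutivity of the star inverts the relation for caps and excludes a zero scalar. -/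
lemma exists_star_cap_cup : ∃ a : Letter → ℂ, (∀ l, a l ≠ 0) ∧
    (∀ (u : Word) (l : Letter) (v : Word),
      S.star (ofDiagram d (cap u l v)) = a l • ofDiagram d (cup u l v)) ∧
    ∀ (u : Word) (l : Letter) (v : Word), S.star (ofDiagram d (cup u l v)) =
      (starRingEnd ℂ (a l))⁻¹ • ofDiagram d (cap u l v) := by
  obtain ⟨a, ha⟩ := S.exists_star_cap
  have h1 : ∀ (u : Word) (l : Letter) (v : Word), ofDiagram d (cap u l v) =
      starRingEnd ℂ (a l) • S.star (ofDiagram d (cup u l v)) := by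
    intro u l v
    rw [← S.star_smul, ← ha, S.star_star]
  have h2 : ∀ l, a l ≠ 0 := by
    intro l h
    have := h1 [] l []
    rw [h, map_zero, zero_smul] at this
    exact ofDiagram_ne_zero _ this
  refine ⟨a, h2, ha, fun u l v => ?_⟩
  rw [h1, smul_smul, inv_mul_cancel₀ (by simpa using h2 l), one_smul]

/-- The two zigzag relations. -/
lemma zigzag :
    (ofDiagram d (cup [] .X [.X]) : (⟨[.X]⟩ : OrientedKauffman d) ⟶ ⟨[.X, .Xstar, .X]⟩) ≫
      ofDiagram d (cap [.X] .Xstar []) = 𝟙 (⟨[.X]⟩ : OrientedKauffman d) ∧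
    (ofDiagram d (cup [.X] .Xstar []) : (⟨[.X]⟩ : OrientedKauffman d) ⟶ ⟨[.X, .Xstar, .X]⟩) ≫
      ofDiagram d (cap [] .X [.X]) = 𝟙 (⟨[.X]⟩ : OrientedKauffman d) := by
  have hsub : Subsingleton (Diagram [Letter.X] [Letter.X]) :=
    Diagram.subsingleton_of_length_le (by simp)
  constructor
  · refine (comp_ofDiagram (w := [.X]) (w' := [.X, .Xstar, .X]) (w'' := [.X]) _ _).trans ?_
    have h : (cup [] .X [.X]).loops (w := [.X]) (w' := [.X, .Xstar, .X]) (w'' := [.X])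
        (cap [.X] .Xstar []) = 0 := by
      refine loops_cap_eq_zero (u := [.X]) (l := .Xstar) (v := []) (w := [.X])
        (cup [] .X [.X]) fun h => ?_
      have h1 : (cup [] .X [.X]).partner (.inr (1 : Fin 3)) = .inr (0 : Fin 3) :=
        cup_partner_right (u := []) (l := .X) (v := [.X])
      have h2 := h1.symm.trans h
      simp [rightPt] at h2
    rw [h, pow_zero, one_smul]
    exact congrArg (ofDiagram d) (Subsingleton.elim _ (Diagram.id [.X]))
  · refine (comp_ofDiagram (w := [.X]) (w' := [.X, .Xstar, .X]) (w'' := [.X]) _ _).trans ?_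
    have h : (cup [.X] .Xstar []).loops (w := [.X]) (w' := [.X, .Xstar, .X]) (w'' := [.X])
        (cap [] .X [.X]) = 0 := by
      refine loops_cap_eq_zero (u := []) (l := .X) (v := [.X]) (w := [.X])
        (cup [.X] .Xstar []) fun h => ?_
      have h1 : (cup [.X] .Xstar []).partner (.inr (1 : Fin 3)) = .inr (2 : Fin 3) :=
        cup_partner_left (u := [.X]) (l := .Xstar) (v := [])
      have h2 : (cup [.X] .Xstar []).partner (.inr (0 : Fin 3)) = .inr (1 : Fin 3) := h
      have h3 := (cup [.X] .Xstar []).partner_partner (.inr (0 : Fin 3))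
      have h4 := (congrArg (cup [.X] .Xstar []).partner h2).symm.trans h3
      have h5 := h1.symm.trans h4
      simp at h5
    rw [h, pow_zero, one_smul]
    exact congrArg (ofDiagram d) (Subsingleton.elim _ (Diagram.id [.X]))

variable {S}

/-- The value of the star operation on caps. -/
lemma IsCStar.exists_real (hS : S.IsCStar) : ∃ a r : ℝ, d = r ∧ 0 < a * r ∧
    (∀ (u : Word) (l : Letter) (v : Word),
      S.star (ofDiagram d (cap u l v)) = (a : ℂ) • ofDiagram d (cup u l v)) ∧
    ∀ (u : Word) (l : Letter) (v : Word), S.star (ofDiagram d (cup u l v)) =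
      (a : ℂ)⁻¹ • ofDiagram d (cap u l v) := by
  obtain ⟨a, ha0, hcap, hcup⟩ := S.exists_star_cap_cup
  -- The star exchanges the two zigzags up to the product of the scalar of the cap and that of the
  -- cup; both zigzags are identities, so this product is one.
  have hconj : a .Xstar = starRingEnd ℂ (a .X) := by
    have gen : ∀ {A B : OrientedKauffman d} (f f' : A ⟶ B) (g g' : B ⟶ A) (x y : ℂ),
        S.star f = y • g' → S.star g = x • f' → f ≫ g = 𝟙 A → f' ≫ g' = 𝟙 A →
        (x * y) • 𝟙 A = (1 : ℂ) • 𝟙 A := by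
      intro A B f f' g g' x y h1 h2 h3 h4
      have h5 := S.star_comp f g
      rw [h1, h2, h3, S.star_id, Linear.smul_comp, Linear.comp_smul, h4, smul_smul] at h5
      rw [← h5, one_smul]
    have h1 := gen _ _ _ _ _ _ (hcup [] .X [.X]) (hcap [.X] .Xstar []) (zigzag (d := d)).1
      (zigzag (d := d)).2
    exact eq_of_div_eq_one (smul_ofDiagram_injective (Diagram.id [.X]) h1)
  -- A cup followed by its adjoint is the scalar `d` divided by the conjugate of `a l`.
  -- Endomorphisms of the empty word are scalars, so the positivity axiom makes this a squared
  -- modulus, nonzero since the cup is nonzero.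
  have hpos : ∀ l, ∃ ρ : ℝ, 0 < ρ ∧ d = ρ * starRingEnd ℂ (a l) := by
    intro l
    have h1 : ofDiagram d (cup [] l []) ≫ S.star (ofDiagram d (cup [] l [])) =
        ((starRingEnd ℂ (a l))⁻¹ * d) • 𝟙 (⟨[]⟩ : OrientedKauffman d) := by
      rw [hcup, Linear.comp_smul, mul_smul]
      congr 1
      refine (comp_ofDiagram _ _).trans ?_
      rw [loops_cap_eq_one _ cup_partner_left, pow_one]
      have hsub : Subsingleton (Diagram ([] : Word) []) :=
        Diagram.subsingleton_of_length_le (by simp)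
      exact congrArg (fun D => d • ofDiagram d D) (Subsingleton.elim _ (Diagram.id []))
    obtain ⟨N⟩ := id hS
    obtain ⟨g, hg⟩ : ∃ g : (⟨[]⟩ : OrientedKauffman d) ⟶ ⟨[]⟩,
        ofDiagram d (cup [] l []) ≫ S.star (ofDiagram d (cup [] l [])) = g ≫ S.star g :=
      N.positive _
    obtain ⟨z, hz⟩ := OrientedKauffman.exists_smul_ofDiagram (d := d) (X := ⟨[]⟩) (Y := ⟨[]⟩)
      (by simp) (Diagram.id []) g
    have hz' : g = z • 𝟙 (⟨[]⟩ : OrientedKauffman d) := hz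
    have h2 : g ≫ S.star g = (z * starRingEnd ℂ z) • 𝟙 (⟨[]⟩ : OrientedKauffman d) := by
      rw [hz', S.star_smul, S.star_id, Linear.smul_comp, Linear.comp_smul, smul_smul,
        Category.comp_id]
    have h3 := smul_ofDiagram_injective (d := d) (Diagram.id []) (h1.symm.trans (hg.trans h2))
    have hne : z ≠ 0 := by
      rintro rfl
      refine ofDiagram_ne_zero (d := d) (cup [] l []) (eq_zero_of_comp_star hS ?_)
      refine h1.trans ?_
      rw [h3, zero_mul, zero_smul]
    refine ⟨‖z‖ ^ 2, by positivity, ?_⟩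
    rw [Complex.mul_conj, Complex.normSq_eq_norm_sq] at h3
    rw [← h3]
    have h4 : starRingEnd ℂ (a l) ≠ 0 := by simpa using ha0 l
    field_simp
  obtain ⟨ρ, hρ, h1⟩ := hpos .X
  obtain ⟨ρ', hρ', h2⟩ := hpos .Xstar
  rw [hconj, Complex.conj_conj] at h2
  -- Now `d` is a positive multiple of `a .X` and of its conjugate. Comparing moduli identifies the
  -- two multiples, so `a .X` is real.
  have hnorm : ρ = ρ' := by
    have h3 := congrArg norm (h1.symm.trans h2)
    rw [norm_mul, norm_mul, Complex.norm_real, Complex.norm_real, RCLike.norm_conj,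
      Real.norm_of_nonneg hρ.le, Real.norm_of_nonneg hρ'.le] at h3
    exact mul_right_cancel₀ (norm_ne_zero_iff.2 (ha0 .X)) h3
  have hreal : starRingEnd ℂ (a .X) = a .X := by
    have h3 := h1.symm.trans h2
    rw [hnorm] at h3
    exact mul_left_cancel₀ (by exact_mod_cast hρ'.ne') h3
  obtain ⟨α, hα⟩ := Complex.conj_eq_iff_real.1 hreal
  have hall : ∀ l, a l = α := by
    rintro (_ | _)
    · exact hα
    · rw [hconj, hreal, hα]
  have hα0 : α ≠ 0 := by
    rintro rfl
    exact ha0 .X (by rw [hα, Complex.ofReal_zero])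
  refine ⟨α, ρ * α, ?_, ?_, ?_, ?_⟩
  · rw [h1, hreal, hα, Complex.ofReal_mul]
  · have := mul_self_pos.2 hα0
    nlinarith
  · intro u l v
    rw [hcap, hall]
  · intro u l v
    rw [hcup, hall, Complex.conj_ofReal]

/-- A C*-structure is determined by a real parameter. -/
theorem IsCStar.exists_star_eq (hS : S.IsCStar) : ∃ a r : ℝ, d = r ∧ 0 < a * r ∧
    ∀ (w w' : Word) (D : Diagram w w'),
      S.star (ofDiagram d D) = (a : ℂ) ^ D.sharp • ofDiagram d D.reflect := by
  obtain ⟨a, r, hd, har, hcap, hcup⟩ := hS.exists_real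
  refine ⟨a, r, hd, har, ?_⟩
  have ha0 : (a : ℂ) ≠ 0 := by
    rw [Complex.ofReal_ne_zero]
    rintro rfl
    simp at har
  have hd0 : d ≠ 0 := by
    rw [hd, Complex.ofReal_ne_zero]
    rintro rfl
    simp at har
  have hdconj : starRingEnd ℂ d = d := by rw [hd, Complex.conj_ofReal]
  -- The formula passes to composites: `♯` is additive, reflection preserves loops, and the common
  -- power of the real nonzero `d` cancels.
  have key : ∀ {w w' w'' : Word} (D : Diagram w w') (E : Diagram w' w''),
      S.star (ofDiagram d D) = (a : ℂ) ^ D.sharp • ofDiagram d D.reflect →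
      S.star (ofDiagram d E) = (a : ℂ) ^ E.sharp • ofDiagram d E.reflect →
      S.star (ofDiagram d (D.comp E)) =
        (a : ℂ) ^ (D.comp E).sharp • ofDiagram d (D.comp E).reflect := by
    intro w w' w'' D E hD hE
    have h1 := S.star_comp (ofDiagram d D) (ofDiagram d E)
    rw [hD, hE, comp_ofDiagram, S.star_smul, Linear.smul_comp, Linear.comp_smul, comp_ofDiagram,
      (D.reflect_comp E).1, (D.reflect_comp E).2, map_pow, hdconj, smul_smul, smul_smul] at h1
    refine smul_right_injective _ (pow_ne_zero (D.loops E) hd0) ?_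
    change d ^ D.loops E • _ = d ^ D.loops E • _
    rw [h1, Diagram.sharp_comp, zpow_add₀ ha0, smul_smul]
    congr 1
    ring
  intro w w' D
  induction D using Diagram.induction_caps with
  | id w => rw [Diagram.sharp_id, zpow_zero, one_smul, Diagram.reflect_id, ofDiagram_id, S.star_id]
  | cap u l v E ih =>
    refine key _ _ ?_ ih
    rw [hcap, sharp_cap, zpow_one]
    rfl
  | cup u l v E ih =>
    refine key _ _ ih ?_
    rw [hcup, sharp_cup, zpow_neg_one, cup, Diagram.reflect_reflect]

end StarStructure

/-! ### Uniqueness -/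

/-- The self-equivalence that rescales the morphisms according to the lengths of the words. -/
noncomputable def rescale (d : ℂ) (c : ℂ) (hc : c ≠ 0) : OrientedKauffman d ⥤ OrientedKauffman d where
  obj X := X
  map {X Y} f := c ^ ((X.word.length : ℤ) - Y.word.length) • f
  map_id X := by rw [sub_self, zpow_zero, one_smul]
  map_comp {X Y Z} f g := by
    rw [Linear.smul_comp, Linear.comp_smul, smul_smul, ← zpow_add₀ hc, sub_add_sub_cancel]

variable {c : ℂ} {hc : c ≠ 0}

lemma rescale_map_of_length_eq {X Y : OrientedKauffman d} (f : X ⟶ Y)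
    (h : X.word.length = Y.word.length) : (rescale d c hc).map f = f := by
  change c ^ ((X.word.length : ℤ) - Y.word.length) • f = f
  rw [h, sub_self, zpow_zero, one_smul]

lemma rescale_map_tensor {X Y X' Y' : OrientedKauffman d} (f : X ⟶ Y) (g : X' ⟶ Y') :
    (rescale d c hc).map (f ⊗ₘ g) = (rescale d c hc).map f ⊗ₘ (rescale d c hc).map g := by
  refine Eq.trans ?_ (smul_tensor_smul _ _ _ _).symm
  change c ^ (((X.word ++ X'.word).length : ℤ) - (Y.word ++ Y'.word).length) • _ = _
  rw [List.length_append, List.length_append, ← zpow_add₀ hc]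
  congr 2
  push_cast
  ring

/-- The rescaling is strictly monoidal. -/
@[reducible] noncomputable def rescaleMonoidal (d : ℂ) (c : ℂ) (hc : c ≠ 0) : (rescale d c hc).Monoidal :=
  Functor.CoreMonoidal.toMonoidal
    { εIso := Iso.refl _
      μIso := fun X Y => Iso.refl _
      μIso_hom_natural_left := by
        intro X Y f X'
        change (rescale d c hc).map f ▷ X' ≫ 𝟙 _ = 𝟙 _ ≫ (rescale d c hc).map (f ▷ X')
        rw [Category.comp_id, Category.id_comp, ← tensorHom_id, ← tensorHom_id, rescale_map_tensor,
          (rescale d c hc).map_id]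
        rfl
      μIso_hom_natural_right := by
        intro X Y X' f
        change X' ◁ (rescale d c hc).map f ≫ 𝟙 _ = 𝟙 _ ≫ (rescale d c hc).map (X' ◁ f)
        rw [Category.comp_id, Category.id_comp, ← id_tensorHom, ← id_tensorHom, rescale_map_tensor,
          (rescale d c hc).map_id]
        rfl
      associativity := by
        intro X Y Z
        change (𝟙 _ ▷ Z) ≫ 𝟙 _ ≫ (rescale d c hc).map (α_ X Y Z).hom =
          (α_ X Y Z).hom ≫ X ◁ 𝟙 _ ≫ 𝟙 _
        rw [rescale_map_of_length_eq _ (congrArg (fun A : OrientedKauffman d => A.word.length)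
          (append_assoc' X Y Z)), id_whiskerRight, whiskerLeft_id]
        erw [Category.id_comp, Category.id_comp, Category.comp_id, Category.comp_id]
      left_unitality := by
        intro X
        change (λ_ X).hom = (𝟙 _ ▷ X) ≫ 𝟙 _ ≫ (rescale d c hc).map (λ_ X).hom
        rw [rescale_map_of_length_eq _ rfl, id_whiskerRight]
        erw [Category.id_comp, Category.id_comp]
      right_unitality := by
        intro X
        change (ρ_ X).hom = (X ◁ 𝟙 _) ≫ 𝟙 _ ≫ (rescale d c hc).map (ρ_ X).hom
        rw [rescale_map_of_length_eq _ (congrArg (fun A : OrientedKauffman d => A.word.length)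
          (append_nil' X)), whiskerLeft_id]
        erw [Category.id_comp, Category.id_comp] }

/-- The rescaling is naturally isomorphic to the identity functor. -/
noncomputable def rescaleIso (d : ℂ) (c : ℂ) (hc : c ≠ 0) : 𝟭 (OrientedKauffman d) ≅ rescale d c hc :=
  NatIso.ofComponents (fun X =>
    { hom := (c ^ (-(X.word.length : ℤ)) • 𝟙 X : X ⟶ X)
      inv := (c ^ (X.word.length : ℤ) • 𝟙 X : X ⟶ X)
      hom_inv_id := by
        change (c ^ (-(X.word.length : ℤ)) • 𝟙 X) ≫ (c ^ (X.word.length : ℤ) • 𝟙 X) = 𝟙 X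
        rw [Linear.smul_comp, Linear.comp_smul, smul_smul, ← zpow_add₀ hc, Category.comp_id,
          neg_add_cancel, zpow_zero, one_smul]
      inv_hom_id := by
        change (c ^ (X.word.length : ℤ) • 𝟙 X) ≫ (c ^ (-(X.word.length : ℤ)) • 𝟙 X) = 𝟙 X
        rw [Linear.smul_comp, Linear.comp_smul, smul_smul, ← zpow_add₀ hc, Category.comp_id,
          add_neg_cancel, zpow_zero, one_smul] }) (by
    intro X Y f
    change f ≫ (c ^ (-(Y.word.length : ℤ)) • 𝟙 Y) = (c ^ (-(X.word.length : ℤ)) • 𝟙 X) ≫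
      (c ^ ((X.word.length : ℤ) - Y.word.length) • f)
    rw [Linear.smul_comp, Linear.comp_smul, Linear.comp_smul, smul_smul, ← zpow_add₀ hc,
      Category.comp_id, Category.id_comp]
    congr 2
    ring)

/-- Any two C*-structures are equivalent. -/
theorem StarStructure.IsCStar.equivalent {S T : StarStructure (OrientedKauffman d)}
    (hS : S.IsCStar) (hT : T.IsCStar) : S.Equivalent T := by
  obtain ⟨a, r, hd, har, hSD⟩ := hS.exists_star_eq
  obtain ⟨b, r', hd', hbr, hTD⟩ := hT.exists_star_eq
  obtain rfl : r = r' := by exact_mod_cast hd.symm.trans hd'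
  have hb0 : b ≠ 0 := by rintro rfl; simp at hbr
  have ha0 : a ≠ 0 := by rintro rfl; simp at har
  -- Both parameters have the sign of `r`.
  have hab : 0 < a / b := by
    have h1 : 0 < (a * r) * (b * r) := mul_pos har hbr
    have h2 : 0 < a * b := by
      by_contra h
      nlinarith [sq_nonneg r]
    rw [div_pos_iff]
    exact mul_pos_iff.1 h2
  -- Rescaling multiplies a diagram by `γ ^ (2 ♯)` and its reflection by the inverse, so the two
  -- stars are matched by `γ ^ 4 = a / b`.
  let γ : ℝ := √√(a / b)
  have hγ0 : γ ≠ 0 := (Real.sqrt_pos.2 (Real.sqrt_pos.2 hab)).ne'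
  have hγ : (γ : ℂ) ^ 2 * (γ : ℂ) ^ 2 * b = a := by
    have h1 : γ ^ 2 * γ ^ 2 * b = a := by
      rw [Real.sq_sqrt (Real.sqrt_nonneg _), Real.mul_self_sqrt hab.le, div_mul_cancel₀ a hb0]
    exact_mod_cast h1
  have hc : (γ : ℂ) ≠ 0 := by exact_mod_cast hγ0
  have hb : (b : ℂ) ≠ 0 := by exact_mod_cast hb0
  refine ⟨rescale d γ hc, rescaleMonoidal d γ hc, Functor.isEquivalence_of_iso (rescaleIso d γ hc),
    ⟨fun {X Y f g} => smul_add _ f g⟩, ⟨fun {X Y} f z => smul_comm _ z f⟩, fun X Y f => ?_,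
    T.star_id _, fun X Y => T.star_id _⟩
  induction f using OrientedKauffman.hom_induction with
  | zero =>
    rw [S.star_zero]
    change _ • (0 : Y ⟶ X) = T.star (_ • (0 : X ⟶ Y))
    rw [smul_zero, smul_zero, T.star_zero]
  | add f g hf hg =>
    change _ • S.star f = T.star (_ • f) at hf
    change _ • S.star g = T.star (_ • g) at hg
    change _ • S.star (f + g) = T.star (_ • (f + g))
    rw [S.star_add, smul_add, smul_add, T.star_add, hf, hg]
  | smul z D =>
    change _ • S.star (z • ofDiagram d D : X ⟶ Y) = T.star (_ • z • ofDiagram d D : X ⟶ Y)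
    have h1 : S.star (ofDiagram d D : X ⟶ Y) = ((a : ℂ) ^ D.sharp • ofDiagram d D.reflect : Y ⟶ X) :=
      hSD _ _ D
    have h2 : T.star (ofDiagram d D : X ⟶ Y) = ((b : ℂ) ^ D.sharp • ofDiagram d D.reflect : Y ⟶ X) :=
      hTD _ _ D
    rw [S.star_smul, T.star_smul, T.star_smul, h1, h2, map_zpow₀, Complex.conj_ofReal]
    simp only [smul_smul]
    congr 1
    have h3 := D.two_mul_sharp
    have h4 : (Y.word.length : ℤ) - X.word.length = -(2 * D.sharp) := by omega
    rw [h4, ← h3, ← hγ, mul_zpow, mul_zpow, zpow_neg, zpow_mul]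
    have h5 : ((γ : ℂ) ^ (2 : ℤ)) ^ D.sharp ≠ 0 := zpow_ne_zero _ (zpow_ne_zero _ hc)
    field_simp

end StarOnDiagrams

end KauffmanDiagrams

namespace KauffmanDiagrams
open CategoryTheory MonoidalCategory

/-! ### Jones-Wenzl projections -/

/-- The quotients of consecutive quantum integers. -/
noncomputable def quantumRatio (r : ℝ) : ℕ → ℝ
  | 0 => r
  | n + 1 => r - (quantumRatio r n)⁻¹

/-- Replacing `r` by `-r` negates all ratios, so `r` may be taken positive. If all ratios `ρ` were
positive, then `ρ + ρ⁻¹ ≥ 2` would make each step of the recursion decrease them by at least `2 -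
r`, which cannot go on. -/
lemma exists_quantumRatio_mul_le_zero {r : ℝ} (hr : r ^ 2 < 4) :
    ∃ n, quantumRatio r n * r ≤ 0 := by
  by_contra! h
  wlog hpos : 0 < r generalizing r
  · have hneg : ∀ n, quantumRatio (-r) n = -quantumRatio r n := by
      intro n
      induction n with
      | zero => rfl
      | succ n ih => rw [quantumRatio, quantumRatio, ih, inv_neg]; ring
    have h0 := h 0
    have hne : r ≠ 0 := by rintro rfl; simp at h0
    refine this (r := -r) (by rwa [neg_sq]) (fun n => ?_) ?_
    · rw [hneg, neg_mul_neg]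
      exact h n
    · exact neg_pos.2 (lt_of_le_of_ne (not_lt.1 hpos) hne)
  have hq : ∀ n, 0 < quantumRatio r n := fun n => pos_of_mul_pos_left (h n) hpos.le
  have hr2 : r < 2 := by nlinarith
  have hle : ∀ n : ℕ, quantumRatio r n ≤ r + n * (r - 2) := by
    intro n
    induction n with
    | zero => simp [quantumRatio]
    | succ n ih =>
      have h1 := hq n
      have h2 : 2 ≤ quantumRatio r n + (quantumRatio r n)⁻¹ := by
        have h3 : 0 ≤ (quantumRatio r n - 1) ^ 2 * (quantumRatio r n)⁻¹ := by positivity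
        have h4 : (quantumRatio r n - 1) ^ 2 * (quantumRatio r n)⁻¹ =
          quantumRatio r n + (quantumRatio r n)⁻¹ - 2 := by field_simp; ring
        linarith
      rw [quantumRatio]
      push_cast
      linarith
  obtain ⟨n, hn⟩ := exists_nat_gt (r / (2 - r))
  rw [div_lt_iff₀ (by linarith)] at hn
  have h1 := hle n
  have h2 := hq n
  nlinarith

section JonesWenzl

variable {A : Type*} [Ring A] [Algebra ℂ A]

/-- Relations satisfied by the first `N` generators of a Temperley-Lieb algebra. -/
structure TemperleyLieb (r : ℝ) (e : ℕ → A) (N : ℕ) : Prop where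
  sq : ∀ i < N, e i * e i = (r : ℂ) • e i
  down : ∀ i, i + 1 < N → e (i + 1) * e i * e (i + 1) = e (i + 1)
  comm : ∀ i j, i + 2 ≤ j → j < N → e i * e j = e j * e i

/-- The properties of a Jones-Wenzl projection `p` and its predecessor `q`. -/
structure IsJonesWenzl (r : ℝ) (e : ℕ → A) (N n : ℕ) (p q : A) : Prop where
  idem : p * p = p
  idem' : q * q = q
  mul_pred : p * q = p
  comm : ∀ j, n < j → j < N → p * e j = e j * p
  comm' : q * e n = e n * q
  trace : e n * p * e n = (quantumRatio r n : ℂ) • (q * e n)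

variable {r : ℝ} {e : ℕ → A} {N : ℕ}

lemma TemperleyLieb.isJonesWenzl_zero (h : TemperleyLieb r e N) (hN : 0 < N) :
    IsJonesWenzl r e N 0 1 1 where
  idem := one_mul 1
  idem' := one_mul 1
  mul_pred := one_mul 1
  comm j _ _ := by rw [one_mul, mul_one]
  comm' := by rw [one_mul, mul_one]
  trace := by rw [mul_one, one_mul]; exact h.sq 0 hN

/-- Wenzl's recursion. The coefficient is chosen so that the new element is idempotent, by the trace
relation for `p`. -/
lemma TemperleyLieb.isJonesWenzl_succ (h : TemperleyLieb r e N) {n : ℕ} (hn : n + 1 < N) {p q : A}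
    (hp : IsJonesWenzl r e N n p q) (h0 : quantumRatio r n ≠ 0) :
    IsJonesWenzl r e N (n + 1) (p - ((quantumRatio r n : ℂ))⁻¹ • (p * e n * p)) p := by
  have h0' : (quantumRatio r n : ℂ) ≠ 0 := by exact_mod_cast h0
  have hpe : p * e (n + 1) = e (n + 1) * p := hp.comm _ (Nat.lt_succ_self n) hn
  have hpp : ∀ x, p * (p * x) = p * x := fun x => by rw [← mul_assoc, hp.idem]
  have hpq : ∀ x, p * (q * x) = p * x := fun x => by rw [← mul_assoc, hp.mul_pred]
  have hepe : ∀ x, e n * (p * (e n * x)) = (quantumRatio r n : ℂ) • (q * (e n * x)) := fun x => by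
    rw [← mul_assoc, ← mul_assoc, hp.trace, smul_mul_assoc, mul_assoc]
  have hright : (p - ((quantumRatio r n : ℂ))⁻¹ • (p * e n * p)) * p =
      p - ((quantumRatio r n : ℂ))⁻¹ • (p * e n * p) := by
    rw [sub_mul, smul_mul_assoc, mul_assoc (p * e n), hp.idem]
  refine ⟨?_, hp.idem, hright, ?_, hpe, ?_⟩
  · conv_lhs => rw [mul_sub, hright]
    rw [mul_smul_comm, sub_mul, smul_mul_assoc]
    simp only [mul_assoc, hpp]
    rw [hepe, mul_smul_comm, hpq, smul_smul, inv_mul_cancel₀ h0', one_smul, sub_self,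
      smul_zero, sub_zero]
  · intro j hj hjN
    have h1 : p * e j = e j * p := hp.comm j (by omega) hjN
    have h2 : e n * e j = e j * e n := h.comm n j (by omega) hjN
    rw [sub_mul, mul_sub, h1, smul_mul_assoc, mul_smul_comm]
    congr 2
    rw [mul_assoc (p * e n), h1, mul_assoc p, ← mul_assoc (e n), h2, mul_assoc (e j), ← mul_assoc p,
      h1]
    simp only [mul_assoc]
  · have h1 : e (n + 1) * p * e (n + 1) = (r : ℂ) • (p * e (n + 1)) := by
      rw [← hpe, mul_assoc, h.sq _ hn, mul_smul_comm]
    -- As `p` commutes with `e (n + 1)`, the relation `down` applies between the two copies of `p`.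
    -- Together with `h1` this gives the recursion of `quantumRatio`.
    have h2 : e (n + 1) * (p * e n * p) * e (n + 1) = p * e (n + 1) := by
      have h3 : e (n + 1) * (p * e n * p) * e (n + 1) =
          (e (n + 1) * p) * e n * (p * e (n + 1)) := by simp only [mul_assoc]
      rw [h3, hpe, ← hpe]
      have h4 : p * e (n + 1) * e n * (p * e (n + 1)) =
          p * (e (n + 1) * e n * e (n + 1)) * p := by
        rw [hpe, ← mul_assoc p, ← mul_assoc p, hpe]
        simp only [mul_assoc]
      rw [h4, h.down n hn, mul_assoc, ← hpe, ← mul_assoc, hp.idem]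
    rw [mul_sub, sub_mul, mul_smul_comm, smul_mul_assoc, h1, h2, ← sub_smul, quantumRatio]
    push_cast
    rfl

/-- Positivity forces the quantum integers to be positive. -/
lemma IsJonesWenzl.ratio_pos {n : ℕ} {p q : A} (hp : IsJonesWenzl r e N n p q)
    (hr : r ≠ 0) (hsq : e n * e n = (r : ℂ) • e n) {st : A →+ A}
    (st_mul : ∀ x y, st (x * y) = st y * st x)
    (st_smul : ∀ (c : ℂ) x, st (c • x) = (starRingEnd ℂ c) • st x)
    (st_proper : ∀ x, x * st x = 0 → x = 0) (he : st (e n) = e n) (hsp : st p = p)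
    (hsq' : st q = q) (hqe : q * e n ≠ 0) (hpe : p * e n ≠ 0) : 0 < quantumRatio r n * r := by
  by_contra hneg
  rw [not_lt] at hneg
  set ρ := quantumRatio r n with hρ
  set P := q * e n with hP
  set x := e n * p with hx
  have hstP : st P = P := by rw [hP, st_mul, he, hsq', hp.comm']
  have hstx : st x = p * e n := by rw [hx, st_mul, hsp, he]
  have h1 : x * st x = (ρ : ℂ) • P := by
    rw [hstx, hx, mul_assoc, ← mul_assoc p, hp.idem, ← mul_assoc, hp.trace]
  have h2 : x * P = (ρ : ℂ) • P := by
    rw [hx, hP, mul_assoc, ← mul_assoc p, hp.mul_pred, ← mul_assoc, hp.trace]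
  have h3 : P * st x = (ρ : ℂ) • P := by
    have := congrArg st h2
    rwa [st_mul, st_smul, hstP, Complex.conj_ofReal] at this
  have h4 : P * P = (r : ℂ) • P := by
    rw [hP, mul_assoc, ← mul_assoc (e n), ← hp.comm', mul_assoc, hsq, mul_smul_comm, mul_smul_comm,
      ← mul_assoc, hp.idem']
  -- This polynomial in `α` is the coefficient of `P` in the product of `x + α P` with its adjoint.
  -- Its discriminant is a positive multiple of `ρ ^ 2 - ρ r`, nonnegative under the contrary
  -- assumption, so a real root exists.
  obtain ⟨α, hα⟩ : ∃ α : ℝ, ρ + 2 * α * ρ + α ^ 2 * r = 0 := by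
    obtain ⟨σ, hσ⟩ : ∃ σ : ℝ, σ ^ 2 = ρ ^ 2 - ρ * r :=
      ⟨√(ρ ^ 2 - ρ * r), Real.sq_sqrt (by nlinarith [sq_nonneg ρ])⟩
    refine ⟨(-ρ + σ) / r, ?_⟩
    field_simp
    linear_combination hσ
  have hz : x + (α : ℂ) • P = 0 := by
    refine st_proper _ ?_
    rw [map_add, st_smul, hstP, Complex.conj_ofReal, add_mul, mul_add, mul_add, mul_smul_comm,
      smul_mul_assoc, smul_mul_assoc, mul_smul_comm, h1, h2, h3, h4]
    simp only [smul_smul, ← add_smul]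
    have h5 : (ρ : ℂ) + α * ρ + (α * ρ + α * (α * r)) = 0 := by
      have : ((ρ + 2 * α * ρ + α ^ 2 * r : ℝ) : ℂ) = 0 := by rw [hα, Complex.ofReal_zero]
      push_cast at this
      linear_combination this
    rw [h5, zero_smul]
  -- Multiplying `x + α P = 0` by `P` gives a second equation. The two leave only `α = 0`, where `x`
  -- vanishes, and `α = -1`, where `ρ = r` contradicts the sign assumption.
  have h5 : ρ + α * r = 0 := by
    have h6 : ((ρ : ℂ) + α * r) • P = 0 := by
      rw [add_smul, mul_smul, ← h4, ← h2, ← smul_mul_assoc, ← add_mul, hz, zero_mul]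
    have h7 := (smul_eq_zero.1 h6).resolve_right hqe
    exact_mod_cast h7
  have h6 : r * (α * (α + 1)) = 0 := by linear_combination (2 * α + 1) * h5 - hα
  rcases mul_eq_zero.1 ((mul_eq_zero.1 h6).resolve_left hr) with h7 | h7
  · rw [h7, Complex.ofReal_zero, zero_smul, add_zero] at hz
    rw [hz, map_zero] at hstx
    exact hpe hstx.symm
  · have h8 : ρ = r := by
      have : α = -1 := by linarith
      rw [this] at h5
      linarith
    rw [h8] at hneg
    have := mul_self_pos.2 hr
    linarith

/-- The Temperley-Lieb relations in a star algebra restrict the parameter. -/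
theorem TemperleyLieb.ratio_pos (h : TemperleyLieb r e N) (hr : r ≠ 0) {st : A →+ A}
    (st_one : st 1 = 1) (st_mul : ∀ x y, st (x * y) = st y * st x)
    (st_smul : ∀ (c : ℂ) x, st (c • x) = (starRingEnd ℂ c) • st x)
    (st_proper : ∀ x, x * st x = 0 → x = 0) (he : ∀ i < N, st (e i) = e i)
    (φ : ℕ → A →ₗ[ℂ] ℂ) (hφ : ∀ n < N, ∀ i < n, ∀ x, φ n (e i * x) = 0)
    (hφ' : ∀ n < N, φ n (e n) ≠ 0) {n : ℕ} (hn : n < N) : 0 < quantumRatio r n * r := by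
  -- The idempotents differ from one by terms starting with an earlier generator, which `φ m` kills.
  -- So `φ m` does not see left multiplication by them, and `p * e n` and `q * e n` are nonzero.
  -- Positivity at each stage permits the next division.
  have key : ∀ n, n < N → ∃ p q, IsJonesWenzl r e N n p q ∧ st p = p ∧ st q = q ∧
      (∀ m, n ≤ m → m < N → ∀ x, φ m (p * x) = φ m x) ∧
      (∀ m, n ≤ m → m < N → ∀ x, φ m (q * x) = φ m x) ∧ 0 < quantumRatio r n * r := by
    have fin : ∀ n, n < N → ∀ p q, IsJonesWenzl r e N n p q → st p = p → st q = q →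
      (∀ m, n ≤ m → m < N → ∀ x, φ m (p * x) = φ m x) →
      (∀ m, n ≤ m → m < N → ∀ x, φ m (q * x) = φ m x) → 0 < quantumRatio r n * r := by
      intro n hn p q hp h1 h2 h3 h4
      refine hp.ratio_pos hr (h.sq n hn) st_mul st_smul st_proper (he n hn) h1 h2 ?_ ?_
      · intro h5
        have h6 := h4 n le_rfl hn (e n)
        rw [h5, map_zero] at h6
        exact hφ' n hn h6.symm
      · intro h5
        have h6 := h3 n le_rfl hn (e n)
        rw [h5, map_zero] at h6
        exact hφ' n hn h6.symm
    intro n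
    induction n with
    | zero =>
      intro hn
      have h1 : ∀ m, 0 ≤ m → m < N → ∀ x, φ m (1 * x) = φ m x := fun m _ _ x => by rw [one_mul]
      exact ⟨1, 1, h.isJonesWenzl_zero hn, st_one, st_one, h1, h1,
        fin 0 hn 1 1 (h.isJonesWenzl_zero hn) st_one st_one h1 h1⟩
    | succ n ih =>
      intro hn
      obtain ⟨p, q, hp, h1, -, h3, -, h5⟩ := ih (by omega)
      have h0 : quantumRatio r n ≠ 0 := left_ne_zero_of_mul h5.ne'
      have hp' := h.isJonesWenzl_succ hn hp h0
      have h6 : st (p - ((quantumRatio r n : ℂ))⁻¹ • (p * e n * p)) =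
          p - ((quantumRatio r n : ℂ))⁻¹ • (p * e n * p) := by
        rw [map_sub, st_smul, st_mul, st_mul, h1, he n (by omega), map_inv₀, Complex.conj_ofReal,
          mul_assoc]
      have h7 : ∀ m, n + 1 ≤ m → m < N → ∀ x,
          φ m ((p - ((quantumRatio r n : ℂ))⁻¹ • (p * e n * p)) * x) = φ m x := by
        intro m hm hmN x
        rw [sub_mul, smul_mul_assoc, map_sub, map_smul, mul_assoc, mul_assoc, h3 m (by omega) hmN,
          h3 m (by omega) hmN, hφ m hmN n (by omega), smul_zero, sub_zero]
      have h8 : ∀ m, n + 1 ≤ m → m < N → ∀ x, φ m (p * x) = φ m x :=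
        fun m hm => h3 m (by omega)
      exact ⟨_, _, hp', h6, h1, h7, h8, fin _ hn _ _ hp' h6 h1 h7 h8⟩
  obtain ⟨p, q, -, -, -, -, -, h1⟩ := key n hn
  exact h1

end JonesWenzl

end KauffmanDiagrams

namespace KauffmanDiagrams
open CategoryTheory MonoidalCategory

/-! ### The Temperley-Lieb generators -/

/-- A word in which the two letters alternate. -/
def IsAlternatingWord (w : Word) : Prop :=
  ∀ (n : ℕ) (h : n + 1 < w.length),
    (w.get ⟨n + 1, h⟩).sign = -(w.get ⟨n, Nat.lt_of_succ_lt h⟩).sign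

lemma exists_isAlternatingWord (N : ℕ) : ∃ w : Word, w.length = N ∧ IsAlternatingWord w := by
  refine ⟨List.ofFn fun i : Fin N => if Even (i : ℕ) then .X else .Xstar, List.length_ofFn,
    fun n h => ?_⟩
  simp only [List.get_ofFn, Fin.val_cast, Nat.even_add_one]
  by_cases hn : Even n <;> simp [hn, Letter.sign]

section Hook

variable {w : Word} (hw : IsAlternatingWord w) {n : ℕ} (h : n + 1 < w.length)

/-- The diagram joining the points number `n` and `n + 1` above and below, all other strings being
vertical. -/
def hook : Diagram w w where
  partner := Sum.elim
    (fun k => if (k : ℕ) = n then .inl ⟨n + 1, h⟩ else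
      if (k : ℕ) = n + 1 then .inl ⟨n, Nat.lt_of_succ_lt h⟩ else .inr k)
    (fun k => if (k : ℕ) = n then .inr ⟨n + 1, h⟩ else
      if (k : ℕ) = n + 1 then .inr ⟨n, Nat.lt_of_succ_lt h⟩ else .inl k)
  partner_partner p := by
    rcases p with k | k <;> simp only [Sum.elim_inl, Sum.elim_inr] <;> split_ifs <;>
      simp_all [Fin.ext_iff]
  oriented p := by
    have h0 := hw n h
    rcases p with ⟨k, hk⟩ | ⟨k, hk⟩ <;> simp only [Sum.elim_inl, Sum.elim_inr] <;>
      split_ifs with h1 h2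
    · subst h1; exact h0
    · subst h2; simp only [charge, h0, neg_neg]
    · rfl
    · subst h1; simp only [charge, h0]
    · subst h2; simp only [charge, h0, neg_neg]
    · simp only [charge, neg_neg]
  planar p q := by
    rcases p with ⟨k, hk⟩ | ⟨k, hk⟩ <;> rcases q with ⟨m, hm⟩ | ⟨m, hm⟩ <;>
      simp only [Sum.elim_inl, Sum.elim_inr] <;> split_ifs <;>
      simp only [pos, Fin.val_rev] at * <;> omega

lemma hook_reflect : (hook hw h).reflect = hook hw h := by
  ext p : 2
  rcases p with k | k <;> simp only [Diagram.reflect, hook, Sum.swap_inl, Sum.swap_inr,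
    Sum.elim_inl, Sum.elim_inr] <;> split_ifs <;> rfl

lemma hook_sharp : (hook hw h).sharp = 0 := by
  have := (hook hw h).two_mul_sharp
  omega

lemma hook_mat (f g : Fin w.length → Bool) : (hook hw h).mat f g =
    if f ⟨n, Nat.lt_of_succ_lt h⟩ = f ⟨n + 1, h⟩ ∧ g ⟨n, Nat.lt_of_succ_lt h⟩ = g ⟨n + 1, h⟩ ∧
      ∀ k : Fin w.length, (k : ℕ) ≠ n → (k : ℕ) ≠ n + 1 → f k = g k then 1 else 0 := by
  classical
  unfold Diagram.mat
  congr 1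
  refine propext ⟨fun hc => ⟨?_, ?_, fun k h1 h2 => ?_⟩, fun ⟨h1, h2, h3⟩ p => ?_⟩
  · simpa [hook] using (hc (.inl ⟨n, Nat.lt_of_succ_lt h⟩)).symm
  · simpa [hook] using (hc (.inr ⟨n, Nat.lt_of_succ_lt h⟩)).symm
  · simpa [hook, h1, h2] using hc (.inr k)
  · rcases p with ⟨k, hk⟩ | ⟨k, hk⟩ <;> simp only [hook, Sum.elim_inl, Sum.elim_inr] <;>
      split_ifs with h4 h5 <;> simp only [Sum.elim_inl, Sum.elim_inr]
    · subst h4; exact h1.symm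
    · subst h5; exact h1
    · exact (h3 _ h4 h5).symm
    · subst h4; exact h2.symm
    · subst h5; exact h2
    · exact h3 _ h4 h5

/-- Recolouring of the points number `n` and `n + 1`. -/
def recolour (n : ℕ) (f : Fin w.length → Bool) (c : Bool) : Fin w.length → Bool :=
  fun k => if (k : ℕ) = n ∨ (k : ℕ) = n + 1 then c else f k

/-- The upper arc constrains the row `f`; the lower arc leaves one free colour for the intermediate
colouring. The relations between hooks follow by comparing such matrices, without tracing strings.
-/
lemma hook_mat_mul (M : Matrix (Fin w.length → Bool) (Fin w.length → Bool) ℕ)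
    (f g : Fin w.length → Bool) : ((hook hw h).mat * M) f g =
      if f ⟨n, Nat.lt_of_succ_lt h⟩ = f ⟨n + 1, h⟩ then ∑ c, M (recolour n f c) g else 0 := by
  rw [Matrix.mul_apply]
  split_ifs with h1
  · refine (Finset.sum_of_injOn (recolour n f) ?_ (fun _ _ => Finset.mem_univ _) ?_ ?_).symm
    · intro a _ b _ hab
      simpa [recolour] using congrFun hab ⟨n, Nat.lt_of_succ_lt h⟩
    · intro x _ hx
      rw [hook_mat, if_neg, zero_mul]
      rintro ⟨-, h2, h3⟩
      refine hx ⟨x ⟨n, Nat.lt_of_succ_lt h⟩, Finset.mem_coe.2 (Finset.mem_univ _), ?_⟩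
      funext ⟨k, hk⟩
      simp only [recolour]
      split_ifs with h4
      · rcases h4 with rfl | rfl
        · rfl
        · exact h2
      · rw [not_or] at h4
        exact h3 _ h4.1 h4.2
    · intro c _
      rw [hook_mat, if_pos, one_mul]
      refine ⟨h1, by simp [recolour], fun k h2 h3 => by simp [recolour, h2, h3]⟩
  · refine Finset.sum_eq_zero fun x _ => ?_
    rw [hook_mat, if_neg fun h2 => h1 h2.1, zero_mul]

lemma hook_mul_self : (hook hw h).loops (hook hw h) = 1 ∧
    (hook hw h).comp (hook hw h) = hook hw h := by
  refine Diagram.mat_ext ?_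
  rw [← Diagram.mat_mul]
  ext f g
  rw [hook_mat_mul, Matrix.smul_apply, hook_mat, ite_and]
  split_ifs with h1 h2
  · have h3 : ∀ c, (hook hw h).mat (recolour n f c) g = 1 := fun c => by
      rw [hook_mat, if_pos]
      exact ⟨by simp [recolour], h2.1, fun k h3 h4 => by simpa [recolour, h3, h4] using h2.2 k h3 h4⟩
    simp [h3]
  · refine (Finset.sum_eq_zero fun c _ => ?_).trans (smul_zero _).symm
    rw [hook_mat, if_neg]
    exact fun h3 => h2 ⟨h3.2.1, fun k h4 h5 => by simpa [recolour, h4, h5] using h3.2.2 k h4 h5⟩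
  · rw [smul_zero]

/-- For distant hooks the entry is symmetric in `n` and `m`, which yields commutation. -/
lemma hook_mat_mul_hook {m : ℕ} (hm : m + 1 < w.length) (hnm : n + 2 ≤ m ∨ m + 2 ≤ n)
    (f g : Fin w.length → Bool) : ((hook hw h).mat * (hook hw hm).mat) f g =
      if (f ⟨n, Nat.lt_of_succ_lt h⟩ = f ⟨n + 1, h⟩ ∧ f ⟨m, Nat.lt_of_succ_lt hm⟩ = f ⟨m + 1, hm⟩) ∧
        (g ⟨n, Nat.lt_of_succ_lt h⟩ = g ⟨n + 1, h⟩ ∧ g ⟨m, Nat.lt_of_succ_lt hm⟩ = g ⟨m + 1, hm⟩) ∧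
        ∀ k : Fin w.length, (k : ℕ) ≠ n → (k : ℕ) ≠ n + 1 → (k : ℕ) ≠ m → (k : ℕ) ≠ m + 1 →
          f k = g k then 1 else 0 := by
  have hf : ∀ c, recolour n f c ⟨m, Nat.lt_of_succ_lt hm⟩ = f ⟨m, Nat.lt_of_succ_lt hm⟩ ∧
      recolour n f c ⟨m + 1, hm⟩ = f ⟨m + 1, hm⟩ := fun c => by
    constructor <;> exact if_neg (by simp only; omega)
  have hn : ∀ c, recolour n f c ⟨n, Nat.lt_of_succ_lt h⟩ = c ∧ recolour n f c ⟨n + 1, h⟩ = c :=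
    fun c => ⟨if_pos (Or.inl rfl), if_pos (Or.inr rfl)⟩
  rw [hook_mat_mul]
  split_ifs with h1 h2 h2
  · rw [Finset.sum_eq_single (g ⟨n, Nat.lt_of_succ_lt h⟩)]
    · obtain ⟨⟨-, h3⟩, ⟨h4, h5⟩, h6⟩ := h2
      rw [hook_mat, if_pos]
      rw [(hf _).1, (hf _).2]
      refine ⟨h3, h5, fun ⟨k, hk⟩ h7 h8 => ?_⟩
      by_cases h9 : k = n
      · subst h9; exact (hn _).1
      by_cases h10 : k = n + 1
      · subst h10; exact (hn _).2.trans h4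
      · exact (if_neg (by simp [h9, h10])).trans (h6 _ h9 h10 h7 h8)
    · intro c _ hc
      rw [hook_mat, if_neg]
      rintro ⟨-, -, h3⟩
      have h4 := h3 ⟨n, Nat.lt_of_succ_lt h⟩ (by simp only; omega) (by simp only; omega)
      rw [(hn c).1] at h4
      exact hc h4
    · exact fun h3 => absurd (Finset.mem_univ _) h3
  · refine Finset.sum_eq_zero fun c _ => ?_
    rw [hook_mat, if_neg]
    rintro ⟨h3, h4, h5⟩
    rw [(hf _).1, (hf _).2] at h3
    refine h2 ⟨⟨h1, h3⟩, ⟨?_, h4⟩, fun k h6 h7 h8 h9 => ?_⟩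
    · rw [← h5 _ (by simp only; omega) (by simp only; omega),
        ← h5 ⟨n + 1, h⟩ (by simp only; omega) (by simp only; omega), (hn c).1, (hn c).2]
    · rw [← h5 k h8 h9]
      exact (if_neg (by simp [h6, h7])).symm
  · exact absurd h2.1.1 h1
  · rfl

lemma hook_comm {m : ℕ} (hm : m + 1 < w.length) (hnm : n + 2 ≤ m) :
    (hook hw h).loops (hook hw hm) = (hook hw hm).loops (hook hw h) ∧
      (hook hw h).comp (hook hw hm) = (hook hw hm).comp (hook hw h) := by
  refine Diagram.mat_ext ?_
  rw [← Diagram.mat_mul, ← Diagram.mat_mul]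
  ext f g
  rw [hook_mat_mul_hook hw h hm (Or.inl hnm), hook_mat_mul_hook hw hm h (Or.inr hnm)]
  congr 1
  refine propext ⟨fun ⟨h1, h2, h3⟩ => ⟨h1.symm, h2.symm, fun k a b c d => h3 k c d a b⟩,
    fun ⟨h1, h2, h3⟩ => ⟨h1.symm, h2.symm, fun k a b c d => h3 k c d a b⟩⟩

lemma hook_mul_hook_mul_hook (h' : n + 1 + 1 < w.length) :
    (hook hw h').loops (hook hw h) + ((hook hw h').comp (hook hw h)).loops (hook hw h') = 0 ∧
      ((hook hw h').comp (hook hw h)).comp (hook hw h') = hook hw h' := by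
  refine Diagram.mat_ext ?_
  rw [pow_add, ← smul_smul, ← Diagram.mat_mul, ← Matrix.smul_mul, ← Diagram.mat_mul, pow_zero,
    one_smul, Matrix.mul_assoc]
  ext f g
  have e1 : ∀ c, recolour (n + 1) f c ⟨n, Nat.lt_of_succ_lt h⟩ = f ⟨n, Nat.lt_of_succ_lt h⟩ :=
    fun c => if_neg (by simp only; omega)
  have e2 : ∀ c, recolour (n + 1) f c ⟨n + 1, h⟩ = c := fun c => if_pos (Or.inl rfl)
  have e3 : ∀ c, recolour (n + 1) f c ⟨n + 1 + 1, h'⟩ = c := fun c => if_pos (Or.inr rfl)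
  have e4 : ∀ c b, recolour n (recolour (n + 1) f c) b ⟨n + 1 + 1, h'⟩ = c := fun c b =>
    (if_neg (by simp only; omega)).trans (e3 c)
  have e5 : ∀ c b, recolour n (recolour (n + 1) f c) b ⟨n + 1, h⟩ = b := fun c b =>
    if_pos (Or.inr rfl)
  have e6 : ∀ c b, recolour n (recolour (n + 1) f c) b ⟨n, Nat.lt_of_succ_lt h⟩ = b := fun c b =>
    if_pos (Or.inl rfl)
  have e7 : ∀ c b (k : Fin w.length), (k : ℕ) ≠ n → (k : ℕ) ≠ n + 1 → (k : ℕ) ≠ n + 1 + 1 →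
      recolour n (recolour (n + 1) f c) b k = f k := fun c b k h1 h2 h3 =>
    (if_neg (by simp [h1, h2])).trans (if_neg (by simp [h2, h3]))
  rw [hook_mat_mul, hook_mat, ite_and]
  split_ifs with h1 h2
  -- The middle hook forces the colour of the first lower arc to be that of `f` at `n`, and the last
  -- hook forces the second intermediate colour to be the same. A single term of value one remains,
  -- so there is no loop.
  · rw [Finset.sum_eq_single (f ⟨n, Nat.lt_of_succ_lt h⟩)]
    · rw [hook_mat_mul, e1, e2, if_pos rfl, Finset.sum_eq_single (f ⟨n, Nat.lt_of_succ_lt h⟩)]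
      · rw [hook_mat, if_pos]
        refine ⟨(e5 _ _).trans (e4 _ _).symm, h2.1, fun ⟨k, hk⟩ h3 h4 => ?_⟩
        by_cases h5 : k = n
        · subst h5
          exact (e6 _ _).trans (h2.2 _ h3 h4)
        · exact (e7 _ _ _ h5 h3 h4).trans (h2.2 _ h3 h4)
      · intro b _ hb
        rw [hook_mat, if_neg]
        rintro ⟨h3, -⟩
        rw [e5, e4] at h3
        exact hb h3
      · exact fun h3 => absurd (Finset.mem_univ _) h3
    · intro c _ hc
      rw [hook_mat_mul, e1, e2, if_neg hc.symm]
    · exact fun h3 => absurd (Finset.mem_univ _) h3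
  · refine Finset.sum_eq_zero fun c _ => ?_
    rw [hook_mat_mul, e1, e2]
    split_ifs with h3
    · refine Finset.sum_eq_zero fun b _ => ?_
      rw [hook_mat, if_neg]
      rintro ⟨h4, h5, h6⟩
      rw [e5, e4] at h4
      refine h2 ⟨h5, fun ⟨k, hk⟩ h7 h8 => ?_⟩
      by_cases h9 : k = n
      · subst h9
        rw [← h6 _ h7 h8, e6, h3, h4]
      · rw [← h6 _ h7 h8, e7 _ _ _ h9 h7 h8]
    · rfl
  · rfl

/-- The colouring with the points up to number `m` in one colour and the others in the other. -/
def stepColour (w : Word) (m : ℕ) : Fin w.length → Bool := fun k => decide ((k : ℕ) ≤ m)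

/-- Both lower points joined by the hook lie on the same side of the step, so alternation fails
along the lower arc. -/
lemma hook_weightMat_stepColour_of_lt (K : ℤ → Bool → ℂ) {m : ℕ} (hnm : n < m)
    (f : Fin w.length → Bool) : (hook hw h).weightMat K f (stepColour w m) = 0 := by
  rw [Diagram.weightMat, Diagram.amplitude, if_neg, zero_div]
  intro hA
  have h1 := hA (.inr ⟨n, Nat.lt_of_succ_lt h⟩)
  have h2 : n + 1 ≤ m := hnm
  simp [hook, stepColour, hnm.le, h2] at h1

/-- The step occurs exactly between the two joined points, above and below, so every string
alternates. -/
lemma hook_weightMat_stepColour_self {K : ℤ → Bool → ℂ} (hK : ∀ c b, K c b ≠ 0) :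
    (hook hw h).weightMat K (stepColour w n) (stepColour w n) ≠ 0 := by
  rw [Diagram.weightMat]
  refine div_ne_zero (Diagram.amplitude_firstEnds_ne_zero hK ?_) (wordWeight_ne_zero hK _)
  rintro (⟨k, hk⟩ | ⟨k, hk⟩) <;> simp only [hook, Sum.elim_inl, Sum.elim_inr] <;>
    split_ifs with h1 h2 <;> simp_all [stepColour]

end Hook

/-! ### Bounding the parameter -/

section Necessity

variable {d : ℂ}

/-- The endomorphism given by a hook, or zero if there is no such hook. -/
noncomputable def hookHom (d : ℂ) {w : Word} (hw : IsAlternatingWord w) (n : ℕ) :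
    End (⟨w⟩ : OrientedKauffman d) :=
  if h : n + 1 < w.length then ofDiagram d (hook hw h) else 0

lemma hookHom_of_lt {w : Word} (hw : IsAlternatingWord w) {n : ℕ} (h : n + 1 < w.length) :
    hookHom d hw n = ofDiagram d (hook hw h) := dif_pos h

lemma temperleyLieb_hookHom {r : ℝ} {w : Word} (hw : IsAlternatingWord w) {N : ℕ}
    (hN : w.length = N + 1) : TemperleyLieb r (hookHom (r : ℂ) hw) N where
  sq i hi := by
    have h : i + 1 < w.length := by omega
    rw [hookHom_of_lt hw h, End.mul_def]
    refine (comp_ofDiagram _ _).trans ?_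
    rw [(hook_mul_self hw h).1, (hook_mul_self hw h).2, pow_one]
  down i hi := by
    have h : i + 1 < w.length := by omega
    have h' : i + 1 + 1 < w.length := by omega
    rw [mul_assoc, hookHom_of_lt hw h, hookHom_of_lt hw h', End.mul_def, End.mul_def]
    have h1 := hook_mul_hook_mul_hook hw h h'
    have h2 := comp_ofDiagram (d := (r : ℂ)) (hook hw h') (hook hw h)
    have h3 := comp_ofDiagram (d := (r : ℂ)) ((hook hw h').comp (hook hw h)) (hook hw h')
    refine (congrArg (· ≫ ofDiagram (r : ℂ) (hook hw h')) h2).trans ?_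
    refine (Linear.smul_comp _ _ _ _ _ _).trans ?_
    rw [h3, smul_smul, ← pow_add, h1.1, h1.2, pow_zero, one_smul]
  comm i j hij hj := by
    have h : i + 1 < w.length := by omega
    have h' : j + 1 < w.length := by omega
    rw [hookHom_of_lt hw h, hookHom_of_lt hw h', End.mul_def, End.mul_def]
    refine (comp_ofDiagram _ _).trans (Eq.trans ?_ (comp_ofDiagram _ _).symm)
    rw [(hook_comm hw h h' hij).1, (hook_comm hw h h' hij).2]

/-- A complex `t` suffices for a multiplicative representation. It remains available for small `d`,
where the representation only has to detect that elements are nonzero. -/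
lemma exists_turnWeight_parameter (d : ℂ) : ∃ t : ℂ, t ≠ 0 ∧ t ^ 2 + (t ^ 2)⁻¹ = d := by
  obtain ⟨q, hq⟩ : ∃ q : ℂ, q ^ 2 - d * q + 1 = 0 := by
    obtain ⟨s, hs⟩ := IsAlgClosed.exists_pow_nat_eq (d ^ 2 / 4 - 1) (n := 2) two_pos
    exact ⟨d / 2 + s, by linear_combination hs⟩
  obtain ⟨t, ht⟩ := IsAlgClosed.exists_pow_nat_eq q (n := 2) two_pos
  have hq0 : q ≠ 0 := by
    rintro rfl
    simp at hq
  refine ⟨t, ?_, ?_⟩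
  · rintro rfl
    exact hq0 (by rw [← ht]; simp)
  · rw [ht]
    field_simp
    linear_combination hq

/-- A C*-structure exists only for real parameters of absolute value at least two. -/
theorem StarStructure.IsCStar.four_le_sq {S : StarStructure (OrientedKauffman d)} (hS : S.IsCStar) :
    ∃ r : ℝ, d = r ∧ r ≠ 0 ∧ 4 ≤ r ^ 2 := by
  obtain ⟨a, r, rfl, har, hstar⟩ := hS.exists_star_eq
  have hr : r ≠ 0 := right_ne_zero_of_mul har.ne'
  refine ⟨r, rfl, hr, ?_⟩
  by_contra hlt
  obtain ⟨n, hn⟩ := exists_quantumRatio_mul_le_zero (not_le.1 hlt)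
  -- A word of length `n + 2` carries the generators number `0` to `n`, the last of which has the
  -- offending ratio.
  obtain ⟨w, hwl, hw⟩ := exists_isAlternatingWord (n + 1 + 1)
  obtain ⟨t, ht, htd⟩ := exists_turnWeight_parameter (r : ℂ)
  have hK := turnWeight_ne_zero (s := 1) one_ne_zero ht
  have hd := sum_turnWeight (s := 1) (d := (r : ℂ)) (one_mul 1) ht (by rw [one_mul]; exact htd)
  have hr' : (r : ℂ) ≠ 0 := by exact_mod_cast hr
  let A : OrientedKauffman (r : ℂ) := ⟨w⟩
  let st : End A →+ End A :=
    { toFun := S.star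
      map_zero' := S.star_zero A A
      map_add' := S.star_add }
  -- The diagonal matrix entry at the colouring with its step after point `m`.
  let φ : ℕ → End A →ₗ[ℂ] ℂ := fun m =>
    (Matrix.entryLinearMap ℂ ℂ (stepColour w m) (stepColour w m)).comp
      (weightHom (turnWeight 1 t) A A)
  refine absurd ((temperleyLieb_hookHom hw hwl).ratio_pos (st := st) hr (S.star_id A)
    (fun x y => S.star_comp y x) (fun c x => S.star_smul c x) (fun x hx => ?_) (fun i hi => ?_) φ
    (fun m hm i hi x => ?_) (fun m hm => ?_) (Nat.lt_succ_self n)) (not_lt.2 hn)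
  -- The product in `End` is composition in the reverse order, so properness is applied to the
  -- adjoint of `x`.
  · have h1 : S.star x ≫ S.star (S.star x) = 0 := (congrArg (S.star x ≫ ·) (S.star_star x)).trans hx
    rw [← S.star_star x, eq_zero_of_comp_star hS h1, S.star_zero]
  · rw [hookHom_of_lt hw (by omega)]
    refine (hstar _ _ _).trans ?_
    rw [hook_sharp, hook_reflect, zpow_zero, one_smul]
  -- For the same reason the matrix of the hook stands on the right, and its column at the step
  -- colouring vanishes.
  · have h1 : weightHom (turnWeight 1 t) A A (hookHom (r : ℂ) hw i * x) = _ :=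
      weightHom_comp hK hd hr' x (hookHom (r : ℂ) hw i)
    change weightHom (turnWeight 1 t) A A (hookHom (r : ℂ) hw i * x) (stepColour w m)
      (stepColour w m) = 0
    rw [h1, Matrix.mul_apply]
    refine Finset.sum_eq_zero fun f _ => ?_
    rw [hookHom_of_lt hw (by omega), weightHom_ofDiagram,
      hook_weightMat_stepColour_of_lt hw _ _ hi, mul_zero]
  · change weightHom (turnWeight 1 t) A A (hookHom (r : ℂ) hw m) (stepColour w m)
      (stepColour w m) ≠ 0
    rw [hookHom_of_lt hw (by omega), weightHom_ofDiagram]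
    exact hook_weightMat_stepColour_self hw _ hK

end Necessity

end KauffmanDiagrams

/-! ### The classification -/

theorem theorem4p2 (d : ℂ) :
    ((∃ S : StarStructure (OrientedKauffman d), S.IsCStar) ↔
      ∃ r : ℝ, d = (r : ℂ) ∧ r ≠ 0 ∧ 4 ≤ r ^ 2) ∧
    ((∃ S : StarStructure (OrientedKauffman d), S.IsCStar) →
      (∀ S T : StarStructure (OrientedKauffman d), S.IsCStar → T.IsCStar → S.Equivalent T) ∧
      ∃ S : StarStructure (OrientedKauffman d), S.IsCStar ∧
        ∀ (w w' : Word) (D : Diagram w w'),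
          S.star (ofDiagram d D) = (d / (‖d‖ : ℂ)) ^ D.sharp • ofDiagram d D.reflect) := by
  refine ⟨⟨fun ⟨S, hS⟩ => hS.four_le_sq, ?_⟩, fun ⟨S, hS⟩ => ⟨fun S T hS hT => hS.equivalent hT, ?_⟩⟩
  · rintro ⟨r, rfl, -, hr⟩
    obtain ⟨S, hS, -⟩ := exists_isCStar hr
    exact ⟨S, hS⟩
  · obtain ⟨r, rfl, -, hr⟩ := hS.four_le_sq
    exact exists_isCStar hr
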